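/- Let $\hat{\mathbb C}=\mathbb C\cup\{\infty\}$ and let $\chi$ be the chordal metric on $\hat{\mathbb C}$, i.e. $\chi(z,w)=\frac{|z-w|}{\sqrt{1+|z|^2}\sqrt{1+|w|^2}}$ and $\chi(z,\infty)=\chi(\infty,z)=\frac1{\sqrt{1+|z|^2}}$ for $z,w\in\mathbb C$, and $\chi(\infty,\infty)=0$. A meromorphic function $f$ on an open set $U\subseteq\mathbb C$ is called locally univalent on $U$ if all its poles in $U$ are simple and $f'(z)\ne 0$ for all $z\in U$ with $f(z)\neq\infty$; in particular, a holomorphic function $f$ on $U$ is locally univalent if $f'$ has no zeros in $U$. For $M\subseteq\mathbb C$ let $\mathcal H_{l.u.}(M)$, respectively $\mathcal M_{l.u.}(M)$, be the set of all functions that are holomorphic, respectively meromorphic, and locally univalent on some open neighbourhood of $M$ in $\mathbb C$ (which may depend on the function). Let $\Omega$ be a domain in $\mathbb C$ and let $K\subseteq\Omega$ be a compact set such that no connected component of $\Omega\setminus K$ is relatively compact in $\Omega$. Then: (a) for every $f\in\mathcal H_{l.u.}(K)$ and every $\varepsilon>0$ there is $g\in\mathcal H_{l.u.}(\Omega)$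 with $|g(z)-f(z)|<\varepsilon$ for all $z\in K$; (b) if $\mathbb C\setminus K$ is connected, then for every $f\in\mathcal M_{l.u.}(K)$ and every $\varepsilon>0$ there is $g\in\mathcal M_{l.u.}(\mathbb C)$ with $\chi(g(z),f(z))<\varepsilon$ for all $z\in K$. -/

import Mathlib

open Set Filter Topology

noncomputable section

namespace LocUniv

/-- The Riemann sphere `ℂ ∪ {∞}`, with its usual topology. -/
abbrev Sphere : Type := OnePoint ℂ

/-- The chordal metric on the Riemann sphere. -/
def chordal : Sphere → Sphere → ℝ
  | OnePoint.some z, OnePoint.some w => ‖z - w‖ / (√(1 + ‖z‖ ^ 2) * √(1 + ‖w‖ ^ 2))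
  | OnePoint.some z, OnePoint.infty => 1 / √(1 + ‖z‖ ^ 2)
  | OnePoint.infty, OnePoint.some w => 1 / √(1 + ‖w‖ ^ 2)
  | OnePoint.infty, OnePoint.infty => 0

/-- The complex-valued representative of a sphere-valued function; the value at the poles is `0`,
an arbitrary choice. -/
def finitePart (f : ℂ → Sphere) (z : ℂ) : ℂ :=
  (f z).elim 0 id

/-- `f` is meromorphic on `U`, as a map into the Riemann sphere: the poles are isolated, `f` is
meromorphic as a complex-valued function away from them, and the value of `f` at each
point of `U` is the limit of `f` there (in particular `∞` exactly at the poles). -/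
def MeroOn (f : ℂ → Sphere) (U : Set ℂ) : Prop :=
  ∀ z ∈ U, (∀ᶠ w in 𝓝[≠] z, f w ≠ OnePoint.infty) ∧
    MeromorphicAt (finitePart f) z ∧ ContinuousAt f z

/-- `f` is a locally univalent meromorphic function on the open set `U`: it has at most simple
poles, and its derivative does not vanish at the points that are not poles. -/
def MeroLocUnivOn (f : ℂ → Sphere) (U : Set ℂ) : Prop :=
  MeroOn f U ∧
    (∀ z ∈ U, f z = OnePoint.infty →
      ((-1 : ℤ) : WithTop ℤ) ≤ meromorphicOrderAt (finitePart f) z) ∧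
    ∀ z ∈ U, f z ≠ OnePoint.infty → deriv (finitePart f) z ≠ 0

/-- `f` is a locally univalent holomorphic function on the open set `U`. -/
def HolLocUnivOn (f : ℂ → ℂ) (U : Set ℂ) : Prop :=
  DifferentiableOn ℂ f U ∧ ∀ z ∈ U, deriv f z ≠ 0

/-- The functions that are holomorphic and locally univalent on some open neighbourhood of `M`. -/
def HLU (M : Set ℂ) : Set (ℂ → ℂ) :=
  {f | ∃ U : Set ℂ, IsOpen U ∧ M ⊆ U ∧ HolLocUnivOn f U}

/-- The functions that are meromorphic and locally univalent on some open neighbourhood of `M`. -/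
def MLU (M : Set ℂ) : Set (ℂ → Sphere) :=
  {f | ∃ U : Set ℂ, IsOpen U ∧ M ⊆ U ∧ MeroLocUnivOn f U}

/-- `A` is relatively compact in `Ω`. -/
def RelCompactIn (A Ω : Set ℂ) : Prop :=
  IsCompact (closure A) ∧ closure A ⊆ Ω

end LocUniv

end

/-! Both parts reduce to one differential equation with a free parameter function. If `f` is locally
univalent near `K`, then `f'` has no zeros there. Because `K` has no holes relative to `Ω`, one can
write `f' = R exp u` near `K`, with `R` holomorphic and zero-free in all of `Ω`
(`expFactor_of_ne_zero`). Any `s` holomorphic in `Ω` then gives a zero-free function `R exp s`.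
Making `s` close to `u` is ordinary Runge approximation; the difficulty is that `R exp s` must have
a primitive, a nonlinear condition on its periods.

For meromorphic `f = φ / q`, with `q` the product of `z - p` over the simple poles, the zero-free
quantity is the Wronskian `φ' q - φ q'`. Dividing by `q ^ 2` with entire remainders again leads to
an equation `g' = theta a r q z (s z)`, regular at the zeros of `q` (`exists_numerator_approx`).
Since `g` is the correction to the quotient itself, uniform closeness of `g` gives chordal
closeness, and the poles stay fixed.

The equation is propagated over a grid, one square `S` at a time (`exists_solNear_insert`). `S` is
chosen next to a square not in the final union; three of its sides are attached to the part already
treated. On these sides `s` is only extended continuously, but with freely prescribed integrals of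
`theta` (`exists_continuous_integral_mul_exp`), so that the vertex values of `f` remain consistent.
The attached sides have area zero and the complement of the resulting set leads out through the
missing side, so a Hartogs–Rosenthal argument with pole pushing (`mem_of_eqOn_holomorphic`,
`cauchyKernel_mem_of_isPreconnected`) approximates the extension by functions holomorphic near all
the squares. This disturbs the finitely many period conditions slightly; a local surjectivity
argument inside the algebra of holomorphic functions restores them
(`exists_mem_near_apply_eq_zero`). The fourth side then takes care of itself by Cauchy's theorem.

The squares lying off the initial region can be added in such an order because `K` is Runge in `Ω`
(`exists_solNear_compact`). Iterating over a compact exhaustion with geometrically decreasing errors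
gives solutions in `Ω` (`exists_sol_approx`). -/

noncomputable section
namespace LocUniv
open MeasureTheory Complex

/-! ### Cauchy–Pompeiu formula and the Hartogs–Rosenthal theorem. -/

/-- The Wirtinger derivative `∂φ/∂z̄`. -/
def dbar (φ : ℂ → ℂ) (z : ℂ) : ℂ := (1 / 2) * (fderiv ℝ φ z 1 + I * fderiv ℝ φ z I)

theorem dbar_eq_zero_of_eventually_differentiable {φ : ℂ → ℂ} {z : ℂ}
    (h : DifferentiableAt ℂ φ z) : dbar φ z = 0 := by
  have h1 : fderiv ℝ φ z = (fderiv ℂ φ z).restrictScalars ℝ := h.fderiv_restrictScalars ℝ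
  have h2 : fderiv ℂ φ z I = I * fderiv ℂ φ z 1 := by
    conv_lhs => rw [show (I : ℂ) = I • (1 : ℂ) by simp, map_smul]
    simp
  simp only [dbar, h1, ContinuousLinearMap.coe_restrictScalars', h2]
  linear_combination (1 / 2) * fderiv ℂ φ z 1 * I_mul_I

theorem continuous_dbar {φ : ℂ → ℂ} (hφ : ContDiff ℝ 1 φ) : Continuous (dbar φ) := by
  have := hφ.continuous_fderiv one_ne_zero
  unfold dbar
  fun_prop

theorem dbar_comp_const_add (φ : ℂ → ℂ) (z w : ℂ) :
    dbar (fun x => φ (z + x)) w = dbar φ (z + w) := by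
  have h : fderiv ℝ (fun x => φ (z + x)) w = fderiv ℝ φ (z + w) :=
    fderiv_comp_add_left z
  simp [dbar, h]

/-- Rotating the frame `1, I` to the radial and angular directions costs only a phase. In polar
coordinates that phase is absorbed by `1 / ζ`, leaving exact derivatives to integrate. -/
theorem dbar_polar (φ : ℂ → ℂ) (z : ℂ) (θ : ℝ) :
    exp (-(θ * I)) * dbar φ z =
      (1 / 2) * (fderiv ℝ φ z (exp (θ * I)) + I * fderiv ℝ φ z (I * exp (θ * I))) := by
  have e1 : exp (θ * I) = (Real.cos θ) • (1 : ℂ) + (Real.sin θ) • I := by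
    simp [exp_mul_I]
  have e2 : I * exp (θ * I) = (-Real.sin θ) • (1 : ℂ) + (Real.cos θ) • I := by
    rw [e1]; simp; linear_combination sin θ * I_mul_I
  have e3 : exp (-(θ * I)) = Real.cos θ - Real.sin θ * I := by
    rw [show -(θ * I) = ((-θ : ℝ) : ℂ) * I by push_cast; ring, exp_mul_I]
    simp [sub_eq_add_neg]
  rw [e2, e1, e3, map_add, map_smul, map_smul, map_add, map_smul, map_smul]
  simp only [real_smul, dbar]
  push_cast
  linear_combination (-(1 / 2) * sin θ * fderiv ℝ φ z I)* I_mul_I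

/-- **Cauchy–Pompeiu formula** for compactly supported functions, at the origin. -/
theorem integral_dbar_div_zero {φ : ℂ → ℂ} (hφ : ContDiff ℝ 1 φ) (hc : HasCompactSupport φ) :
    ∫ ζ, dbar φ ζ / ζ = -(Real.pi * φ 0) := by
  rw [← Complex.integral_comp_polarCoord_symm]
  obtain ⟨R, hR0, hR⟩ : ∃ R : ℝ, 0 < R ∧ ∀ x : ℂ, R < ‖x‖ → fderiv ℝ φ x = 0 ∧ φ x = 0 := by
    obtain ⟨R, hR⟩ := hc.isCompact.isBounded.subset_closedBall (0 : ℂ)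
    refine ⟨max R 1, by positivity, fun x hx => ?_⟩
    have hx' : x ∉ tsupport φ := fun h => by
      have := hR h
      simp only [mem_closedBall_zero_iff] at this
      exact absurd hx (not_lt.mpr (this.trans (le_max_left _ _)))
    exact ⟨by
      have := mt (fun h => support_fderiv_subset ℝ h) hx'
      simpa using this, image_eq_zero_of_notMem_tsupport hx'⟩
  have hfd := hφ.continuous_fderiv one_ne_zero
  set f₁ : ℝ × ℝ → ℂ := fun p => fderiv ℝ φ (p.1 * exp (p.2 * I)) (exp (p.2 * I)) with hf₁
  set f₂ : ℝ × ℝ → ℂ := fun p => fderiv ℝ φ (p.1 * exp (p.2 * I)) (I * exp (p.2 * I)) with hf₂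
  have hf₁c : Continuous f₁ := by
    apply Continuous.clm_apply <;> fun_prop
  have hf₂c : Continuous f₂ := by
    apply Continuous.clm_apply <;> fun_prop
  have hint : ∀ f : ℝ × ℝ → ℂ, Continuous f → (∀ p : ℝ × ℝ, R < p.1 → f p = 0) →
      IntegrableOn f (Ioi 0 ×ˢ Ioo (-Real.pi) Real.pi) := by
    intro f hf h0
    have hk : IntegrableOn f (Icc 0 R ×ˢ Icc (-Real.pi) Real.pi) :=
      hf.continuousOn.integrableOn_compact (isCompact_Icc.prod isCompact_Icc)
    refine hk.of_forall_sdiff_eq_zero (measurableSet_Ioi.prod measurableSet_Ioo) ?_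
    rintro ⟨r, θ⟩ ⟨⟨hr, hθ⟩, hn⟩
    apply h0
    by_contra hlt
    exact hn ⟨⟨le_of_lt hr, not_lt.mp hlt⟩, Ioo_subset_Icc_self hθ⟩
  have hnorm : ∀ p : ℝ × ℝ, R < p.1 → R < ‖(p.1 : ℂ) * exp (p.2 * I)‖ := by
    intro p hp
    rw [norm_mul, norm_exp_ofReal_mul_I, norm_real, mul_one]
    exact hp.trans_le (le_abs_self _)
  have hf₁i := hint f₁ hf₁c (fun p hp => by simp [hf₁, (hR _ (hnorm p hp)).1])
  have hf₂i := hint f₂ hf₂c (fun p hp => by simp [hf₂, (hR _ (hnorm p hp)).1])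
  have hder : ∀ r θ : ℝ, HasFDerivAt φ (fderiv ℝ φ (r * exp (θ * I))) (r * exp (θ * I)) :=
    fun r θ => (hφ.differentiable one_ne_zero _).hasFDerivAt
  -- Along each ray the radial term is an exact derivative; compact support leaves only the value at
  -- the origin.
  have h₁ : ∫ p in Ioi 0 ×ˢ Ioo (-Real.pi) Real.pi, f₁ p = -(2 * Real.pi * φ 0) := by
    rw [Measure.volume_eq_prod, setIntegral_prod_swap _ _ f₁ |>.symm] at *
    rw [setIntegral_prod]
    · have : ∀ θ : ℝ, ∫ r in Ioi (0 : ℝ), f₁ (r, θ) = -φ 0 := by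
        intro θ
        have hd : ∀ r : ℝ, HasDerivAt (fun r : ℝ => φ (r * exp (θ * I))) (f₁ (r, θ)) r := by
          intro r
          have h := ((hasDerivAt_id r).ofReal_comp.mul_const (exp (θ * I)))
          have := (hder r θ).comp_hasDerivAt r h
          rw [show f₁ (r, θ) = fderiv ℝ φ (r * exp (θ * I)) ((1 : ℝ) * exp (θ * I)) by simp [hf₁]]
          exact this
        have := integral_Ioi_of_hasDerivAt_of_tendsto' (a := (0 : ℝ)) (m := (0 : ℂ))
          (fun r _ => hd r) ?_ ?_
        · simpa using this
        · have hk : IntegrableOn (fun r => f₁ (r, θ)) (Icc 0 R) :=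
            (hf₁c.comp (by fun_prop)).continuousOn.integrableOn_compact isCompact_Icc
          refine hk.of_forall_sdiff_eq_zero measurableSet_Ioi ?_
          rintro r ⟨hr, hn⟩
          have : R < r := by
            by_contra hlt
            exact hn ⟨le_of_lt hr, not_lt.mp hlt⟩
          simp [hf₁, (hR _ (hnorm (r, θ) this)).1]
        · refine tendsto_const_nhds.congr' ?_
          filter_upwards [eventually_gt_atTop R] with r hr
          exact (hR _ (hnorm (r, θ) hr)).2.symm
      simp only [Prod.swap_prod_mk, this]
      simp [Real.pi_pos.le, two_mul]
    · have := hf₁i.swap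
      exact this
  -- The angular term is `1 / r` times a derivative in `θ`, so it integrates to zero over a full
  -- circle.
  have h₂ : ∫ p in Ioi 0 ×ˢ Ioo (-Real.pi) Real.pi, f₂ p = 0 := by
    rw [Measure.volume_eq_prod] at *
    rw [setIntegral_prod _ hf₂i]
    refine (setIntegral_congr_fun measurableSet_Ioi (g := fun _ => 0) ?_).trans (by simp)
    intro r hr
    have hr0 : (r : ℂ) ≠ 0 := by exact_mod_cast (ne_of_gt hr)
    have hd : ∀ θ : ℝ, HasDerivAt (fun θ : ℝ => (1 / (r : ℂ)) * φ (r * exp (θ * I)))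
        (f₂ (r, θ)) θ := by
      intro θ
      have h := (((hasDerivAt_id θ).ofReal_comp.mul_const I).cexp.const_mul (r : ℂ))
      have := ((hder r θ).comp_hasDerivAt θ h).const_mul (1 / (r : ℂ))
      have e : f₂ (r, θ) = 1 / (r : ℂ) * fderiv ℝ φ (r * exp (θ * I))
          (r * (exp (θ * I) * ((1 : ℝ) * I))) := by
        rw [show (r : ℂ) * (exp (θ * I) * ((1 : ℝ) * I)) = r • (I * exp (θ * I)) by
          rw [real_smul]; push_cast; ring, map_smul, real_smul]
        field_simp
        rfl
      rw [e]
      exact this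
    have := intervalIntegral.integral_eq_sub_of_hasDerivAt (a := -Real.pi) (b := Real.pi)
      (fun θ _ => hd θ) ((hf₂c.comp (by fun_prop)).intervalIntegrable _ _)
    change ∫ y in Ioo (-Real.pi) Real.pi, f₂ (r, y) = 0
    rw [← integral_Ioc_eq_integral_Ioo,
      ← intervalIntegral.integral_of_le (by linarith [Real.pi_pos]), this]
    simp [exp_neg]
  have key : ∀ p ∈ polarCoord.target, p.1 • (dbar φ (Complex.polarCoord.symm p) /
      Complex.polarCoord.symm p) = (1 / 2) * (f₁ p + I * f₂ p) := by
    rintro ⟨r, θ⟩ hp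
    have hr : 0 < r := hp.1
    have hr0 : (r : ℂ) ≠ 0 := by exact_mod_cast hr.ne'
    have hpc : Complex.polarCoord.symm (r, θ) = r * exp (θ * I) := by
      rw [Complex.polarCoord_symm_apply, exp_mul_I]
      simp
    rw [hpc]
    have := dbar_polar φ (r * exp (θ * I)) θ
    simp only [hf₁, hf₂]
    rw [← this, exp_neg, real_smul]
    field_simp [exp_ne_zero]
  rw [setIntegral_congr_fun (s := polarCoord.target)
    (measurableSet_Ioi.prod measurableSet_Ioo) key]
  have : IntegrableOn (fun p => I * f₂ p) (Ioi 0 ×ˢ Ioo (-Real.pi) Real.pi) := hf₂i.const_mul I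
  change ∫ p in Ioi 0 ×ˢ Ioo (-Real.pi) Real.pi, _ = _
  rw [integral_const_mul, integral_add hf₁i this, integral_const_mul, h₁, h₂]
  ring

/-- **Cauchy–Pompeiu formula** for compactly supported functions. -/
theorem integral_dbar_div {φ : ℂ → ℂ} (hφ : ContDiff ℝ 1 φ) (hc : HasCompactSupport φ) (z : ℂ) :
    ∫ ζ, dbar φ ζ / (z - ζ) = Real.pi * φ z := by
  have h := integral_dbar_div_zero (φ := fun x => φ (z + x)) (hφ.comp (by fun_prop))
    (hc.comp_homeomorph (Homeomorph.addLeft z))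
  simp only [dbar_comp_const_add, add_zero] at h
  have h2 := integral_add_left_eq_self (μ := volume) (fun ζ => dbar φ ζ / (z - ζ)) z
  rw [← h2]
  simp only [sub_add_cancel_left, div_neg, integral_neg, h, neg_neg]

/-- The polar Jacobian cancels the singularity, so the integrand is at most the indicator of a
rectangle of area `2πρ`. -/
theorem lintegral_ball_inv_norm_le {ρ : ℝ} (hρ : 0 ≤ ρ) :
    ∫⁻ ζ in Metric.ball (0 : ℂ) ρ, ENNReal.ofReal ‖ζ‖⁻¹ ≤ ENNReal.ofReal (2 * Real.pi * ρ) := by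
  rw [← lintegral_indicator Metric.isOpen_ball.measurableSet,
    ← Complex.lintegral_comp_polarCoord_symm]
  have hle : ∀ p ∈ polarCoord.target, ENNReal.ofReal p.1 •
      (Metric.ball (0 : ℂ) ρ).indicator (fun ζ => ENNReal.ofReal ‖ζ‖⁻¹)
        (Complex.polarCoord.symm p) ≤ (Ioo 0 ρ ×ˢ Ioo (-Real.pi) Real.pi).indicator 1 p := by
    rintro ⟨r, θ⟩ hp
    have hr : 0 < r := hp.1
    by_cases h : r < ρ
    · rw [indicator_of_mem (show (r, θ) ∈ Ioo 0 ρ ×ˢ Ioo (-Real.pi) Real.pi from ⟨⟨hr, h⟩, hp.2⟩)]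
      refine (mul_le_mul_right (indicator_le_self _ _ _) _).trans ?_
      rw [Complex.norm_polarCoord_symm, ← ENNReal.ofReal_mul hr.le, abs_of_pos hr,
        mul_inv_cancel₀ hr.ne']
      simp
    · rw [indicator_of_notMem]
      · simp
      · simpa [abs_of_pos hr] using h
  refine (setLIntegral_mono' (measurableSet_Ioi.prod measurableSet_Ioo) hle).trans ?_
  refine (setLIntegral_le_lintegral _ _).trans ?_
  rw [lintegral_indicator_one (measurableSet_Ioo.prod measurableSet_Ioo), Measure.volume_eq_prod,
    Measure.prod_prod, Real.volume_Ioo, Real.volume_Ioo, ← ENNReal.ofReal_mul (by linarith)]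
  exact ENNReal.ofReal_le_ofReal (by linarith)

/-- The Cauchy potential of a small set is uniformly small. -/
theorem setLIntegral_inv_norm_sub_le (S : Set ℂ) (z : ℂ) {ρ : ℝ} (hρ : 0 < ρ) :
    ∫⁻ ζ in S, ENNReal.ofReal ‖z - ζ‖⁻¹ ≤
      ENNReal.ofReal (2 * Real.pi * ρ) + ENNReal.ofReal ρ⁻¹ * volume S := by
  have h1 : ∀ ζ, ENNReal.ofReal ‖z - ζ‖⁻¹ ≤
      (Metric.ball z ρ).indicator (fun ζ => ENNReal.ofReal ‖z - ζ‖⁻¹) ζ + ENNReal.ofReal ρ⁻¹ := by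
    intro ζ
    by_cases h : ζ ∈ Metric.ball z ρ
    · rw [indicator_of_mem h]; exact le_self_add
    · rw [indicator_of_notMem h, zero_add]
      apply ENNReal.ofReal_le_ofReal
      rw [Metric.mem_ball, dist_comm, dist_eq_norm, not_lt] at h
      exact inv_anti₀ hρ h
  refine (lintegral_mono h1).trans ?_
  rw [lintegral_add_right _ measurable_const, setLIntegral_const]
  gcongr
  refine (setLIntegral_le_lintegral _ _).trans ?_
  rw [lintegral_indicator Metric.isOpen_ball.measurableSet]
  refine le_trans (le_of_eq ?_) (lintegral_ball_inv_norm_le hρ.le)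
  rw [← lintegral_indicator Metric.isOpen_ball.measurableSet,
    ← lintegral_indicator Metric.isOpen_ball.measurableSet,
    ← lintegral_add_left_eq_self (μ := volume) _ z]
  congr 1
  ext ζ
  by_cases h : ‖ζ‖ < ρ <;> simp [indicator, h]

/-- The Cauchy kernels `z ↦ (z - ζ)⁻¹` on `E`, as a continuous family in `ζ ∉ E`. -/
def cauchyKernel (E : Set ℂ) : C(↥Eᶜ, C(E, ℂ)) :=
  ContinuousMap.curry ⟨fun p => ((p.2 : ℂ) - p.1)⁻¹, by
    refine Continuous.inv₀ (by fun_prop) fun p h => p.1.2 ?_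
    rw [← sub_eq_zero.mp h]
    exact p.2.2⟩

@[simp]
theorem cauchyKernel_apply (E : Set ℂ) (ζ : ↥Eᶜ) (z : E) :
    cauchyKernel E ζ z = ((z : ℂ) - ζ)⁻¹ := rfl

open Classical in
/-- **Hartogs–Rosenthal**: a closed subspace of `C(E)` that contains the Cauchy kernels contains
the smooth functions that are holomorphic outside a set whose trace on `E` is negligible. -/
theorem mem_of_cauchyKernel_mem {E : Set ℂ} [CompactSpace E] (X : Submodule ℂ C(E, ℂ))
    (hX : IsClosed (X : Set C(E, ℂ))) (hk : ∀ ζ : ↥Eᶜ, cauchyKernel E ζ ∈ X)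
    {φ : ℂ → ℂ} (hφ : ContDiff ℝ 1 φ) (hc : HasCompactSupport φ)
    (hnull : volume (E ∩ tsupport (dbar φ)) = 0) (ψ : C(E, ℂ)) (hψ : ∀ z, ψ z = φ z) :
    ψ ∈ X := by
  have hE : IsCompact E := isCompact_iff_compactSpace.mpr ‹_›
  have hdc := continuous_dbar hφ
  set T := tsupport (dbar φ) with hT
  have hTc : IsCompact T := by
    refine hc.isCompact.of_isClosed_subset (isClosed_tsupport _) ?_
    refine closure_minimal (fun x hx => ?_) (isClosed_tsupport _)
    by_contra hx'
    have : fderiv ℝ φ x = 0 := by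
      have := mt (fun h => support_fderiv_subset ℝ h) hx'
      simpa using this
    exact hx (by simp [dbar, this])
  obtain ⟨M, hM0, hM⟩ : ∃ M : ℝ, 0 < M ∧ ∀ x, ‖dbar φ x‖ ≤ M := by
    obtain ⟨M, hM⟩ := hTc.exists_bound_of_continuousOn hdc.continuousOn
    refine ⟨max M 1, by positivity, fun x => ?_⟩
    by_cases hx : x ∈ T
    · exact (hM x hx).trans (le_max_left _ _)
    · rw [image_eq_zero_of_notMem_tsupport hx]; simp
  rw [← SetLike.mem_coe, ← hX.closure_eq, Metric.mem_closure_iff]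
  intro ε hε
  -- Order of choice: `ρ` controls the singular part of the kernel near its pole, and only then is
  -- the area `η` made small against the bound `ρ⁻¹` valid elsewhere.
  obtain ⟨ρ, hρ, hρε⟩ : ∃ ρ : ℝ, 0 < ρ ∧ M / Real.pi * (2 * Real.pi * ρ) < ε / 2 :=
    ⟨ε / (8 * M), by positivity, by
      rw [show M / Real.pi * (2 * Real.pi * (ε / (8 * M))) = ε / 4 by
        field_simp; norm_num]; linarith⟩
  obtain ⟨η, hη, hηε⟩ : ∃ η : ℝ, 0 < η ∧ M / Real.pi * (ρ⁻¹ * η) < ε / 2 :=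
    ⟨ε * ρ * Real.pi / (4 * M), by positivity, by
      rw [show M / Real.pi * (ρ⁻¹ * (ε * ρ * Real.pi / (4 * M))) = ε / 4 by
        field_simp]; linarith⟩
  obtain ⟨V, hVo, hEV, hVv⟩ : ∃ V : Set ℂ, IsOpen V ∧ E ∩ T ⊆ V ∧
      volume V < ENNReal.ofReal η := by
    obtain ⟨V, hV1, hV2, hV3⟩ := (E ∩ T).exists_isOpen_lt_of_lt (μ := volume)
      (ENNReal.ofReal η) (by rw [hnull]; simpa using hη)
    exact ⟨V, hV2, hV1, hV3⟩
  -- the truncated Cauchy transform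
  set F : Set ℂ := T \ V with hF
  have hFc : IsCompact F := hTc.diff hVo
  have hFE : F ⊆ Eᶜ := fun x hx hxE => hx.2 (hEV ⟨hxE, hx.1⟩)
  set k : ℂ → C(E, ℂ) := fun ζ => if h : ζ ∈ Eᶜ then cauchyKernel E ⟨ζ, h⟩ else 0 with hkdef
  have hkX : ∀ ζ, k ζ ∈ X := by
    intro ζ
    by_cases h : ζ ∈ Eᶜ
    · simp only [hkdef, h, dif_pos]; exact hk _
    · simp only [hkdef, h, dif_neg, not_false_eq_true]; exact X.zero_mem
  have hkc : ContinuousOn k Eᶜ := by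
    rw [continuousOn_iff_continuous_domRestrict]
    convert (cauchyKernel E).continuous using 1
    ext1 ζ
    simp only [domRestrict_apply, hkdef, ζ.2, dif_pos]
  set g : ℂ → C(E, ℂ) := fun ζ => ((Real.pi : ℂ)⁻¹ * dbar φ ζ) • k ζ with hg
  have hgi : IntegrableOn g F :=
    ((continuous_const.mul hdc).continuousOn.smul (hkc.mono hFE)).integrableOn_compact hFc
  refine ⟨∫ ζ in F, g ζ, ?_, ?_⟩
  -- An integral of elements of `X` stays in the closed subspace `X`: its image in the quotient is
  -- the integral of zero.
  · have : IsClosed (X : Set C(E, ℂ)) := hX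
    have h := X.mkQL.integral_comp_comm hgi
    rw [SetLike.mem_coe, ← Submodule.Quotient.mk_eq_zero]
    change X.mkQL _ = 0
    rw [← h]
    refine integral_eq_zero_of_ae (Eventually.of_forall fun ζ => ?_)
    change Submodule.Quotient.mk (g ζ) = 0
    rw [Submodule.Quotient.mk_eq_zero]
    exact X.smul_mem _ (hkX ζ)
  · rw [dist_eq_norm]
    refine lt_of_le_of_lt (b := M / Real.pi * (2 * Real.pi * ρ + ρ⁻¹ * η)) ?_ (by linarith)
    rw [ContinuousMap.norm_le _ (by positivity)]
    intro z
    have hev : (∫ ζ in F, g ζ) z = ∫ ζ in F, (Real.pi : ℂ)⁻¹ * (dbar φ ζ / (z - ζ)) := by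
      have := (ContinuousMap.evalCLM ℂ z).integral_comp_comm hgi
      change (ContinuousMap.evalCLM ℂ z) _ = _
      rw [← this]
      refine setIntegral_congr_fun hFc.measurableSet fun ζ hζ => ?_
      have : ζ ∈ Eᶜ := hFE hζ
      simp [hg, hkdef, (show ζ ∉ E from this), div_eq_mul_inv, mul_assoc]
    have hb : ∀ ζ, ENNReal.ofReal ‖(Real.pi : ℂ)⁻¹ * (dbar φ ζ / (z - ζ))‖ ≤
        ENNReal.ofReal (M / Real.pi) * ENNReal.ofReal ‖(z : ℂ) - ζ‖⁻¹ := by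
      intro ζ
      rw [← ENNReal.ofReal_mul (by positivity)]
      apply ENNReal.ofReal_le_ofReal
      rw [norm_mul, norm_div, norm_inv, norm_real, Real.norm_of_nonneg Real.pi_pos.le,
        div_eq_mul_inv, div_eq_mul_inv, mul_comm M, mul_assoc]
      gcongr
      exact hM ζ
    have hzi : Integrable (fun ζ => (Real.pi : ℂ)⁻¹ * (dbar φ ζ / (z - ζ))) := by
      refine IntegrableOn.integrable_of_forall_notMem_eq_zero (s := T) ⟨?_, ?_⟩ ?_
      · exact (measurable_const.mul
          (hdc.measurable.div (measurable_const.sub measurable_id))).aestronglyMeasurable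
      · rw [hasFiniteIntegral_iff_norm]
        refine (lintegral_mono hb).trans_lt ?_
        rw [lintegral_const_mul' _ _ ENNReal.ofReal_ne_top]
        refine ENNReal.mul_lt_top ENNReal.ofReal_lt_top
          ((setLIntegral_inv_norm_sub_le _ _ one_pos).trans_lt ?_)
        exact ENNReal.add_lt_top.mpr ⟨ENNReal.ofReal_lt_top,
          ENNReal.mul_lt_top ENNReal.ofReal_lt_top hTc.measure_lt_top⟩
      · intro ζ hζ
        rw [image_eq_zero_of_notMem_tsupport hζ]; simp
    have hall : φ z = ∫ ζ in T, (Real.pi : ℂ)⁻¹ * (dbar φ ζ / (z - ζ)) := by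
      rw [setIntegral_eq_integral_of_forall_compl_eq_zero, integral_const_mul,
        integral_dbar_div hφ hc]
      · rw [← mul_assoc, inv_mul_cancel₀ (by exact_mod_cast Real.pi_ne_zero), one_mul]
      · intro ζ hζ
        rw [image_eq_zero_of_notMem_tsupport hζ]; simp
    rw [ContinuousMap.sub_apply, hψ, hev, hall, hF,
      ← integral_inter_add_sdiff hVo.measurableSet hzi.integrableOn, add_sub_cancel_right]
    refine (norm_integral_le_lintegral_norm _).trans ?_
    refine ENNReal.toReal_le_of_le_ofReal (by positivity) ?_
    refine (lintegral_mono hb).trans ?_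
    rw [lintegral_const_mul' _ _ ENNReal.ofReal_ne_top, ENNReal.ofReal_mul (by positivity)]
    gcongr
    refine (setLIntegral_inv_norm_sub_le _ _ hρ).trans ?_
    rw [ENNReal.ofReal_add (by positivity) (by positivity),
      ENNReal.ofReal_mul (p := ρ⁻¹) (by positivity)]
    gcongr
    exact (measure_mono inter_subset_right).trans hVv.le

end LocUniv

end

/-! ### Approximation in closed subspaces and subalgebras of `C(E)`. -/

noncomputable section
namespace LocUniv
open MeasureTheory Complex

theorem exists_contDiff_cutoff {L U : Set ℂ} (hL : IsCompact L) (hU : IsOpen U) (hLU : L ⊆ U) :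
    ∃ χ : ℂ → ℝ, ContDiff ℝ 1 χ ∧ HasCompactSupport χ ∧ tsupport χ ⊆ U ∧
      (∀ᶠ z in 𝓝ˢ L, χ z = 1) ∧ ∀ z, χ z ∈ Icc (0 : ℝ) 1 := by
  obtain ⟨t, ht, hLt, htU⟩ := exists_compact_between hL hU hLU
  obtain ⟨f, h1, h2, h3⟩ := exists_contMDiffMap_one_nhds_of_subset_interior
    (modelWithCornersSelf ℝ ℂ) (n := 1) hL.isClosed hLt
  have hs : tsupport f ⊆ t := closure_minimal (fun x hx => by
    by_contra hxt; exact hx (h2 x hxt)) ht.isClosed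
  exact ⟨f, f.contMDiff.contDiff, ht.of_isClosed_subset (isClosed_tsupport _) hs, hs.trans htU,
    h1, h3⟩

theorem contDiff_cutoff_mul {U : Set ℂ} (hU : IsOpen U) {u : ℂ → ℂ} (hu : DifferentiableOn ℂ u U)
    {χ : ℂ → ℝ} (hχ : ContDiff ℝ 1 χ) (hs : tsupport χ ⊆ U) :
    ContDiff ℝ 1 (fun z => (χ z : ℂ) * u z) := by
  rw [contDiff_iff_contDiffAt]
  intro z
  by_cases hz : z ∈ U
  · have h1 : ContDiffAt ℂ 1 u z := (hu.contDiffOn hU).contDiffAt (hU.mem_nhds hz)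
    exact (ofRealCLM.contDiff.contDiffAt.comp z hχ.contDiffAt).mul (h1.restrict_scalars ℝ)
  · have h0 : (fun z => (χ z : ℂ) * u z) =ᶠ[𝓝 z] fun _ => 0 := by
      filter_upwards [(isClosed_tsupport χ).isOpen_compl.mem_nhds (fun h => hz (hs h))] with w hw
      rw [image_eq_zero_of_notMem_tsupport hw]; simp
    exact contDiffAt_const.congr_of_eventuallyEq h0

/-- A continuous function on `E` that is holomorphic near `L` belongs to every closed subspace of
`C(E)` containing the Cauchy kernels, provided that `E \ L` is negligible. -/
theorem mem_of_eqOn_holomorphic {E L U : Set ℂ} [CompactSpace E] (hL : IsCompact L) (hLE : L ⊆ E)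
    (hU : IsOpen U) (hLU : L ⊆ U) {u : ℂ → ℂ} (hu : DifferentiableOn ℂ u U)
    (hnull : volume (E \ L) = 0) (X : Submodule ℂ C(E, ℂ))
    (hX : IsClosed (X : Set C(E, ℂ))) (hk : ∀ ζ : ↥Eᶜ, cauchyKernel E ζ ∈ X)
    (ψ : C(E, ℂ)) (hψ : ∀ z : E, (z : ℂ) ∈ L → ψ z = u z) : ψ ∈ X := by
  have hE : IsCompact E := isCompact_iff_compactSpace.mpr ‹_›
  obtain ⟨χ, hχ, hχc, hχU, hχ1, hχI⟩ := exists_contDiff_cutoff hL hU hLU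
  have hw := contDiff_cutoff_mul hU hu hχ hχU
  set w : ℂ → ℂ := fun z => (χ z : ℂ) * u z with hwdef
  -- `w` is already holomorphic near `L`. The Tietze extension `v` of the rest vanishes on `L`, but
  -- carries no smoothness.
  obtain ⟨v, hv⟩ := ContinuousMap.exists_restrict_eq hE.isClosed
    (ψ - ⟨fun z : E => w z, hw.continuous.comp continuous_subtype_val⟩)
  have hvE : ∀ z : E, v z = ψ z - w z := fun z => by
    have := DFunLike.congr_fun hv z
    simpa using this
  have hvL : ∀ z ∈ L, v z = 0 := fun z hz => by
    have h1 : χ z = 1 := hχ1.self_of_nhdsSet z hz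
    rw [hvE ⟨z, hLE hz⟩, hψ ⟨z, hLE hz⟩ hz]
    simp [hwdef, h1]
  rw [← SetLike.mem_coe, ← hX.closure_eq, Metric.mem_closure_iff]
  intro ε hε
  obtain ⟨χ₂, hχ₂, -, hχ₂U, hχ₂1, hχ₂I⟩ := exists_contDiff_cutoff (U := {z | ‖v z‖ < ε / 4}) hL
    (isOpen_lt (by fun_prop) continuous_const) (fun z hz => by simp [hvL z hz, hε])
  obtain ⟨χ₃, hχ₃, hχ₃c, -, hχ₃1, hχ₃I⟩ := exists_contDiff_cutoff hE isOpen_univ (subset_univ _)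
  have c2 := hχ₂.continuous
  have c3 := hχ₃.continuous
  -- Cutting `v` off near `L` before smoothing makes `s` vanish near `L`, because the approximation
  -- does not enlarge the support. Hence `w + s` coincides with `u` near `L`.
  obtain ⟨s, hs, hsd, hss⟩ := Continuous.exists_contDiff_approx
    (f := fun z => ((1 - χ₂ z : ℝ) : ℂ) * v z * χ₃ z) (ε := fun _ => ε / 4) 1
    (by fun_prop) continuous_const (fun _ => by positivity)
  have hsc : HasCompactSupport s := by
    refine hχ₃c.mono fun z hz => ?_
    have := hss hz
    rw [Function.mem_support] at this ⊢
    intro h; exact this (by simp [h])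
  have hwc : HasCompactSupport w := by
    refine hχc.mono fun z hz h => hz ?_
    simp [hwdef, h]
  have hφ : ContDiff ℝ 1 (fun z => w z + s z) := hw.add hs
  have hφc : HasCompactSupport (fun z => w z + s z) := hwc.add hsc
  have hloc : ∀ᶠ z in 𝓝ˢ L, dbar (fun z => w z + s z) z = 0 := by
    rw [eventually_nhdsSet_iff_forall] at hχ1 hχ₂1 ⊢
    intro x hx
    have hev : ∀ᶠ z in 𝓝 x, w z + s z = u z ∧ z ∈ U := by
      filter_upwards [hχ1 x hx, hχ₂1 x hx, hU.mem_nhds (hLU hx)] with z h1 h2 h3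
      have h0 : s z = 0 := by
        by_contra h
        exact hss h (by simp [h2])
      exact ⟨by simp [hwdef, h1, h0], h3⟩
    filter_upwards [hev.eventually_nhds] with y hy
    have heq : (fun z => w z + s z) =ᶠ[𝓝 y] u := hy.mono fun _ h => h.1
    have hyU : y ∈ U := hy.self_of_nhds.2
    exact dbar_eq_zero_of_eventually_differentiable
      ((hu.differentiableAt (hU.mem_nhds hyU)).congr_of_eventuallyEq heq)
  have hnull' : volume (E ∩ tsupport (dbar (fun z => w z + s z))) = 0 := by
    refine measure_mono_null (t := E \ L) (fun z hz => ⟨hz.1, fun hzL => ?_⟩) hnull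
    have := eventually_nhdsSet_iff_forall.mp hloc z hzL
    exact (notMem_tsupport_iff_eventuallyEq.mpr this) hz.2
  let Φ : C(E, ℂ) := ⟨fun z => w z + s z, hφ.continuous.comp continuous_subtype_val⟩
  refine ⟨Φ, mem_of_cauchyKernel_mem X hX hk hφ hφc hnull' Φ fun _ => rfl, ?_⟩
  rw [dist_eq_norm]
  refine lt_of_le_of_lt (b := ε / 2) ?_ (by linarith)
  rw [ContinuousMap.norm_le _ (by positivity)]
  intro z
  have h3 : χ₃ z = 1 := hχ₃1.self_of_nhdsSet z z.2
  have e1 : (ψ - Φ) z = (χ₂ z : ℂ) * v z - (s z - ((1 - χ₂ z : ℝ) : ℂ) * v z * χ₃ z) := by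
    change ψ z - (w z + s z) = _
    rw [h3, hvE]
    push_cast
    ring
  rw [e1]
  have hd := hsd z
  rw [dist_eq_norm] at hd
  have h2 : ‖(χ₂ z : ℂ) * v z‖ ≤ ε / 4 := by
    by_cases h : ‖v z‖ < ε / 4
    · rw [norm_mul, norm_real, Real.norm_of_nonneg (hχ₂I z).1]
      nlinarith [(hχ₂I z).1, (hχ₂I z).2, norm_nonneg (v z)]
    · have : χ₂ z = 0 := image_eq_zero_of_notMem_tsupport fun h' => h (hχ₂U h')
      rw [this]; simpa using by positivity
  exact (norm_sub_le _ _).trans (by linarith)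

/-- In a closed subalgebra of `C(E)`, the poles of Cauchy kernels can be moved in the
complement of `E`. -/
theorem cauchyKernel_mem_of_isPreconnected {E : Set ℂ} [CompactSpace E]
    (X : Subalgebra ℂ C(E, ℂ)) (hX : IsClosed (X : Set C(E, ℂ))) {S : Set ℂ}
    (hS : IsPreconnected S) (hSE : S ⊆ Eᶜ) {ζ₀ ζ : ↥Eᶜ} (h₀ : (ζ₀ : ℂ) ∈ S) (h : (ζ : ℂ) ∈ S)
    (hk : cauchyKernel E ζ₀ ∈ X) : cauchyKernel E ζ ∈ X := by
  have hE : IsCompact E := isCompact_iff_compactSpace.mpr ‹_›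
  set u : Set ℂ := (↑) '' (cauchyKernel E ⁻¹' (X : Set C(E, ℂ))) with hu
  have hopen : IsOpen (cauchyKernel E ⁻¹' (X : Set C(E, ℂ))) := by
    rw [Metric.isOpen_iff]
    intro ζ₁ h₁
    -- Within this radius the expansion of `1 / (z - ζ₂)` in powers of `(ζ₂ - ζ₁) / (z - ζ₁)`
    -- converges in norm.
    refine ⟨(‖cauchyKernel E ζ₁‖ + 1)⁻¹, by positivity, fun ζ₂ h₂ => ?_⟩
    rw [Metric.mem_ball, Subtype.dist_eq, dist_eq_norm] at h₂
    set x : C(E, ℂ) := ((ζ₂ : ℂ) - ζ₁) • cauchyKernel E ζ₁ with hx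
    have hx1 : ‖x‖ < 1 := by
      rw [hx, norm_smul]
      calc _ ≤ (‖cauchyKernel E ζ₁‖ + 1)⁻¹ * ‖cauchyKernel E ζ₁‖ := by gcongr
        _ < 1 := by
          rw [inv_mul_lt_iff₀ (by positivity)]; linarith
    have hxX : x ∈ X := X.smul_mem h₁ _
    have hsum : (∑' n : ℕ, x ^ n) ∈ X := by
      have hs := (summable_geometric_of_norm_lt_one hx1).hasSum
      exact hX.mem_of_tendsto hs (Eventually.of_forall fun t =>
        X.sum_mem fun n _ => X.pow_mem hxX n)
    have hgeo := mul_neg_geom_series x hx1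
    have : cauchyKernel E ζ₂ = cauchyKernel E ζ₁ * ∑' n : ℕ, x ^ n := by
      ext z
      have hz := DFunLike.congr_fun hgeo z
      simp only [ContinuousMap.mul_apply, ContinuousMap.sub_apply, ContinuousMap.one_apply] at hz
      have n1 : (z : ℂ) - ζ₁ ≠ 0 := fun h => ζ₁.2 (sub_eq_zero.mp h ▸ z.2)
      have n2 : (z : ℂ) - ζ₂ ≠ 0 := fun h => ζ₂.2 (sub_eq_zero.mp h ▸ z.2)
      have hxz : x z = ((ζ₂ : ℂ) - ζ₁) * ((z : ℂ) - ζ₁)⁻¹ := by simp [hx]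
      rw [ContinuousMap.mul_apply, cauchyKernel_apply, cauchyKernel_apply]
      rw [hxz] at hz
      set σ := (∑' n : ℕ, x ^ n) z
      field_simp at hz ⊢
      linear_combination -hz
    change cauchyKernel E ζ₂ ∈ X
    rw [this]
    exact X.mul_mem h₁ hsum
  have huo : IsOpen u := hE.isClosed.isOpen_compl.isOpenMap_subtype_val _ hopen
  have hsub : S ⊆ u := by
    refine hS.subset_of_closure_inter_subset huo ⟨ζ₀, h₀, ζ₀, hk, rfl⟩ ?_
    rintro b ⟨hb, hbS⟩
    refine ⟨⟨b, hSE hbS⟩, ?_, rfl⟩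
    have hcl : IsClosed (cauchyKernel E ⁻¹' (X : Set C(E, ℂ))) :=
      hX.preimage (cauchyKernel E).continuous
    rw [← hcl.closure_eq, closure_subtype]
    exact hb
  obtain ⟨ζ', hmem, he⟩ := hsub h
  rwa [Subtype.ext he] at hmem

/-! ### Zero-free functions up to an exponential factor. -/

/-- Every point off `K` can be joined, off `K`, to a point off `Ω` or to infinity. -/
def RungeIn (K Ω : Set ℂ) : Prop :=
  ∀ b ∉ K, ∃ S : Set ℂ, IsPreconnected S ∧ b ∈ S ∧ S ⊆ Kᶜ ∧
    ((S ∩ Ωᶜ).Nonempty ∨ ¬ Bornology.IsBounded S)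

/-- Near `K`, the function `W` is `R * exp u` with `R` holomorphic without zeros in `Ω`. -/
def ExpFactor (K Ω : Set ℂ) (W : ℂ → ℂ) : Prop :=
  ∃ R u : ℂ → ℂ, DifferentiableOn ℂ R Ω ∧ (∀ z ∈ Ω, R z ≠ 0) ∧
    ∀ᶠ z in 𝓝ˢ K, DifferentiableAt ℂ u z ∧ W z = R z * exp (u z)

theorem ExpFactor.mul {K Ω : Set ℂ} {W₁ W₂ : ℂ → ℂ} (h₁ : ExpFactor K Ω W₁)
    (h₂ : ExpFactor K Ω W₂) : ExpFactor K Ω (fun z => W₁ z * W₂ z) := by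
  obtain ⟨R₁, u₁, hR₁, hn₁, he₁⟩ := h₁
  obtain ⟨R₂, u₂, hR₂, hn₂, he₂⟩ := h₂
  refine ⟨fun z => R₁ z * R₂ z, fun z => u₁ z + u₂ z, hR₁.mul hR₂,
    fun z hz => mul_ne_zero (hn₁ z hz) (hn₂ z hz), ?_⟩
  filter_upwards [he₁, he₂] with z h h'
  exact ⟨h.1.add h'.1, by rw [h.2, h'.2, exp_add]; ring⟩

theorem ExpFactor.inv {K Ω : Set ℂ} {W : ℂ → ℂ} (h : ExpFactor K Ω W) :
    ExpFactor K Ω (fun z => (W z)⁻¹) := by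
  obtain ⟨R, u, hR, hn, he⟩ := h
  refine ⟨fun z => (R z)⁻¹, fun z => -u z, hR.inv hn, fun z hz => inv_ne_zero (hn z hz), ?_⟩
  filter_upwards [he] with z h
  exact ⟨h.1.neg, by rw [h.2, exp_neg, mul_inv]⟩

theorem ExpFactor.of_eventually_eq_mul_exp {K Ω : Set ℂ} {W₁ W₂ u : ℂ → ℂ}
    (h₁ : ExpFactor K Ω W₁)
    (h : ∀ᶠ z in 𝓝ˢ K, DifferentiableAt ℂ u z ∧ W₂ z = W₁ z * exp (u z)) :
    ExpFactor K Ω W₂ := by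
  obtain ⟨R, v, hR, hn, he⟩ := h₁
  refine ⟨R, fun z => v z + u z, hR, hn, ?_⟩
  filter_upwards [he, h] with z h h'
  exact ⟨h.1.add h'.1, by rw [h'.2, h.2, exp_add]; ring⟩

theorem expFactor_const (K Ω : Set ℂ) {c : ℂ} (hc : c ≠ 0) : ExpFactor K Ω (fun _ => c) :=
  ⟨fun _ => c, fun _ => 0, differentiableOn_const _, fun _ _ => hc,
    Eventually.of_forall fun _ => ⟨differentiableAt_const _, by simp⟩⟩

/-- On `K` one has `|b' - b| < |z - b|`, so `(z - b') / (z - b) = 1 - (b' - b) / (z - b)` lies in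
the unit disc about `1` and the principal logarithm applies. -/
theorem exists_log_sub_div_sub {K : Set ℂ} {b b' : ℂ} {r : ℝ} (hr : Metric.ball b r ⊆ Kᶜ)
    (hb : b' ∈ Metric.ball b r) :
    ∃ v : ℂ → ℂ, ∀ᶠ z in 𝓝ˢ K, DifferentiableAt ℂ v z ∧ z - b' = (z - b) * exp (v z) := by
  refine ⟨fun z => log (1 - (b' - b) / (z - b)), ?_⟩
  have hopen : IsOpen {z : ℂ | ‖b' - b‖ < ‖z - b‖} := isOpen_lt (by fun_prop) (by fun_prop)
  have hK : K ⊆ {z : ℂ | ‖b' - b‖ < ‖z - b‖} := by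
    intro z hz
    rw [Metric.mem_ball, dist_eq_norm] at hb
    have : z ∉ Metric.ball b r := fun h => hr h hz
    rw [Metric.mem_ball, dist_eq_norm, not_lt] at this
    exact hb.trans_le this
  filter_upwards [hopen.mem_nhdsSet.mpr hK] with z hz
  have hz' : ‖b' - b‖ < ‖z - b‖ := hz
  have h0 : z - b ≠ 0 := norm_pos_iff.mp ((norm_nonneg _).trans_lt hz)
  have hs : 1 - (b' - b) / (z - b) ∈ slitPlane := by
    rw [sub_eq_add_neg]
    apply mem_slitPlane_of_norm_lt_one
    rwa [norm_neg, norm_div, div_lt_one (norm_pos_iff.mpr h0)]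
  refine ⟨?_, ?_⟩
  · refine DifferentiableAt.clog ?_ hs
    fun_prop (disch := exact h0)
  · rw [exp_log (slitPlane_ne_zero hs)]
    field_simp
    ring

/-- Multiplicative pole pushing: moving `b` slightly off `K` changes `z - b` by an exponential
factor, so the good `b` form a set open and relatively closed along the connected set `S`. It meets
`S`, since for `a ∉ Ω` the factor `z - a` is itself zero-free in `Ω`, and for large `a` the factor
`1 - z / a` has a logarithm near `K`. -/
theorem expFactor_sub {K Ω : Set ℂ} (hK : IsCompact K) (hKΩ : RungeIn K Ω) {b : ℂ} (hb : b ∉ K) :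
    ExpFactor K Ω (fun z => z - b) := by
  obtain ⟨S, hS, hbS, hSK, hS'⟩ := hKΩ b hb
  set u : Set ℂ := {b | b ∉ K ∧ ExpFactor K Ω (fun z => z - b)} with hu
  have hball : ∀ b ∉ K, ∃ r > 0, Metric.ball b r ⊆ Kᶜ := fun b hb =>
    Metric.isOpen_iff.mp hK.isClosed.isOpen_compl b hb
  have huo : IsOpen u := by
    rw [Metric.isOpen_iff]
    rintro b ⟨hb, hbe⟩
    obtain ⟨r, hr, hrK⟩ := hball b hb
    refine ⟨r, hr, fun b' hb' => ⟨hrK hb', ?_⟩⟩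
    obtain ⟨v, hv⟩ := exists_log_sub_div_sub hrK hb'
    exact hbe.of_eventually_eq_mul_exp hv
  have hsu : (S ∩ u).Nonempty := by
    rcases hS' with ⟨a, haS, haΩ⟩ | hub
    · refine ⟨a, haS, hSK haS, fun z => z - a, fun _ => 0, by fun_prop, fun z hz h => ?_, ?_⟩
      · exact haΩ (sub_eq_zero.mp h ▸ hz)
      · exact Eventually.of_forall fun _ => ⟨differentiableAt_const _, by simp⟩
    · obtain ⟨r, hr⟩ := hK.isBounded.subset_ball (0 : ℂ)
      obtain ⟨a, haS, har⟩ : ∃ a ∈ S, a ∉ Metric.ball (0 : ℂ) r := by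
        by_contra! h
        exact hub (Metric.isBounded_ball.subset h)
      by_cases hKe : K = ∅
      · subst hKe
        exact ⟨a, haS, by simp, fun _ => 1, fun _ => 0, by fun_prop, by simp, by simp⟩
      have hr0 : 0 < r := by
        obtain ⟨x, hx⟩ := nonempty_iff_ne_empty.mpr hKe
        have := hr hx
        rw [mem_ball_zero_iff] at this
        exact (norm_nonneg x).trans_lt this
      rw [mem_ball_zero_iff, not_lt] at har
      have ha0 : a ≠ 0 := norm_pos_iff.mp (hr0.trans_le har)
      refine ⟨a, haS, hSK haS, fun _ => -a, fun z => log (1 + -(z / a)), by fun_prop,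
        fun _ _ => neg_ne_zero.mpr ha0, ?_⟩
      filter_upwards [Metric.isOpen_ball.mem_nhdsSet.mpr hr] with z hz
      have hs : 1 + -(z / a) ∈ slitPlane := by
        apply mem_slitPlane_of_norm_lt_one
        rw [mem_ball_zero_iff] at hz
        rw [norm_neg, norm_div, div_lt_one (norm_pos_iff.mpr ha0)]
        exact hz.trans_le har
      refine ⟨DifferentiableAt.clog (by fun_prop) hs, ?_⟩
      rw [exp_log (slitPlane_ne_zero hs)]
      field_simp
      ring
  refine (hS.subset_of_closure_inter_subset huo hsu ?_ hbS).2
  rintro b ⟨hb, hbS⟩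
  obtain ⟨r, hr, hrK⟩ := hball b (hSK hbS)
  obtain ⟨b', hb'u, hb'⟩ := Metric.mem_closure_iff.mp hb r hr
  obtain ⟨v, hv⟩ := exists_log_sub_div_sub hrK (Metric.mem_ball'.mpr hb')
  refine ⟨hSK hbS, hb'u.2.of_eventually_eq_mul_exp (u := fun z => -v z) ?_⟩
  filter_upwards [hv] with z hz
  refine ⟨hz.1.neg, ?_⟩
  rw [hz.2, mul_assoc, ← exp_add]
  simp

theorem expFactor_polynomial {K Ω : Set ℂ} (hK : IsCompact K) (hKΩ : RungeIn K Ω)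
    {P : Polynomial ℂ} (hP0 : P ≠ 0) (hP : ∀ z ∈ K, P.eval z ≠ 0) :
    ExpFactor K Ω (fun z => P.eval z) := by
  have hs := (IsAlgClosed.splits P).eq_prod_roots
  have hroots : ∀ b ∈ P.roots, b ∉ K := fun b hb hbK =>
    hP b hbK (Polynomial.isRoot_of_mem_roots hb)
  have hprod : ∀ s : Multiset ℂ, (∀ b ∈ s, b ∉ K) →
      ExpFactor K Ω (fun z => ((s.map fun a => Polynomial.X - Polynomial.C a).prod).eval z) := by
    intro s
    induction s using Multiset.induction_on with
    | empty => intro _; simpa using expFactor_const K Ω one_ne_zero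
    | cons b s ih =>
      intro h
      have := (expFactor_sub hK hKΩ (h b (Multiset.mem_cons_self b s))).mul
        (ih fun b' hb' => h b' (Multiset.mem_cons_of_mem hb'))
      simpa using this
  have := (expFactor_const K Ω (Polynomial.leadingCoeff_ne_zero.mpr hP0)).mul (hprod _ hroots)
  rw [hs]
  simpa using this

/-- The restrictions to `K` of the rational functions without poles on `K`. -/
def rationalOn (K : Set ℂ) : Submodule ℂ C(K, ℂ) where
  carrier := {ψ | ∃ P Q : Polynomial ℂ, (∀ z ∈ K, Q.eval z ≠ 0) ∧
    ∀ z : K, ψ z = P.eval (z : ℂ) / Q.eval (z : ℂ)}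
  add_mem' := by
    rintro ψ₁ ψ₂ ⟨P₁, Q₁, h₁, e₁⟩ ⟨P₂, Q₂, h₂, e₂⟩
    refine ⟨P₁ * Q₂ + Q₁ * P₂, Q₁ * Q₂, fun z hz => ?_, fun z => ?_⟩
    · simpa using ⟨h₁ z hz, h₂ z hz⟩
    · simp only [ContinuousMap.add_apply, e₁, e₂, Polynomial.eval_add, Polynomial.eval_mul]
      exact div_add_div _ _ (h₁ z z.2) (h₂ z z.2)
  zero_mem' := ⟨0, 1, by simp, by simp⟩
  smul_mem' := by
    rintro c ψ ⟨P, Q, h, e⟩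
    exact ⟨Polynomial.C c * P, Q, h, fun z => by simp [e, mul_div_assoc]⟩

/-- A zero-free holomorphic function near a compact set `K` that is Runge in `Ω` is, up to an
exponential factor, the restriction of a zero-free holomorphic function in `Ω`. -/
theorem expFactor_of_ne_zero {K Ω : Set ℂ} (hK : IsCompact K) (hKΩ : RungeIn K Ω) {W : ℂ → ℂ}
    (hW : ∀ᶠ z in 𝓝ˢ K, DifferentiableAt ℂ W z) (hW0 : ∀ z ∈ K, W z ≠ 0) :
    ExpFactor K Ω W := by
  rcases K.eq_empty_or_nonempty with rfl | hne
  · exact ⟨fun _ => 1, fun _ => 0, by fun_prop, by simp, by simp⟩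
  obtain ⟨U, hU, hKU, hUW⟩ := eventually_nhdsSet_iff_exists.mp hW
  have hWU : DifferentiableOn ℂ W U := fun z hz => (hUW z hz).differentiableWithinAt
  have : CompactSpace K := isCompact_iff_compactSpace.mp hK
  let ψ₀ : C(K, ℂ) := ⟨fun z => W z, hWU.continuousOn.comp_continuous continuous_subtype_val
    fun z => hKU z.2⟩
  have hmem : ψ₀ ∈ (rationalOn K).topologicalClosure := by
    -- With `E = L = K` the null-set condition is empty, and this is Runge's theorem with rational
    -- functions.
    refine mem_of_eqOn_holomorphic hK subset_rfl hU hKU hWU (by simp) _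
      (Submodule.isClosed_topologicalClosure _) (fun ζ => ?_) ψ₀ fun _ _ => rfl
    refine Submodule.le_topologicalClosure _ ⟨1, Polynomial.X - Polynomial.C (ζ : ℂ), ?_, ?_⟩
    · intro z hz h
      simp only [Polynomial.eval_sub, Polynomial.eval_X, Polynomial.eval_C] at h
      exact ζ.2 (sub_eq_zero.mp h ▸ hz)
    · intro z; simp
  obtain ⟨x, hx, hxm⟩ := hK.exists_isMinOn hne (hWU.continuousOn.mono hKU).norm
  have hm : 0 < ‖W x‖ := norm_pos_iff.mpr (hW0 x hx)
  rw [← SetLike.mem_coe, Submodule.topologicalClosure_coe, Metric.mem_closure_iff] at hmem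
  obtain ⟨ψ, ⟨P, Q, hQ, hψ⟩, hd⟩ := hmem _ hm
  -- The tolerance `min |W|` puts the ratio of the rational function to `W` within distance one of
  -- `1`, where it has a logarithm.
  have hlt : ∀ z ∈ K, ‖P.eval z / Q.eval z / W z - 1‖ < 1 := by
    intro z hz
    have h1 : ‖W z - P.eval z / Q.eval z‖ < ‖W x‖ := by
      have := (ContinuousMap.dist_apply_le_dist (f := ψ₀) (g := ψ) ⟨z, hz⟩).trans_lt hd
      rw [dist_eq_norm, hψ] at this
      exact this
    have h2 : ‖W x‖ ≤ ‖W z‖ := hxm hz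
    rw [div_sub_one (hW0 z hz), norm_div, norm_sub_rev,
      div_lt_one (norm_pos_iff.mpr (hW0 z hz))]
    exact h1.trans_le h2
  have hP : ∀ z ∈ K, P.eval z ≠ 0 := fun z hz h => by
    have := hlt z hz
    simp [h] at this
  have hP0 : P ≠ 0 := fun h => hP x hx (by simp [h])
  have hQ0 : Q ≠ 0 := fun h => hQ x hx (by simp [h])
  have hfac := (expFactor_polynomial hK hKΩ hP0 hP).mul (expFactor_polynomial hK hKΩ hQ0 hQ).inv
  refine hfac.of_eventually_eq_mul_exp (u := fun z => -log (P.eval z / Q.eval z / W z)) ?_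
  rw [eventually_nhdsSet_iff_forall]
  intro z hz
  have hd1 : ∀ᶠ y in 𝓝 z, DifferentiableAt ℂ W y :=
    eventually_nhdsSet_iff_forall.mp hW z hz
  have hWz := hd1.self_of_nhds
  have hPd : ∀ y, DifferentiableAt ℂ (fun z => P.eval z) y := fun y => P.differentiableAt
  have hQd : ∀ y, DifferentiableAt ℂ (fun z => Q.eval z) y := fun y => Q.differentiableAt
  have hc : ContinuousAt (fun y => P.eval y / Q.eval y / W y) z :=
    (((hPd z).div (hQd z) (hQ z hz)).div hWz (hW0 z hz)).continuousAt
  have hev : ∀ᶠ y in 𝓝 z, ‖P.eval y / Q.eval y / W y - 1‖ < 1 :=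
    (hc.sub continuousAt_const).norm.eventually_lt continuousAt_const (hlt z hz)
  filter_upwards [hd1, hev, hWz.continuousAt.eventually_ne (hW0 z hz),
    (hQd z).continuousAt.eventually_ne (hQ z hz)] with y h1 h2 h3 h4
  have hs : P.eval y / Q.eval y / W y ∈ slitPlane := by
    have := mem_slitPlane_of_norm_lt_one h2
    simpa using this
  have hPy : P.eval y ≠ 0 := fun h => by simp [h] at h2
  refine ⟨(DifferentiableAt.clog (((hPd y).div (hQd y) h4).div h1 h3) hs).neg, ?_⟩
  rw [exp_neg, exp_log (slitPlane_ne_zero hs)]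
  field_simp

end LocUniv

end

/-! ### The nonlinear right-hand side and its superposition operator. -/

noncomputable section
namespace LocUniv
open Complex

/-- The entire function `(exp x - 1) / x`. -/
def expSlope (x : ℂ) : ℂ := dslope exp 0 x

theorem mul_expSlope (x : ℂ) : x * expSlope x = exp x - 1 := by
  have := sub_smul_dslope exp 0 x
  simpa [expSlope] using this

theorem differentiable_expSlope : Differentiable ℂ expSlope := by
  rw [← differentiableOn_univ]
  exact (Complex.differentiableOn_dslope univ_mem).mpr differentiable_exp.differentiableOn

/-- The function is `(exp (Q s) - 1) / Q` for `Q ≠ 0` and `s` for `Q = 0`, so a single formula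
covers the zeros of `q`, the poles in the meromorphic case. -/
theorem hasDerivAt_mul_expSlope (Q s : ℂ) :
    HasDerivAt (fun s => s * expSlope (Q * s)) (exp (Q * s)) s := by
  by_cases hQ : Q = 0
  · have h0 : expSlope 0 = 1 := by simp [expSlope]
    simpa [hQ, h0] using hasDerivAt_id' s
  · have h1 : (fun s => s * expSlope (Q * s)) = fun s => Q⁻¹ * (exp (Q * s) - 1) := by
      ext s
      rw [← mul_expSlope]
      field_simp
    rw [h1]
    refine ((((hasDerivAt_id' s).const_mul Q).cexp.sub_const 1).const_mul Q⁻¹).congr_deriv ?_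
    field_simp

/-- The right-hand side of the differential equation `f' = theta a r q z s`; off the zeros of `q`
it equals `a + r (exp (q² s) - 1) / q²`. -/
def theta (a r q : ℂ → ℂ) (z s : ℂ) : ℂ := a z + r z * (s * expSlope (q z ^ 2 * s))

theorem theta_of_ne_zero (a r q : ℂ → ℂ) {z : ℂ} (hz : q z ≠ 0) (s : ℂ) :
    theta a r q z s = a z + r z * ((exp (q z ^ 2 * s) - 1) / q z ^ 2) := by
  rw [theta, ← mul_expSlope]
  field_simp

/-- The derivative in `s` is zero-free wherever `r` is. This makes the linearized superposition
operator multiplication by an invertible function. -/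
theorem hasDerivAt_theta (a r q : ℂ → ℂ) (z s : ℂ) :
    HasDerivAt (theta a r q z) (r z * exp (q z ^ 2 * s)) s :=
  ((hasDerivAt_mul_expSlope (q z ^ 2) s).const_mul (r z)).const_add (a z)

theorem DifferentiableOn.theta {a r q s : ℂ → ℂ} {U : Set ℂ} (ha : DifferentiableOn ℂ a U)
    (hr : DifferentiableOn ℂ r U) (hq : DifferentiableOn ℂ q U) (hs : DifferentiableOn ℂ s U) :
    DifferentiableOn ℂ (fun z => theta a r q z (s z)) U :=
  ha.add (hr.mul (hs.mul (differentiable_expSlope.comp_differentiableOn ((hq.pow 2).mul hs))))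

section Nemytskii

variable {E : Type*} [TopologicalSpace E]

/-- The superposition operator `s ↦ θ(·, s(·))`. -/
def superposition (θ : C(E × ℂ, ℂ)) (s : C(E, ℂ)) : C(E, ℂ) :=
  θ.comp ((ContinuousMap.id E).prodMk s)

@[simp]
theorem superposition_apply (θ : C(E × ℂ, ℂ)) (s : C(E, ℂ)) (z : E) :
    superposition θ s z = θ (z, s z) := rfl

/-- By compactness of `E`, `θ'` varies little, uniformly in `z`, close to the graph of `s`. The mean
value inequality in each fibre then bounds the nonlinear remainder in the supremum norm. -/
theorem hasStrictFDerivAt_superposition [CompactSpace E] (θ θ' : C(E × ℂ, ℂ))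
    (h : ∀ z x, HasDerivAt (fun x => θ (z, x)) (θ' (z, x)) x) (s : C(E, ℂ)) :
    HasStrictFDerivAt (superposition θ)
      (ContinuousLinearMap.mul ℂ C(E, ℂ) (superposition θ' s)) s := by
  rw [hasStrictFDerivAt_iff_isLittleO, Asymptotics.isLittleO_iff]
  intro c hc
  let F : C(ℂ, C(E, ℂ)) := ContinuousMap.curry ⟨fun p => θ' (p.2, s p.2 + p.1), by fun_prop⟩
  obtain ⟨δ, hδ, hF⟩ := Metric.continuousAt_iff.mp (F.continuous.continuousAt (x := 0)) c hc
  have hm : ∀ z x, ‖x - s z‖ < δ → ‖θ' (z, x) - θ' (z, s z)‖ ≤ c := by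
    intro z x hx
    have h1 := hF (x := x - s z) (by simpa [dist_eq_norm] using hx)
    have h2 := (ContinuousMap.dist_apply_le_dist (f := F (x - s z)) (g := F 0) z).trans h1.le
    have e1 : F (x - s z) z = θ' (z, x) := by
      change θ' (z, s z + (x - s z)) = _; simp
    have e2 : F 0 z = θ' (z, s z) := by
      change θ' (z, s z + 0) = _; simp
    rwa [e1, e2, dist_eq_norm] at h2
  have hnhds : Metric.ball s δ ×ˢ Metric.ball s δ ∈ 𝓝 (s, s) :=
    prod_mem_nhds (Metric.ball_mem_nhds s hδ) (Metric.ball_mem_nhds s hδ)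
  filter_upwards [hnhds] with p hp
  rw [ContinuousMap.norm_le _ (by positivity)]
  intro z
  have hb : ∀ g ∈ Metric.ball s δ, g z ∈ Metric.ball (s z) δ := fun g hg =>
    (ContinuousMap.dist_apply_le_dist z).trans_lt hg
  have := (convex_ball (s z) δ).norm_image_sub_le_of_norm_hasDerivWithin_le
    (f := fun x => θ (z, x) - θ' (z, s z) * x) (f' := fun x => θ' (z, x) - θ' (z, s z)) (C := c)
    (fun x _ => ((h z x).sub
      (by simpa using (hasDerivAt_id x).const_mul (θ' (z, s z)))).hasDerivWithinAt)
    (fun x hx => hm z x (by simpa [dist_eq_norm] using hx)) (hb p.2 hp.2) (hb p.1 hp.1)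
  calc _ = ‖θ (z, p.1 z) - θ' (z, s z) * p.1 z - (θ (z, p.2 z) - θ' (z, s z) * p.2 z)‖ := by
        congr 1
        simp
        ring
    _ ≤ c * ‖p.1 z - p.2 z‖ := this
    _ ≤ c * ‖p.1 - p.2‖ := by
        gcongr
        exact (p.1 - p.2).norm_coe_le_norm z

end Nemytskii

/-! ### Correcting finitely many conditions inside a subalgebra. -/

section Solve

variable {E : Type*} [TopologicalSpace E] [CompactSpace E]

/-- `B` is the image of `A` under the linearized functional; being finite-dimensional it is closed,
hence also contains the image of the closure of `A`. Since `s = m (m' s)`, invertibility of `m`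
gives `Λ s ∈ B` for all `s ∈ A`. So every value `Λ (Θ w)` with `w ∈ A` lies in `B`, in directions
that corrections from `A` can reach; `Λ` need not be surjective. -/
theorem exists_mem_near_apply_eq_zero (A : Subalgebra ℂ C(E, ℂ)) {Θ : C(E, ℂ) → C(E, ℂ)}
    {m m' u : C(E, ℂ)} (hΘ : HasStrictFDerivAt Θ (ContinuousLinearMap.mul ℂ C(E, ℂ) m) u)
    (hΘA : ∀ w ∈ A, Θ w ∈ A) (hu : u ∈ A.topologicalClosure)
    (hm' : m' ∈ A.topologicalClosure) (hmm : m * m' = 1)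
    {Z : Type*} [NormedAddCommGroup Z] [NormedSpace ℂ Z] [FiniteDimensional ℂ Z]
    (Λ : C(E, ℂ) →L[ℂ] Z) (h0 : Λ (Θ u) = 0) {ε : ℝ} (hε : 0 < ε) :
    ∃ w ∈ A, ‖w - u‖ < ε ∧ Λ (Θ w) = 0 := by
  set Λm : C(E, ℂ) →L[ℂ] Z := Λ ∘L ContinuousLinearMap.mul ℂ C(E, ℂ) m with hΛm
  set B : Submodule ℂ Z := A.toSubmodule.map (Λm : C(E, ℂ) →ₗ[ℂ] Z) with hB
  have hcl : ∀ x ∈ A.topologicalClosure, Λm x ∈ B := by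
    intro x hx
    have hBc : IsClosed (B : Set Z) := B.closed_of_finiteDimensional
    have : x ∈ closure (A : Set C(E, ℂ)) := hx
    exact closure_minimal (fun y hy => (⟨y, hy, rfl⟩ : Λm y ∈ B))
      (hBc.preimage Λm.continuous) this
  have hAB : ∀ s ∈ A, Λ s ∈ B := by
    intro s hs
    have := hcl (m' * s) (mul_mem hm' (A.le_topologicalClosure hs))
    have e : Λm (m' * s) = Λ s := by
      simp [hΛm, ← mul_assoc, hmm]
    rwa [e] at this
  obtain ⟨σ, hσ⟩ := LinearMap.exists_rightInverse_of_surjective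
    ((Λm : C(E, ℂ) →ₗ[ℂ] Z).submoduleMap A.toSubmodule)
    (LinearMap.range_eq_top.mpr (LinearMap.submoduleMap_surjective _ _))
  obtain ⟨π, hπ⟩ := LinearMap.exists_leftInverse_of_injective B.subtype (Submodule.ker_subtype B)
  let σ' : B →L[ℂ] C(E, ℂ) := LinearMap.toContinuousLinearMap (A.toSubmodule.subtype ∘ₗ σ)
  let π' : Z →L[ℂ] B := LinearMap.toContinuousLinearMap π
  have hσA : ∀ y, σ' y ∈ A := fun y => (σ y).2
  have hσm : ∀ y : B, Λm (σ' y) = y := fun y =>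
    congrArg Subtype.val (LinearMap.congr_fun hσ y)
  have hπB : ∀ y : B, π' y = y := fun y => LinearMap.congr_fun hπ y
  -- Keeping `v` as a coordinate makes the derivative of `Φ` onto, so `Φ` is open at `(u, 0)`: for
  -- every `v` near `u`, in particular one in `A`, some correction `σ' y ∈ A` makes the second
  -- component vanish.
  let Φ : C(E, ℂ) × B → C(E, ℂ) × B := fun p => (p.1, π' (Λ (Θ (p.1 + σ' p.2))))
  let j : C(E, ℂ) × B →L[ℂ] C(E, ℂ) :=
    ContinuousLinearMap.fst ℂ _ _ + σ' ∘L ContinuousLinearMap.snd ℂ _ _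
  have hΦ : HasStrictFDerivAt Φ ((ContinuousLinearMap.fst ℂ C(E, ℂ) B).prod
      ((π' ∘L Λm) ∘L j)) (u, 0) := by
    refine hasStrictFDerivAt_fst.prodMk ?_
    have hj : HasStrictFDerivAt (fun p : C(E, ℂ) × B => p.1 + σ' p.2) j (u, 0) :=
      j.hasStrictFDerivAt
    have h1 : HasStrictFDerivAt Θ (ContinuousLinearMap.mul ℂ C(E, ℂ) m)
        ((fun p : C(E, ℂ) × B => p.1 + σ' p.2) (u, 0)) := by simpa using hΘ
    exact (π' ∘L Λ).hasStrictFDerivAt.comp (u, (0 : B)) (h1.comp (u, (0 : B)) hj)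
  have hsurj : ((ContinuousLinearMap.fst ℂ C(E, ℂ) B).prod ((π' ∘L Λm) ∘L j)).range = ⊤ := by
    rw [LinearMap.range_eq_top]
    rintro ⟨x, b⟩
    refine ⟨(x, b - π' (Λm x)), ?_⟩
    refine Prod.ext rfl ?_
    change π' (Λm (x + σ' (b - π' (Λm x)))) = b
    rw [map_add, hσm, map_add, hπB]
    abel
  have hmap := hΦ.map_nhds_eq_of_surj hsurj
  have hΦ0 : Φ (u, 0) = (u, 0) := by simp [Φ, h0]
  rw [hΦ0] at hmap
  have hnb : {p : C(E, ℂ) × B | ‖p.1 + σ' p.2 - u‖ < ε} ∈ 𝓝 (u, (0 : B)) := by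
    refine IsOpen.mem_nhds (isOpen_lt (by fun_prop) continuous_const) ?_
    simpa using hε
  have himg : Φ '' {p : C(E, ℂ) × B | ‖p.1 + σ' p.2 - u‖ < ε} ∈ 𝓝 (u, (0 : B)) := by
    rw [← hmap]; exact image_mem_map hnb
  have hpre : {v : C(E, ℂ) | (v, (0 : B)) ∈ Φ '' {p | ‖p.1 + σ' p.2 - u‖ < ε}} ∈ 𝓝 u :=
    (Continuous.prodMk_left (0 : B)).continuousAt.preimage_mem_nhds himg
  obtain ⟨v, ⟨⟨v', y⟩, hp, hvy⟩, hvA⟩ :=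
    mem_closure_iff_nhds.mp (show u ∈ closure (A : Set C(E, ℂ)) from hu) _ hpre
  have h1 : v' = v := congrArg Prod.fst hvy
  have h2 : π' (Λ (Θ (v' + σ' y))) = 0 := congrArg Prod.snd hvy
  subst h1
  have hwA : v' + σ' y ∈ A := A.add_mem hvA (hσA y)
  refine ⟨v' + σ' y, hwA, hp, ?_⟩
  -- The retraction `π'` loses nothing here, because the value already belongs to `B`.
  have h3 := hπB ⟨_, hAB _ (hΘA _ hwA)⟩
  rw [h2] at h3
  exact (congrArg Subtype.val h3).symm

/-- Solving finitely many scalar equations modulo a subspace inside a dense subalgebra. -/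
theorem exists_mem_near_apply_mem (A : Subalgebra ℂ C(E, ℂ)) {Θ : C(E, ℂ) → C(E, ℂ)}
    {m m' u : C(E, ℂ)} (hΘ : HasStrictFDerivAt Θ (ContinuousLinearMap.mul ℂ C(E, ℂ) m) u)
    (hΘA : ∀ w ∈ A, Θ w ∈ A) (hu : u ∈ A.topologicalClosure)
    (hm' : m' ∈ A.topologicalClosure) (hmm : m * m' = 1)
    {Y : Type*} [NormedAddCommGroup Y] [NormedSpace ℂ Y] [FiniteDimensional ℂ Y]
    (Λ : C(E, ℂ) →L[ℂ] Y) (N : Submodule ℂ Y) (h0 : Λ (Θ u) ∈ N) {ε : ℝ} (hε : 0 < ε) :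
    ∃ w ∈ A, ‖w - u‖ < ε ∧ Λ (Θ w) ∈ N := by
  let p : Y →ₗ[ℂ] (Fin (Module.finrank ℂ (Y ⧸ N)) → ℂ) :=
    (Module.finBasis ℂ (Y ⧸ N)).equivFun.toLinearMap ∘ₗ N.mkQ
  have hp : ∀ y, p y = 0 ↔ y ∈ N := fun y => by
    simp [p, Submodule.Quotient.mk_eq_zero]
  obtain ⟨w, hw, hwu, h⟩ := exists_mem_near_apply_eq_zero A hΘ hΘA hu hm' hmm
    (LinearMap.toContinuousLinearMap p ∘L Λ) ((hp _).mpr h0) hε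
  exact ⟨w, hw, hwu, (hp _).mp h⟩

end Solve

end LocUniv

end

/-! ### Prescribing integrals along segments. -/

noncomputable section
namespace LocUniv
open Complex

/-- A continuous function through four given points over `0, 1/3, 2/3, 1`. -/
theorem exists_continuous_four (α β x y : ℂ) :
    ∃ u : ℝ → ℂ, Continuous u ∧ u 0 = α ∧ u 1 = β ∧ u (1 / 3) = x ∧ u (2 / 3) = y := by
  refine ⟨fun t => α * (1 - t) * (1 - 3 * t) * (1 - 3 / 2 * t) +
    β * t * (3 * t - 1) * (3 / 2 * t - 1) + x * (27 / 2) * (t * (1 - t) * (2 / 3 - t)) +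
    y * (27 / 2) * (t * (1 - t) * (t - 1 / 3)), by fun_prop, ?_, ?_, ?_, ?_⟩ <;>
  · push_cast
    ring

/-- Paths `u` with prescribed end points realize every value of `∫ ρ exp u`. -/
theorem exists_continuous_integral_mul_exp {ρ : ℝ → ℂ} (hρ : Continuous ρ)
    (hρ0 : ∀ t ∈ Icc (0 : ℝ) 1, ρ t ≠ 0) (α β τ : ℂ) :
    ∃ u : ℝ → ℂ, Continuous u ∧ u 0 = α ∧ u 1 = β ∧ ∫ t in (0 : ℝ)..1, ρ t * exp (u t) = τ := by
  -- The inner values make `ρ exp u` equal to `1` at `1/3` and `-1` at `2/3`, so that whatever the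
  -- defect `D ≠ 0`, one of them lies in a common open half-plane with `D`.
  obtain ⟨u, hu, hu0, hu1, hux, huy⟩ := exists_continuous_four α β (-log (ρ (1 / 3)))
    (-log (ρ (2 / 3)) + Real.pi * I)
  set g : ℝ → ℂ := fun t => ρ t * exp (u t) with hg
  have hgc : Continuous g := by fun_prop
  have hg1 : g (1 / 3) = 1 := by
    simp only [hg, hux, exp_neg]
    rw [exp_log (hρ0 _ ⟨by norm_num, by norm_num⟩),
      mul_inv_cancel₀ (hρ0 _ ⟨by norm_num, by norm_num⟩)]
  have hg2 : g (2 / 3) = -1 := by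
    simp only [hg, huy, exp_add, exp_neg, exp_pi_mul_I]
    rw [exp_log (hρ0 _ ⟨by norm_num, by norm_num⟩)]
    field_simp [hρ0 (2 / 3) ⟨by norm_num, by norm_num⟩]
  set D : ℂ := τ - ∫ t in (0 : ℝ)..1, g t with hD
  by_cases hD0 : D = 0
  · exact ⟨u, hu, hu0, hu1, (sub_eq_zero.mp hD0).symm⟩
  -- a direction `ν` with positive component of both `D` and some `g t₀`
  obtain ⟨t₀, ht₀, ν, hνg, hνD⟩ : ∃ t₀ ∈ Ioo (0 : ℝ) 1, ∃ ν : ℂ,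
      0 < (g t₀ * (starRingEnd ℂ) ν).re ∧ 0 < (D * (starRingEnd ℂ) ν).re := by
    by_cases hre : D.re = 0
    · have him : D.im ≠ 0 := fun h => hD0 (Complex.ext hre h)
      refine ⟨1 / 3, ⟨by norm_num, by norm_num⟩, 1 + D, ?_, ?_⟩
      · rw [hg1]; simp [hre]
      · simp only [mul_re, conj_re, conj_im, add_re, add_im, one_re, one_im, hre]
        have : 0 < D.im * D.im := mul_self_pos.mpr him
        nlinarith
    · rcases lt_or_gt_of_ne hre with h | h
      · refine ⟨2 / 3, ⟨by norm_num, by norm_num⟩, -1, ?_, ?_⟩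
        · rw [hg2]; simp
        · simpa using h
      · refine ⟨1 / 3, ⟨by norm_num, by norm_num⟩, 1, ?_, ?_⟩
        · rw [hg1]; simp
        · simpa using h
  -- A nonnegative weight vanishing at both end points and supported where `g` points along `ν`.
  -- Changing `g` to `g (1 + c k)` keeps the end values and shifts the integral by `c J`.
  set k : ℝ → ℝ := fun t => max 0 (t * (1 - t)) * max 0 (g t * (starRingEnd ℂ) ν).re with hk
  have hkc : Continuous k := by
    have : Continuous fun t => (g t * (starRingEnd ℂ) ν).re :=
      continuous_re.comp (hgc.mul continuous_const)
    fun_prop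
  have hk0 : ∀ t, 0 ≤ k t := fun t => mul_nonneg (le_max_left _ _) (le_max_left _ _)
  set J : ℂ := ∫ t in (0 : ℝ)..1, g t * k t with hJ
  have hJν : 0 < (J * (starRingEnd ℂ) ν).re := by
    have e : (J * (starRingEnd ℂ) ν).re =
        ∫ t in (0 : ℝ)..1, k t * (g t * (starRingEnd ℂ) ν).re := by
      rw [hJ, ← intervalIntegral.integral_mul_const]
      have hi : IntervalIntegrable (fun t => g t * k t * (starRingEnd ℂ) ν) MeasureTheory.volume
          0 1 := Continuous.intervalIntegrable (by fun_prop) _ _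
      have := reCLM.intervalIntegral_comp_comm hi
      simp only [reCLM_apply] at this
      rw [← this]
      congr 1
      ext t
      rw [show g t * k t * (starRingEnd ℂ) ν = (k t : ℂ) * (g t * (starRingEnd ℂ) ν) by ring,
        re_ofReal_mul]
    rw [e]
    have hc : Continuous fun t => k t * (g t * (starRingEnd ℂ) ν).re :=
      hkc.mul (continuous_re.comp (hgc.mul continuous_const))
    refine intervalIntegral.integral_pos (by norm_num) hc.continuousOn (fun t _ => ?_)
      ⟨t₀, Ioo_subset_Icc_self ht₀, ?_⟩
    · simp only [hk]
      rcases le_total (g t * (starRingEnd ℂ) ν).re 0 with h | h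
      · rw [max_eq_left h]; simp
      · exact mul_nonneg (hk0 t) h
    · have : 0 < k t₀ := by
        simp only [hk]
        rw [max_eq_right hνg.le]
        have := ht₀.1
        have h2 := ht₀.2
        exact mul_pos (lt_max_of_lt_right (mul_pos this (by linarith))) hνg
      exact mul_pos this hνg
  have hJ0 : J ≠ 0 := fun h => by simp [h] at hJν
  set c : ℂ := D / J with hc
  have hcJ : c * J = D := div_mul_cancel₀ _ hJ0
  -- `c` is not a negative real, because `J` and `c J = D` both have positive component along `ν`.
  -- Hence `1 + c k` stays in the slit plane and has a continuous logarithm.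
  have hslit : ∀ t, 1 + c * k t ∈ slitPlane := by
    intro t
    by_cases him : c.im = 0
    · left
      have hcr : c = (c.re : ℂ) := Complex.ext rfl (by simpa using him)
      have hpos : 0 ≤ c.re := by
        by_contra hneg
        rw [← hcJ, hcr, mul_assoc, re_ofReal_mul] at hνD
        nlinarith
      rw [hcr]
      have := mul_nonneg hpos (hk0 t)
      simp only [add_re, one_re, re_ofReal_mul, ofReal_re]
      linarith
    · rcases (hk0 t).eq_or_lt with h | h
      · rw [← h]; simp
      · right
        simp only [add_im, one_im, zero_add, im_mul_ofReal]
        exact mul_ne_zero him h.ne'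
  refine ⟨fun t => u t + log (1 + c * k t), ?_, ?_, ?_, ?_⟩
  · exact hu.add (Continuous.clog (by fun_prop) hslit)
  · simp [hk, hu0]
  · simp [hk, hu1]
  · have : ∀ t, ρ t * exp (u t + log (1 + c * k t)) = g t + c * (g t * k t) := by
      intro t
      rw [exp_add, exp_log (slitPlane_ne_zero (hslit t))]
      simp only [hg]
      ring
    simp_rw [this]
    rw [intervalIntegral.integral_add (hgc.intervalIntegrable _ _)
      (Continuous.intervalIntegrable (by fun_prop) _ _), intervalIntegral.integral_const_mul, ← hJ,
      hcJ, hD]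
    ring

/-- The affine path from `a` to `b`. -/
def edgePath (a b : ℂ) (t : ℝ) : ℂ := a + t * (b - a)

/-- The closed segment from `a` to `b`. -/
def edge (a b : ℂ) : Set ℂ := edgePath a b '' Icc 0 1

@[fun_prop]
theorem continuous_edgePath (a b : ℂ) : Continuous (edgePath a b) := by
  unfold edgePath; fun_prop

theorem isCompact_edge (a b : ℂ) : IsCompact (edge a b) :=
  isCompact_Icc.image (continuous_edgePath a b)

theorem edgePath_mem {a b : ℂ} {t : ℝ} (ht : t ∈ Icc (0 : ℝ) 1) : edgePath a b t ∈ edge a b :=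
  ⟨t, ht, rfl⟩

theorem edge_subset_of_convex {a b : ℂ} {C : Set ℂ} (hC : Convex ℝ C) (ha : a ∈ C) (hb : b ∈ C) :
    edge a b ⊆ C := by
  rintro _ ⟨t, ht, rfl⟩
  have := hC ha hb (sub_nonneg.mpr ht.2) ht.1 (by ring)
  convert this using 1
  simp [edgePath]
  ring

/-- The integral of `h` along the segment from `a` to `b`. -/
def edgeIntegral (h : ℂ → ℂ) (a b : ℂ) : ℂ := ∫ t in (0 : ℝ)..1, (b - a) * h (edgePath a b t)

theorem edgeIntegral_congr {h₁ h₂ : ℂ → ℂ} {a b : ℂ} (h : EqOn h₁ h₂ (edge a b)) :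
    edgeIntegral h₁ a b = edgeIntegral h₂ a b := by
  refine intervalIntegral.integral_congr fun t ht => ?_
  rw [uIcc_of_le zero_le_one] at ht
  simp only [h (edgePath_mem ht)]

theorem edgeIntegral_eq_sub {f h : ℂ → ℂ} {a b : ℂ}
    (hf : ∀ z ∈ edge a b, HasDerivAt f (h z) z) (hh : ContinuousOn h (edge a b)) :
    edgeIntegral h a b = f b - f a := by
  have h1 : ∀ t ∈ uIcc (0 : ℝ) 1,
      HasDerivAt (fun t => f (edgePath a b t)) ((b - a) * h (edgePath a b t)) t := by
    intro t ht
    rw [uIcc_of_le zero_le_one] at ht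
    have hp : HasDerivAt (edgePath a b) (b - a) t := by
      refine (((hasDerivAt_id' t).ofReal_comp.mul_const (b - a)).const_add a).congr_deriv ?_
      simp
    exact (hf _ (edgePath_mem ht)).scomp t hp
  have hc : ContinuousOn (fun t => (b - a) * h (edgePath a b t)) (uIcc 0 1) := by
    rw [uIcc_of_le zero_le_one]
    exact continuousOn_const.mul
      (hh.comp (continuous_edgePath a b).continuousOn fun t ht => edgePath_mem ht)
  have := intervalIntegral.integral_eq_sub_of_hasDerivAt h1 hc.intervalIntegrable
  rw [edgeIntegral, this]
  simp [edgePath]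

open Classical in
/-- Extension of a continuous function along a segment, with prescribed integral of `theta`. -/
theorem exists_extend_along_edge {E : Set ℂ} (hE : IsClosed E) {s : ℂ → ℂ} (hs : ContinuousOn s E)
    {x y : ℂ} (hxy : x ≠ y) (hEe : ∀ z ∈ E ∩ edge x y, z = x ∨ z = y) {a r q : ℂ → ℂ}
    (ha : ContinuousOn a (edge x y)) (hr : ContinuousOn r (edge x y))
    (hq : ContinuousOn q (edge x y)) (hr0 : ∀ z ∈ edge x y, r z ≠ 0)
    (hq0 : ∀ z ∈ edge x y, q z ≠ 0) (τ : ℂ) :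
    ∃ s' : ℂ → ℂ, ContinuousOn s' (E ∪ edge x y) ∧ EqOn s' s E ∧
      edgeIntegral (fun z => theta a r q z (s' z)) x y = τ := by
  have hyx : y - x ≠ 0 := sub_ne_zero.mpr hxy.symm
  -- Clamping the parameter to `[0, 1]` makes the coefficients continuous on the whole line.
  set p : ℝ → ℂ := fun t => edgePath x y (max 0 (min 1 t)) with hp
  have hpc : Continuous p := (continuous_edgePath x y).comp (by fun_prop)
  have hpm : ∀ t, p t ∈ edge x y := fun t =>
    edgePath_mem ⟨le_max_left _ _, max_le zero_le_one (min_le_left _ _)⟩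
  have hpI : ∀ t ∈ Icc (0 : ℝ) 1, p t = edgePath x y t := fun t ht => by
    simp only [hp]
    rw [min_eq_right ht.2, max_eq_right ht.1]
  have hac := ha.comp_continuous hpc hpm
  have hrc := hr.comp_continuous hpc hpm
  have hqc := hq.comp_continuous hpc hpm
  have hρc : Continuous fun t => (y - x) * (r (p t) / q (p t) ^ 2) :=
    continuous_const.mul (hrc.div (hqc.pow 2) fun t => pow_ne_zero _ (hq0 _ (hpm t)))
  -- With `u = q² s`, the integrand becomes `a - r / q²` plus `(r / q²) exp u`; the first part is
  -- known and is moved to the target value.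
  obtain ⟨u, hu, hu0, hu1, hui⟩ := exists_continuous_integral_mul_exp hρc
    (fun t _ => mul_ne_zero hyx (div_ne_zero (hr0 _ (hpm t)) (pow_ne_zero _ (hq0 _ (hpm t)))))
    (q x ^ 2 * s x) (q y ^ 2 * s y)
    (τ - ∫ t in (0 : ℝ)..1, (y - x) * (a (p t) - r (p t) / q (p t) ^ 2))
  set e : ℂ → ℂ := fun z => u (((z - x) / (y - x)).re) / q z ^ 2 with he
  have hep : ∀ t, e (edgePath x y t) = u t / q (edgePath x y t) ^ 2 := by
    intro t
    simp only [he, edgePath]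
    rw [add_sub_cancel_left, mul_div_cancel_right₀ _ hyx, ofReal_re]
  have hec : ContinuousOn e (edge x y) := by
    refine ContinuousOn.div ?_ (hq.pow 2) fun z hz => pow_ne_zero _ (hq0 z hz)
    exact (hu.comp (continuous_re.comp
      ((continuous_id.sub continuous_const).div_const _))).continuousOn
  have hx : x ∈ edge x y := ⟨0, by simp, by simp [edgePath]⟩
  have hy : y ∈ edge x y := ⟨1, by simp, by simp [edgePath]⟩
  have hEQ : ∀ z ∈ E ∩ edge x y, e z = s z := by
    intro z hz
    rcases hEe z hz with rfl | rfl
    · simp only [he, sub_self, zero_div, zero_re, hu0]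
      exact mul_div_cancel_left₀ _ (pow_ne_zero 2 (hq0 z hx))
    · simp only [he, div_self hyx, one_re, hu1]
      exact mul_div_cancel_left₀ _ (pow_ne_zero 2 (hq0 z hy))
  set s' : ℂ → ℂ := fun z => if z ∈ E then s z else e z with hs'
  have h1 : EqOn s' s E := fun z hz => by simp [hs', hz]
  have h2 : EqOn s' e (edge x y) := fun z hz => by
    by_cases hzE : z ∈ E
    · simp only [hs', hzE, if_true]; exact (hEQ z ⟨hzE, hz⟩).symm
    · simp [hs', hzE]
  refine ⟨s', ?_, h1, ?_⟩
  · exact (hs.congr h1).union_of_isClosed (hec.congr h2) hE (isCompact_edge x y).isClosed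
  · have : edgeIntegral (fun z => theta a r q z (s' z)) x y =
        ∫ t in (0 : ℝ)..1, ((y - x) * (a (p t) - r (p t) / q (p t) ^ 2) +
          (y - x) * (r (p t) / q (p t) ^ 2) * exp (u t)) := by
      refine intervalIntegral.integral_congr fun t ht => ?_
      rw [uIcc_of_le zero_le_one] at ht
      have hm := edgePath_mem (a := x) (b := y) ht
      have hqt := hq0 _ hm
      simp only
      rw [hpI t ht, h2 hm, hep, theta_of_ne_zero _ _ _ hqt, mul_div_cancel₀ _ (pow_ne_zero 2 hqt)]
      field_simp
      ring
    rw [this, intervalIntegral.integral_add, hui]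
    · ring
    · refine Continuous.intervalIntegrable ?_ _ _
      exact continuous_const.mul (hac.sub
        (hrc.div (hqc.pow 2) fun t => pow_ne_zero _ (hq0 _ (hpm t))))
    · exact (hρc.mul (continuous_exp.comp hu)).intervalIntegrable _ _

end LocUniv

end

/-! ### Combinatorics and topology of unit lattice squares. -/

noncomputable section
namespace LocUniv
open Complex

/-- The closed unit square with lower left corner `S`. -/
def sq (S : ℤ × ℤ) : Set ℂ := Icc (S.1 : ℝ) (S.1 + 1) ×ℂ Icc (S.2 : ℝ) (S.2 + 1)

/-- The centre of the square `S`. -/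
def ctr (S : ℤ × ℤ) : ℂ := ⟨S.1 + 1 / 2, S.2 + 1 / 2⟩

/-- A lattice point, as a complex number. -/
def vtx (v : ℤ × ℤ) : ℂ := ⟨v.1, v.2⟩

/-- The corners of a square, relative to the lower left one, in counterclockwise order. -/
def corner : Fin 4 → ℤ × ℤ := ![(0, 0), (1, 0), (1, 1), (0, 1)]

/-- The neighbour of a square across its side number `k`, relative to the square. -/
def nbr : Fin 4 → ℤ × ℤ := ![(0, -1), (1, 0), (0, 1), (-1, 0)]

/-- The side number `k` of the square `S`. -/
def side (S : ℤ × ℤ) (k : Fin 4) : Set ℂ := edge (vtx (S + corner k)) (vtx (S + corner (k + 1)))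

/-- The union of a finite family of squares. -/
def region (Q : Finset (ℤ × ℤ)) : Set ℂ := ⋃ S ∈ Q, sq S

theorem mem_sq {S : ℤ × ℤ} {z : ℂ} :
    z ∈ sq S ↔ (S.1 ≤ z.re ∧ z.re ≤ S.1 + 1) ∧ (S.2 ≤ z.im ∧ z.im ≤ S.2 + 1) := Iff.rfl

theorem mem_region {Q : Finset (ℤ × ℤ)} {z : ℂ} : z ∈ region Q ↔ ∃ S ∈ Q, z ∈ sq S := by
  simp [region]

theorem convex_sq (S : ℤ × ℤ) : Convex ℝ (sq S) :=
  ((convex_Icc _ _).linear_preimage reLm).inter ((convex_Icc _ _).linear_preimage imLm)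

theorem isCompact_sq (S : ℤ × ℤ) : IsCompact (sq S) := isCompact_Icc.reProdIm isCompact_Icc

theorem isCompact_region (Q : Finset (ℤ × ℤ)) : IsCompact (region Q) :=
  Q.isCompact_biUnion fun S _ => isCompact_sq S

theorem mem_sq_floor (z : ℂ) : z ∈ sq (⌊z.re⌋, ⌊z.im⌋) :=
  ⟨⟨Int.floor_le _, (Int.lt_floor_add_one _).le⟩, ⟨Int.floor_le _, (Int.lt_floor_add_one _).le⟩⟩

theorem norm_sub_sq (z w : ℂ) : ‖z - w‖ ^ 2 = (z.re - w.re) ^ 2 + (z.im - w.im) ^ 2 := by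
  rw [Complex.sq_norm, normSq_apply]
  simp
  ring

theorem dist_le_two_of_mem_sq {S : ℤ × ℤ} {z w : ℂ} (hz : z ∈ sq S) (hw : w ∈ sq S) :
    ‖z - w‖ ≤ 2 := by
  obtain ⟨⟨h1, h2⟩, h3, h4⟩ := mem_sq.mp hz
  obtain ⟨⟨h5, h6⟩, h7, h8⟩ := mem_sq.mp hw
  have := norm_sub_sq z w
  refine abs_le_of_sq_le_sq' (a := ‖z - w‖) (b := 2) ?_ (by norm_num) |>.2
  nlinarith

/-- The radius `3 / 4` exceeds the half-diagonal `√2 / 2`, yet is below `1`, so the disc contains no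
other square's centre, and small enough that overlapping discs come from squares sharing a corner.
-/
theorem sq_subset_ball (S : ℤ × ℤ) : sq S ⊆ Metric.ball (ctr S) (3 / 4) := by
  intro z hz
  obtain ⟨⟨h1, h2⟩, h3, h4⟩ := mem_sq.mp hz
  rw [Metric.mem_ball, dist_eq_norm]
  have := norm_sub_sq z (ctr S)
  simp only [ctr] at this
  refine lt_of_pow_lt_pow_left₀ 2 (by norm_num) ?_
  simp only [ctr]
  nlinarith

theorem vtx_mem_sq {S v : ℤ × ℤ} (h1 : S.1 ≤ v.1) (h2 : v.1 ≤ S.1 + 1) (h3 : S.2 ≤ v.2)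
    (h4 : v.2 ≤ S.2 + 1) : vtx v ∈ sq S :=
  ⟨⟨by simpa [vtx] using h1, by simp only [vtx]; exact_mod_cast h2⟩,
    ⟨by simpa [vtx] using h3, by simp only [vtx]; exact_mod_cast h4⟩⟩

theorem vtx_corner_mem_sq (S : ℤ × ℤ) (k : Fin 4) : vtx (S + corner k) ∈ sq S := by
  apply vtx_mem_sq <;> fin_cases k <;> simp [corner]

theorem exists_corner_of_mem_sq {S v : ℤ × ℤ} (h : vtx v ∈ sq S) : ∃ k, v = S + corner k := by
  obtain ⟨⟨h1, h2⟩, h3, h4⟩ := mem_sq.mp h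
  simp only [vtx] at h1 h2 h3 h4
  norm_cast at h1 h2 h3 h4
  have e1 : v.1 = S.1 ∨ v.1 = S.1 + 1 := by omega
  have e2 : v.2 = S.2 ∨ v.2 = S.2 + 1 := by omega
  rcases e1 with e1 | e1 <;> rcases e2 with e2 | e2
  · exact ⟨0, Prod.ext (by simp [corner, e1]) (by simp [corner, e2])⟩
  · exact ⟨3, Prod.ext (by simp [corner, e1]) (by simp [corner, e2])⟩
  · exact ⟨1, Prod.ext (by simp [corner, e1]) (by simp [corner, e2])⟩
  · exact ⟨2, Prod.ext (by simp [corner, e1]) (by simp [corner, e2])⟩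

theorem side_subset_sq (S : ℤ × ℤ) (k : Fin 4) : side S k ⊆ sq S :=
  edge_subset_of_convex (convex_sq S) (vtx_corner_mem_sq S k) (vtx_corner_mem_sq S (k + 1))

theorem side_subset_sq_nbr (S : ℤ × ℤ) (k : Fin 4) : side S k ⊆ sq (S + nbr k) := by
  refine edge_subset_of_convex (convex_sq _) ?_ ?_ <;>
  · apply vtx_mem_sq <;> fin_cases k <;> simp [corner, nbr]

theorem vtx_corner_ne (S : ℤ × ℤ) (k : Fin 4) :
    vtx (S + corner k) ≠ vtx (S + corner (k + 1)) := by
  intro h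
  have h1 := congrArg re h
  have h2 := congrArg im h
  fin_cases k <;> simp [vtx, corner] at h1 h2

/-- The points of the open square. -/
def InSq (S : ℤ × ℤ) (z : ℂ) : Prop :=
  (S.1 < z.re ∧ z.re < S.1 + 1) ∧ (S.2 < z.im ∧ z.im < S.2 + 1)

theorem InSq.eq_of_mem_sq {S T : ℤ × ℤ} {z : ℂ} (hS : InSq S z) (hT : z ∈ sq T) : T = S := by
  obtain ⟨⟨h1, h2⟩, h3, h4⟩ := hS
  obtain ⟨⟨h5, h6⟩, h7, h8⟩ := mem_sq.mp hT
  have a1 : (S.1 : ℝ) < T.1 + 1 := by linarith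
  have a2 : (T.1 : ℝ) < S.1 + 1 := by linarith
  have a3 : (S.2 : ℝ) < T.2 + 1 := by linarith
  have a4 : (T.2 : ℝ) < S.2 + 1 := by linarith
  norm_cast at a1 a2 a3 a4
  exact Prod.ext (by omega) (by omega)

theorem mem_side_cases {S : ℤ × ℤ} {k : Fin 4} {z : ℂ} (h : z ∈ side S k) :
    (k = 0 ∧ z.im = S.2) ∨ (k = 1 ∧ z.re = S.1 + 1) ∨ (k = 2 ∧ z.im = S.2 + 1) ∨
      (k = 3 ∧ z.re = S.1) := by
  obtain ⟨t, ht, rfl⟩ := h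
  fin_cases k <;> simp [edgePath, vtx, corner]

theorem InSq.notMem_side {S T : ℤ × ℤ} {k : Fin 4} {z : ℂ} (hS : InSq S z) : z ∉ side T k := by
  intro h
  obtain rfl := hS.eq_of_mem_sq (side_subset_sq _ _ h)
  obtain ⟨⟨h1, h2⟩, h3, h4⟩ := hS
  rcases mem_side_cases h with ⟨-, h⟩ | ⟨-, h⟩ | ⟨-, h⟩ | ⟨-, h⟩ <;> linarith

/-- A side lies in the boundary of a convex set, which is always a null set. -/
theorem volume_side (S : ℤ × ℤ) (k : Fin 4) : MeasureTheory.volume (side S k) = 0 := by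
  refine MeasureTheory.measure_mono_null (t := frontier (sq S)) (fun z hz => ?_)
    ((convex_sq S).addHaar_frontier _)
  refine ⟨subset_closure (side_subset_sq S k hz), fun hi => ?_⟩
  rw [sq, interior_reProdIm, interior_Icc, interior_Icc] at hi
  exact InSq.notMem_side (S := S) ⟨hi.1, hi.2⟩ hz

/-- A point on a side of `S` which belongs to a square other than the two adjacent ones
is an end point of the side. -/
theorem eq_vtx_of_mem_side {S T : ℤ × ℤ} {k : Fin 4} {z : ℂ} (h : z ∈ side S k) (hT : z ∈ sq T)
    (hTS : T ≠ S) (hTn : T ≠ S + nbr k) :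
    z = vtx (S + corner k) ∨ z = vtx (S + corner (k + 1)) := by
  obtain ⟨⟨h1, h2⟩, h3, h4⟩ := mem_sq.mp (side_subset_sq S k h)
  obtain ⟨⟨h5, h6⟩, h7, h8⟩ := mem_sq.mp hT
  have hc := mem_side_cases h
  have hi : ∀ {x : ℝ} {m n : ℤ}, (m : ℝ) ≤ x → x ≤ m + 1 → (n : ℝ) ≤ x → x ≤ n + 1 →
      n = m ∨ (n = m - 1 ∧ x = m) ∨ (n = m + 1 ∧ x = m + 1) := by
    intro x m n a1 a2 a3 a4
    have b1 : (m : ℝ) ≤ n + 1 := by linarith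
    have b2 : (n : ℝ) ≤ m + 1 := by linarith
    norm_cast at b1 b2
    have : n = m ∨ n = m - 1 ∨ n = m + 1 := by omega
    rcases this with h | h | h
    · exact Or.inl h
    · refine Or.inr (Or.inl ⟨h, ?_⟩)
      subst h; push_cast at *; linarith
    · refine Or.inr (Or.inr ⟨h, ?_⟩)
      subst h; push_cast at *; linarith
  have hx := hi h1 h2 h5 h6
  have hy := hi h3 h4 h7 h8
  have key : ∀ v : ℤ × ℤ, z = vtx v ↔ z.re = v.1 ∧ z.im = v.2 := fun v => by
    simp [Complex.ext_iff, vtx]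
  have hTS' : ¬ (T.1 = S.1 ∧ T.2 = S.2) := fun h => hTS (Prod.ext h.1 h.2)
  have hTn' : ¬ (T.1 = S.1 + (nbr k).1 ∧ T.2 = S.2 + (nbr k).2) := fun h =>
    hTn (Prod.ext h.1 h.2)
  rw [key, key]
  have hne : (S.2 : ℝ) ≠ S.2 + 1 := by norm_num
  have hne' : (S.1 : ℝ) ≠ S.1 + 1 := by norm_num
  fin_cases k <;> simp [corner, nbr] at hc hTn' ⊢ <;> grind

/-- Overlapping discs belong to squares with a common corner. -/
theorem exists_common_vtx {S T : ℤ × ℤ}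
    (h : (Metric.ball (ctr S) (3 / 4) ∩ Metric.ball (ctr T) (3 / 4)).Nonempty) :
    ∃ v : ℤ × ℤ, vtx v ∈ sq S ∧ vtx v ∈ sq T := by
  obtain ⟨z, hS, hT⟩ := h
  have hd : dist (ctr S) (ctr T) < 2 := by
    have := dist_triangle_left (ctr S) (ctr T) z
    rw [Metric.mem_ball] at hS hT
    linarith
  rw [dist_eq_norm] at hd
  have h1 := (abs_re_le_norm (ctr S - ctr T)).trans_lt hd
  have h2 := (abs_im_le_norm (ctr S - ctr T)).trans_lt hd
  simp only [ctr, sub_re, sub_im, add_sub_add_right_eq_sub] at h1 h2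
  rw [abs_lt] at h1 h2
  have a1 := h1.1
  have a2 := h1.2
  have a3 := h2.1
  have a4 := h2.2
  have b1 : (T.1 : ℝ) < S.1 + 2 := by linarith
  have b2 : (S.1 : ℝ) < T.1 + 2 := by linarith
  have b3 : (T.2 : ℝ) < S.2 + 2 := by linarith
  have b4 : (S.2 : ℝ) < T.2 + 2 := by linarith
  norm_cast at b1 b2 b3 b4
  refine ⟨(max S.1 T.1, max S.2 T.2), vtx_mem_sq ?_ ?_ ?_ ?_, vtx_mem_sq ?_ ?_ ?_ ?_⟩ <;>
    simp only <;> omega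

theorem ctr_notMem_ball {S T : ℤ × ℤ} (h : T ≠ S) : ctr T ∉ Metric.ball (ctr S) (3 / 4) := by
  intro hm
  rw [Metric.mem_ball, dist_eq_norm] at hm
  have h1 := (abs_re_le_norm (ctr T - ctr S)).trans_lt hm
  have h2 := (abs_im_le_norm (ctr T - ctr S)).trans_lt hm
  simp only [ctr, sub_re, sub_im, add_sub_add_right_eq_sub] at h1 h2
  have h1' : |(T.1 : ℝ) - S.1| < 1 := h1.trans (by norm_num)
  have h2' : |(T.2 : ℝ) - S.2| < 1 := h2.trans (by norm_num)
  norm_cast at h1' h2'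
  rw [Int.abs_lt_one_iff] at h1' h2'
  exact h (Prod.ext (by omega) (by omega))

/-- The squares of `Q'` together with three sides of the square `S`. -/
def keyhole (Q' : Finset (ℤ × ℤ)) (S : ℤ × ℤ) (k₀ : Fin 4) : Set ℂ :=
  region Q' ∪ ⋃ k ∈ (Finset.univ.erase k₀ : Finset (Fin 4)), side S k

theorem isCompact_keyhole (Q' : Finset (ℤ × ℤ)) (S : ℤ × ℤ) (k₀ : Fin 4) :
    IsCompact (keyhole Q' S k₀) :=
  (isCompact_region Q').union (Finset.isCompact_biUnion _ fun _ _ => isCompact_edge _ _)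

theorem mem_keyhole {Q' : Finset (ℤ × ℤ)} {S : ℤ × ℤ} {k₀ : Fin 4} {z : ℂ} :
    z ∈ keyhole Q' S k₀ ↔ (∃ T ∈ Q', z ∈ sq T) ∨ ∃ k, k ≠ k₀ ∧ z ∈ side S k := by
  simp [keyhole, mem_region]

theorem InSq.notMem_keyhole {Q' : Finset (ℤ × ℤ)} {S T : ℤ × ℤ} {k₀ : Fin 4} {z : ℂ}
    (h : InSq T z) (hT : T ∉ Q') : z ∉ keyhole Q' S k₀ := by
  rw [mem_keyhole]
  rintro (⟨T', hT', hz⟩ | ⟨k, -, hz⟩)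
  · exact hT (h.eq_of_mem_sq hz ▸ hT')
  · exact h.notMem_side hz

theorem inSq_edgePath_ctr {S : ℤ × ℤ} {z : ℂ} (hz : z ∈ sq S) {t : ℝ} (h0 : 0 < t) (h1 : t ≤ 1) :
    InSq S (edgePath z (ctr S) t) := by
  obtain ⟨⟨h1, h2⟩, h3, h4⟩ := mem_sq.mp hz
  simp only [InSq, edgePath, ctr, add_re, add_im, mul_re, mul_im, ofReal_re, ofReal_im, sub_re,
    sub_im, zero_mul, sub_zero, add_zero]
  refine ⟨⟨?_, ?_⟩, ?_, ?_⟩ <;> nlinarith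

theorem isPreconnected_edge (a b : ℂ) : IsPreconnected (edge a b) :=
  isPreconnected_Icc.image _ (continuous_edgePath a b).continuousOn

theorem left_mem_edge (a b : ℂ) : a ∈ edge a b := ⟨0, by simp, by simp [edgePath]⟩

theorem right_mem_edge (a b : ℂ) : b ∈ edge a b := ⟨1, by simp, by simp [edgePath]⟩

/-- The segment leaves `S` through the midpoint of the missing side. That midpoint lies on no other
side of `S` and in no square except the two adjacent ones, neither of which is in `Q'`. -/
theorem edge_ctr_nbr_subset {Q' : Finset (ℤ × ℤ)} {S : ℤ × ℤ} {k₀ : Fin 4} (hS : S ∉ Q')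
    (hk₀ : S + nbr k₀ ∉ Q') : edge (ctr S) (ctr (S + nbr k₀)) ⊆ (keyhole Q' S k₀)ᶜ := by
  rintro _ ⟨t, ⟨ht0, ht1⟩, rfl⟩
  rcases lt_trichotomy t (1 / 2) with h | h | h
  · refine InSq.notMem_keyhole (T := S) ?_ hS
    fin_cases k₀ <;> simp [InSq, edgePath, ctr, nbr] <;>
      constructor <;> try constructor
    all_goals linarith
  · subst h
    rw [mem_compl_iff, mem_keyhole]
    rintro (⟨T, hT, hz⟩ | ⟨k, hk, hz⟩)
    · have : T = S ∨ T = S + nbr k₀ := by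
        obtain ⟨⟨h5, h6⟩, h7, h8⟩ := mem_sq.mp hz
        simp only [edgePath, ctr, Prod.fst_add, Prod.snd_add, add_re, add_im, mul_re, mul_im,
          sub_re, sub_im, ofReal_re, ofReal_im, zero_mul, sub_zero, add_zero] at h5 h6 h7 h8
        push_cast at h5 h6 h7 h8
        have e5 : (2 * T.1 : ℝ) ≤ 2 * S.1 + 1 + (nbr k₀).1 := by linarith
        have e6 : (2 * S.1 + 1 + (nbr k₀).1 : ℝ) ≤ 2 * T.1 + 2 := by linarith
        have e7 : (2 * T.2 : ℝ) ≤ 2 * S.2 + 1 + (nbr k₀).2 := by linarith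
        have e8 : (2 * S.2 + 1 + (nbr k₀).2 : ℝ) ≤ 2 * T.2 + 2 := by linarith
        norm_cast at e5 e6 e7 e8
        simp only [Prod.ext_iff, Prod.fst_add, Prod.snd_add]
        fin_cases k₀ <;> simp [nbr] at e5 e6 e7 e8 ⊢ <;> omega
      rcases this with rfl | rfl
      · exact hS hT
      · exact hk₀ hT
    · have := mem_side_cases hz
      fin_cases k₀ <;> fin_cases k <;> simp [edgePath, ctr, nbr] at this hk <;> linarith
  · refine InSq.notMem_keyhole (T := S + nbr k₀) ?_ hk₀
    fin_cases k₀ <;> simp [InSq, edgePath, ctr, nbr] <;>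
      constructor <;> try constructor
    all_goals linarith

theorem eq_vtx_of_mem_side_of_mem_side {S : ℤ × ℤ} {j k : Fin 4} {z : ℂ} (hjk : j ≠ k)
    (hj : z ∈ side S j) (hk : z ∈ side S k) :
    z = vtx (S + corner k) ∨ z = vtx (S + corner (k + 1)) := by
  obtain ⟨⟨h1, h2⟩, h3, h4⟩ := mem_sq.mp (side_subset_sq S k hk)
  have cj := mem_side_cases hj
  have ck := mem_side_cases hk
  have key : ∀ v : ℤ × ℤ, z = vtx v ↔ z.re = v.1 ∧ z.im = v.2 := fun v => by
    simp [Complex.ext_iff, vtx]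
  rw [key, key]
  have hne : (S.2 : ℝ) ≠ S.2 + 1 := by norm_num
  have hne' : (S.1 : ℝ) ≠ S.1 + 1 := by norm_num
  fin_cases j <;> fin_cases k <;> simp [corner] at hjk cj ck ⊢ <;> grind

/-- Every point off the keyhole set can be joined, off this set, to the centre of a square that is
neither `S` nor in `Q'`. -/
theorem exists_joined_ctr {Q' : Finset (ℤ × ℤ)} {S : ℤ × ℤ} {k₀ : Fin 4} (hS : S ∉ Q')
    (hk₀ : S + nbr k₀ ∉ Q') {ζ : ℂ} (hζ : ζ ∉ keyhole Q' S k₀) :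
    ∃ T ∉ insert S Q', ∃ C : Set ℂ, IsPreconnected C ∧ C ⊆ (keyhole Q' S k₀)ᶜ ∧ ζ ∈ C ∧
      ctr T ∈ C := by
  set T : ℤ × ℤ := (⌊ζ.re⌋, ⌊ζ.im⌋)
  have hT : ζ ∈ sq T := mem_sq_floor ζ
  have hTQ : T ∉ Q' := fun h => hζ (mem_keyhole.mpr (Or.inl ⟨T, h, hT⟩))
  have hsub : edge ζ (ctr T) ⊆ (keyhole Q' S k₀)ᶜ := by
    rintro _ ⟨t, ⟨ht0, ht1⟩, rfl⟩
    rcases ht0.eq_or_lt with rfl | h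
    · simpa [edgePath] using hζ
    · exact (inSq_edgePath_ctr hT h ht1).notMem_keyhole hTQ
  by_cases hTS : T = S
  · refine ⟨S + nbr k₀, ?_, edge ζ (ctr T) ∪ edge (ctr S) (ctr (S + nbr k₀)), ?_,
      union_subset hsub (edge_ctr_nbr_subset hS hk₀), Or.inl (left_mem_edge _ _),
      Or.inr (right_mem_edge _ _)⟩
    · rw [Finset.mem_insert, not_or]
      refine ⟨?_, hk₀⟩
      fin_cases k₀ <;> simp [nbr]
    · exact (isPreconnected_edge _ _).union (ctr S) (hTS ▸ right_mem_edge _ _)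
        (left_mem_edge _ _) (isPreconnected_edge _ _)
  · exact ⟨T, by simp [hTS, hTQ], edge ζ (ctr T), isPreconnected_edge _ _, hsub,
      left_mem_edge _ _, right_mem_edge _ _⟩

end LocUniv

end

/-! ### Solutions near a set, extension to new sides, gluing of primitives. -/

noncomputable section
namespace LocUniv
open Complex

/-- Near `K`, the functions `s` and `f` are holomorphic and `f' = theta a r q z (s z)`. -/
def SolNear (a r q : ℂ → ℂ) (K : Set ℂ) (s f : ℂ → ℂ) : Prop :=
  ∀ᶠ z in 𝓝ˢ K, DifferentiableAt ℂ s z ∧ HasDerivAt f (theta a r q z (s z)) z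

/-- The restrictions to `E` of the holomorphic functions in `N`. -/
def holomorphicRestrict (E N : Set ℂ) : Subalgebra ℂ C(E, ℂ) where
  carrier := {ψ | ∃ g : ℂ → ℂ, DifferentiableOn ℂ g N ∧ ∀ z : E, ψ z = g z}
  mul_mem' := by
    rintro ψ₁ ψ₂ ⟨g₁, h₁, e₁⟩ ⟨g₂, h₂, e₂⟩
    exact ⟨fun z => g₁ z * g₂ z, h₁.mul h₂, fun z => by simp [e₁, e₂]⟩
  add_mem' := by
    rintro ψ₁ ψ₂ ⟨g₁, h₁, e₁⟩ ⟨g₂, h₂, e₂⟩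
    exact ⟨fun z => g₁ z + g₂ z, h₁.add h₂, fun z => by simp [e₁, e₂]⟩
  algebraMap_mem' := fun c => ⟨fun _ => c, differentiableOn_const _, fun _ => rfl⟩

theorem continuous_superposition {E : Type*} [TopologicalSpace E] [LocallyCompactSpace E]
    (θ : C(E × ℂ, ℂ)) : Continuous (superposition θ) := by
  apply ContinuousMap.continuous_of_continuous_uncurry
  change Continuous fun p : C(E, ℂ) × E => θ (p.2, p.1 p.2)
  fun_prop

/-- The integral along a segment contained in `E`, as a continuous functional on `C(E)`. -/
def edgeCLM {E : Set ℂ} [CompactSpace E] {x y : ℂ} (h : edge x y ⊆ E) : C(E, ℂ) →L[ℂ] ℂ :=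
  let γ : C(ℝ, E) := ⟨fun t => ⟨edgePath x y (max 0 (min 1 t)),
    h (edgePath_mem ⟨le_max_left _ _, max_le zero_le_one (min_le_left _ _)⟩)⟩, by fun_prop⟩
  LinearMap.mkContinuous
    { toFun := fun g => ∫ t in (0 : ℝ)..1, (y - x) * g (γ t)
      map_add' := fun g₁ g₂ => by
        simp only [ContinuousMap.add_apply, mul_add]
        exact intervalIntegral.integral_add (Continuous.intervalIntegrable (by fun_prop) _ _)
          (Continuous.intervalIntegrable (by fun_prop) _ _)
      map_smul' := fun c g => by
        simp only [ContinuousMap.smul_apply, smul_eq_mul, RingHom.id_apply,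
          ← intervalIntegral.integral_const_mul]
        congr 1
        ext t
        ring } ‖y - x‖ (fun g => by
      have := intervalIntegral.norm_integral_le_of_norm_le_const (a := 0) (b := 1)
        (C := ‖y - x‖ * ‖g‖) (f := fun t => (y - x) * g (γ t)) (fun t _ => by
          rw [norm_mul]
          gcongr
          exact g.norm_coe_le_norm _)
      simpa using this)

theorem edgeCLM_apply {E : Set ℂ} [CompactSpace E] {x y : ℂ} (h : edge x y ⊆ E) {g : C(E, ℂ)}
    {G : ℂ → ℂ} (hG : ∀ z : E, g z = G z) : edgeCLM h g = edgeIntegral G x y := by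
  refine intervalIntegral.integral_congr fun t ht => ?_
  rw [uIcc_of_le zero_le_one] at ht
  change (y - x) * g ⟨edgePath x y (max 0 (min 1 t)), _⟩ = _
  rw [hG]
  simp only
  rw [min_eq_right ht.2, max_eq_right ht.1]

/-- Extension of `s` to some of the sides of the square `S`, with prescribed integrals. -/
theorem exists_extend_along_sides {Q' : Finset (ℤ × ℤ)} {S : ℤ × ℤ} (hS : S ∉ Q')
    {a r q : ℂ → ℂ} (ha : ContinuousOn a (sq S)) (hr : ContinuousOn r (sq S))
    (hq : ContinuousOn q (sq S)) (hr0 : ∀ z ∈ sq S, r z ≠ 0) (hq0 : ∀ z ∈ sq S, q z ≠ 0)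
    {s : ℂ → ℂ} (hs : ContinuousOn s (region Q')) (F : ℤ × ℤ → ℂ)
    (hF : ∀ k, S + nbr k ∈ Q' → edgeIntegral (fun z => theta a r q z (s z))
      (vtx (S + corner k)) (vtx (S + corner (k + 1))) = F (S + corner (k + 1)) - F (S + corner k))
    (I : Finset (Fin 4)) :
    ∃ s' : ℂ → ℂ, ContinuousOn s' (region Q' ∪ ⋃ k ∈ I, side S k) ∧ EqOn s' s (region Q') ∧
      ∀ k ∈ I, edgeIntegral (fun z => theta a r q z (s' z)) (vtx (S + corner k))
        (vtx (S + corner (k + 1))) = F (S + corner (k + 1)) - F (S + corner k) := by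
  induction I using Finset.induction_on with
  | empty => exact ⟨s, by simpa using hs, fun _ _ => rfl, by simp⟩
  | insert k I hk ih =>
    obtain ⟨s₁, hc, he, hi⟩ := ih
    have hset : (region Q' ∪ ⋃ j ∈ insert k I, side S j) =
        (region Q' ∪ ⋃ j ∈ I, side S j) ∪ side S k := by
      rw [Finset.set_biUnion_insert, union_assoc, union_comm (side S k)]
    have hsq := side_subset_sq S k
    rw [hset]
    -- A side shared with a square of `Q'` carries `s` already, with the right integral by `hF`. Any
    -- other side meets the current set at most in its end points, so `s` can be extended along it
    -- freely.
    by_cases hn : S + nbr k ∈ Q'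
    · have hsub : side S k ⊆ region Q' := fun z hz =>
        mem_region.mpr ⟨_, hn, side_subset_sq_nbr S k hz⟩
      refine ⟨s₁, ?_, he, ?_⟩
      · rwa [union_eq_left.mpr (hsub.trans subset_union_left)]
      · intro j hj
        rcases Finset.mem_insert.mp hj with rfl | hj
        · rw [← hF j hn]
          exact edgeIntegral_congr fun z hz => by simp only [he (hsub hz)]
        · exact hi j hj
    · have hclosed : IsClosed (region Q' ∪ ⋃ j ∈ I, side S j) :=
        ((isCompact_region Q').union
          (Finset.isCompact_biUnion _ fun _ _ => isCompact_edge _ _)).isClosed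
      have hEe : ∀ z ∈ (region Q' ∪ ⋃ j ∈ I, side S j) ∩ side S k,
          z = vtx (S + corner k) ∨ z = vtx (S + corner (k + 1)) := by
        rintro z ⟨hz | hz, hzk⟩
        · obtain ⟨T, hT, hzT⟩ := mem_region.mp hz
          exact eq_vtx_of_mem_side hzk hzT (fun h => hS (h ▸ hT)) (fun h => hn (h ▸ hT))
        · obtain ⟨j, hj, hzj⟩ := mem_iUnion₂.mp hz
          exact eq_vtx_of_mem_side_of_mem_side (fun h => hk (h ▸ hj)) hzj hzk
      obtain ⟨s₂, h2c, h2e, h2i⟩ := exists_extend_along_edge hclosed hc (vtx_corner_ne S k) hEe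
        (ha.mono hsq) (hr.mono hsq) (hq.mono hsq) (fun z hz => hr0 z (hsq hz))
        (fun z hz => hq0 z (hsq hz)) (F (S + corner (k + 1)) - F (S + corner k))
      refine ⟨s₂, h2c, fun z hz => (h2e (Or.inl hz)).trans (he hz), ?_⟩
      intro j hj
      rcases Finset.mem_insert.mp hj with rfl | hj
      · exact h2i
      · rw [← hi j hj]
        refine edgeIntegral_congr fun z hz => ?_
        simp only [h2e (Or.inr (mem_biUnion hj hz))]

/-- Removing one side of a square leaves a path through all four corners. This is why one side per
square needs no period condition. -/
theorem forall_corner_eq {c : Fin 4 → ℂ} (h0 : c 0 = 0) (k₀ : Fin 4)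
    (h : ∀ k, k ≠ k₀ → c (k + 1) = c k) (k : Fin 4) : c k = 0 := by
  have e0 := h 0
  have e1 := h 1
  have e2 := h 2
  have e3 := h 3
  fin_cases k₀ <;> fin_cases k <;> simp at e0 e1 e2 e3 ⊢ <;> simp_all

open Classical in
/-- Local primitives on the discs around the squares of `Q`, matched at the corners, can be
glued. -/
theorem exists_primitive_of_vertex {Q : Finset (ℤ × ℤ)} {h : ℂ → ℂ}
    (hh : DifferentiableOn ℂ h (⋃ T ∈ Q, Metric.ball (ctr T) (3 / 4))) {G : ℤ × ℤ → ℂ}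
    (k₀ : ℤ × ℤ → Fin 4)
    (hG : ∀ T ∈ Q, ∀ k, k ≠ k₀ T → edgeIntegral h (vtx (T + corner k)) (vtx (T + corner (k + 1))) =
      G (T + corner (k + 1)) - G (T + corner k)) :
    ∃ f : ℂ → ℂ, (∀ z ∈ ⋃ T ∈ Q, Metric.ball (ctr T) (3 / 4), HasDerivAt f (h z) z) ∧
      ∀ T ∈ Q, ∀ k, f (vtx (T + corner k)) = G (T + corner k) := by
  have hsub : ∀ T ∈ Q, Metric.ball (ctr T) (3 / 4) ⊆ ⋃ T ∈ Q, Metric.ball (ctr T) (3 / 4) :=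
    fun T hT => subset_biUnion_of_mem (u := fun T => Metric.ball (ctr T) (3 / 4)) hT
  have hloc : ∀ T : ℤ × ℤ, ∃ g : ℂ → ℂ, T ∈ Q →
      (∀ z ∈ Metric.ball (ctr T) (3 / 4), HasDerivAt g (h z) z) ∧
      ∀ k, g (vtx (T + corner k)) = G (T + corner k) := by
    intro T
    by_cases hT : T ∈ Q
    · obtain ⟨g, hg0, hg⟩ := ((hh.mono (hsub T hT)).isExactOn_ball).with_val_at
        (vtx (T + corner 0)) (G (T + corner 0))
      refine ⟨g, fun _ => ⟨hg, fun k => ?_⟩⟩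
      refine sub_eq_zero.mp (forall_corner_eq
        (c := fun k => g (vtx (T + corner k)) - G (T + corner k)) (by simp [hg0]) (k₀ T) ?_ k)
      intro k hk
      have hss : side T k ⊆ Metric.ball (ctr T) (3 / 4) :=
        (side_subset_sq T k).trans (sq_subset_ball T)
      have := edgeIntegral_eq_sub (fun z hz => hg z (hss hz))
        (((hh.mono (hsub T hT)).continuousOn).mono hss)
      rw [hG T hT k hk] at this
      linear_combination -this
    · exact ⟨0, fun h => absurd h hT⟩
  choose g hg using hloc
  have hmatch : ∀ S ∈ Q, ∀ T ∈ Q, ∀ z ∈ Metric.ball (ctr S) (3 / 4) ∩ Metric.ball (ctr T) (3 / 4),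
      g S z = g T z := by
    intro S hS T hT z hz
    obtain ⟨v, hvS, hvT⟩ := exists_common_vtx ⟨z, hz⟩
    obtain ⟨i, hi⟩ := exists_corner_of_mem_sq hvS
    obtain ⟨j, hj⟩ := exists_corner_of_mem_sq hvT
    -- The intersection of the discs is convex and contains the common corner, where both primitives
    -- take the value prescribed by `G`.
    have hconv : Convex ℝ (Metric.ball (ctr S) (3 / 4) ∩ Metric.ball (ctr T) (3 / 4)) :=
      (convex_ball _ _).inter (convex_ball _ _)
    have := hconv.norm_image_sub_le_of_norm_hasDerivWithin_le (f := fun z => g S z - g T z)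
      (f' := fun _ => 0) (C := 0)
      (fun x hx => by
        have := (((hg S hS).1 x hx.1).sub ((hg T hT).1 x hx.2)).hasDerivWithinAt
          (s := Metric.ball (ctr S) (3 / 4) ∩ Metric.ball (ctr T) (3 / 4))
        rw [sub_self] at this
        exact this) (fun x _ => by simp)
      ⟨sq_subset_ball S hvS, sq_subset_ball T hvT⟩ hz
    have e1 : g S (vtx v) = G v := by rw [hi]; exact (hg S hS).2 i
    have e2 : g T (vtx v) = G v := by rw [hj]; exact (hg T hT).2 j
    rw [e1, e2, sub_self, sub_zero, zero_mul] at this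
    exact sub_eq_zero.mp (norm_le_zero_iff.mp this)
  set f : ℂ → ℂ := fun z => if hz : ∃ T ∈ Q, z ∈ Metric.ball (ctr T) (3 / 4)
    then g hz.choose z else 0 with hf
  have hfg : ∀ T ∈ Q, ∀ z ∈ Metric.ball (ctr T) (3 / 4), f z = g T z := by
    intro T hT z hz
    have hex : ∃ T ∈ Q, z ∈ Metric.ball (ctr T) (3 / 4) := ⟨T, hT, hz⟩
    simp only [hf, dif_pos hex]
    exact hmatch _ hex.choose_spec.1 _ hT z ⟨hex.choose_spec.2, hz⟩
  refine ⟨f, fun z hz => ?_, fun T hT k => ?_⟩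
  · obtain ⟨T, hT, hzT⟩ := mem_iUnion₂.mp hz
    refine ((hg T hT).1 z hzT).congr_of_eventuallyEq ?_
    filter_upwards [Metric.isOpen_ball.mem_nhds hzT] with y hy using hfg T hT y hy
  · rw [hfg T hT _ (sq_subset_ball T (vtx_corner_mem_sq T k)), (hg T hT).2 k]

end LocUniv

end

/-! ### Adding one square. -/

noncomputable section
namespace LocUniv
open Complex

/-- The difference operator on lattice functions, along the sides of a finite list. -/
def sideDiff (J : Finset ((ℤ × ℤ) × Fin 4)) : (ℤ × ℤ → ℂ) →ₗ[ℂ] (J → ℂ) where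
  toFun G i := G (i.1.1 + corner (i.1.2 + 1)) - G (i.1.1 + corner i.1.2)
  map_add' G₁ G₂ := by ext i; simp; ring
  map_smul' c G := by ext i; simp; ring

/-- Used to recover vertex values from side increments linearly: on a finite-dimensional target such
a choice is continuous at each vertex, so small changes of the integrals move the vertex values
little. -/
theorem exists_linear_section {V Y : Type*} [AddCommGroup V] [Module ℂ V] [AddCommGroup Y]
    [Module ℂ Y] (D : V →ₗ[ℂ] Y) : ∃ σ : Y →ₗ[ℂ] V, ∀ y ∈ LinearMap.range D, D (σ y) = y := by
  obtain ⟨σ, hσ⟩ := LinearMap.exists_rightInverse_of_surjective D.rangeRestrict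
    (LinearMap.range_rangeRestrict D)
  obtain ⟨π, hπ⟩ := LinearMap.exists_leftInverse_of_injective (LinearMap.range D).subtype
    (Submodule.ker_subtype _)
  refine ⟨σ ∘ₗ π, fun y hy => ?_⟩
  have h1 : π y = ⟨y, hy⟩ := LinearMap.congr_fun hπ ⟨y, hy⟩
  have h2 := congrArg Subtype.val (LinearMap.congr_fun hσ ⟨y, hy⟩)
  simp only [LinearMap.comp_apply, h1]
  exact h2

theorem volume_keyhole_sdiff (Q' : Finset (ℤ × ℤ)) (S : ℤ × ℤ) (k₀ : Fin 4) :
    MeasureTheory.volume (keyhole Q' S k₀ \ region Q') = 0 := by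
  refine MeasureTheory.measure_mono_null (t := ⋃ k : Fin 4, side S k) ?_
    (MeasureTheory.measure_iUnion_null fun k => volume_side S k)
  rintro z ⟨hz, hn⟩
  rcases mem_keyhole.mp hz with h | ⟨k, -, hk⟩
  · exact absurd (mem_region.mpr h) hn
  · exact mem_iUnion.mpr ⟨k, hk⟩

/-- Solutions near the squares of `Q'` can be approximated by solutions near one more square. -/
theorem exists_solNear_insert {O : Set ℂ} {a r q : ℂ → ℂ} (ha : DifferentiableOn ℂ a O)
    (hr : DifferentiableOn ℂ r O) (hq : DifferentiableOn ℂ q O) (hr0 : ∀ z ∈ O, r z ≠ 0)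
    {Q' : Finset (ℤ × ℤ)} {S : ℤ × ℤ} {k₀ : Fin 4} (hS : S ∉ Q') (hk₀ : S + nbr k₀ ∉ Q')
    (hball : ∀ T ∈ insert S Q', Metric.ball (ctr T) (3 / 4) ⊆ O) (hq0 : ∀ z ∈ sq S, q z ≠ 0)
    {s f : ℂ → ℂ} (h : SolNear a r q (region Q') s f) {ε : ℝ} (hε : 0 < ε) :
    ∃ s' f' : ℂ → ℂ, SolNear a r q (region (insert S Q')) s' f' ∧
      ∀ z ∈ region Q', ‖s' z - s z‖ < ε ∧ ‖f' z - f z‖ < ε := by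
  obtain ⟨U, hU, hLU, hUs⟩ := eventually_nhdsSet_iff_exists.mp h
  have hsU : DifferentiableOn ℂ s U := fun z hz => (hUs z hz).1.differentiableWithinAt
  set N : Set ℂ := ⋃ T ∈ insert S Q', Metric.ball (ctr T) (3 / 4) with hN
  have hNo : IsOpen N := isOpen_biUnion fun _ _ => Metric.isOpen_ball
  have hNO : N ⊆ O := iUnion₂_subset hball
  have haN := ha.mono hNO
  have hrN := hr.mono hNO
  have hqN := hq.mono hNO
  have hr0N : ∀ z ∈ N, r z ≠ 0 := fun z hz => hr0 z (hNO hz)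
  have hsqN : ∀ T ∈ insert S Q', sq T ⊆ N := fun T hT =>
    (sq_subset_ball T).trans (subset_biUnion_of_mem
      (u := fun T => Metric.ball (ctr T) (3 / 4)) hT)
  have hSN := hsqN S (Finset.mem_insert_self S Q')
  have hLN : region Q' ⊆ N := iUnion₂_subset fun T hT => hsqN T (Finset.mem_insert_of_mem hT)
  set E := keyhole Q' S k₀ with hE
  have hEc : IsCompact E := isCompact_keyhole Q' S k₀
  have : CompactSpace E := isCompact_iff_compactSpace.mp hEc
  have hLE : region Q' ⊆ E := subset_union_left
  have hEN : E ⊆ N := union_subset hLN (iUnion₂_subset fun k _ => (side_subset_sq S k).trans hSN)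
  -- sides and their vertices
  set F : ℤ × ℤ → ℂ := fun v => f (vtx v) with hF
  have hFs : ∀ T ∈ Q', ∀ x y, x ∈ sq T → y ∈ sq T →
      edgeIntegral (fun z => theta a r q z (s z)) x y = f y - f x := by
    intro T hT x y hx hy
    have hsub : edge x y ⊆ region Q' := fun z hz =>
      mem_region.mpr ⟨T, hT, edge_subset_of_convex (convex_sq T) hx hy hz⟩
    refine edgeIntegral_eq_sub (fun z hz => (hUs z (hLU (hsub hz))).2) ?_
    have hUN : DifferentiableOn ℂ (fun z => theta a r q z (s z)) (U ∩ N) :=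
      DifferentiableOn.theta (haN.mono inter_subset_right) (hrN.mono inter_subset_right)
        (hqN.mono inter_subset_right) (hsU.mono inter_subset_left)
    exact hUN.continuousOn.mono fun z hz => ⟨hLU (hsub hz), hLN (hsub hz)⟩
  -- On the new sides the prescribed integrals are the increments of `f` between the vertices. At a
  -- vertex outside the old region `f` may have any value; only consistency matters.
  obtain ⟨u₀, hu₀c, hu₀s, hu₀i⟩ := exists_extend_along_sides hS (haN.continuousOn.mono hSN)
    (hrN.continuousOn.mono hSN) (hqN.continuousOn.mono hSN) (fun z hz => hr0N z (hSN hz)) hq0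
    (hsU.continuousOn.mono hLU) F (fun k hk => hFs _ hk _ _
      (side_subset_sq_nbr S k (left_mem_edge _ _)) (side_subset_sq_nbr S k (right_mem_edge _ _)))
    (Finset.univ.erase k₀)
  let u : C(E, ℂ) := ⟨fun z => u₀ z, hu₀c.comp_continuous continuous_subtype_val fun z => z.2⟩
  -- the algebra of holomorphic functions
  set A := holomorphicRestrict E N with hA
  have hAc : IsClosed (A.topologicalClosure : Set C(E, ℂ)) := A.isClosed_topologicalClosure
  have hker : ∀ ζ : ↥Eᶜ, cauchyKernel E ζ ∈ A.topologicalClosure := by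
    intro ζ
    obtain ⟨T, hT, C, hC, hCE, hζC, hTC⟩ := exists_joined_ctr hS hk₀ ζ.2
    refine cauchyKernel_mem_of_isPreconnected A.topologicalClosure hAc hC hCE
      (ζ₀ := ⟨ctr T, hCE hTC⟩) hTC hζC (A.le_topologicalClosure ⟨fun z => (z - ctr T)⁻¹, ?_,
        fun z => rfl⟩)
    refine DifferentiableOn.inv (by fun_prop) fun z hz h0 => ?_
    obtain ⟨T', hT', hz'⟩ := mem_iUnion₂.mp hz
    rw [sub_eq_zero.mp h0] at hz'
    exact ctr_notMem_ball (fun h : T = T' => hT (h ▸ hT')) hz'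
  have hu : u ∈ A.topologicalClosure :=
    mem_of_eqOn_holomorphic (isCompact_region Q') hLE hU hLU hsU (volume_keyhole_sdiff Q' S k₀)
      (Subalgebra.toSubmodule A.topologicalClosure) hAc hker u fun z hz => hu₀s hz
  -- the superposition operators
  have haE := haN.continuousOn.comp_continuous (continuous_subtype_val (p := (· ∈ E)))
    fun z => hEN z.2
  have hrE := hrN.continuousOn.comp_continuous (continuous_subtype_val (p := (· ∈ E)))
    fun z => hEN z.2
  have hqE := hqN.continuousOn.comp_continuous (continuous_subtype_val (p := (· ∈ E)))
    fun z => hEN z.2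
  have hes := differentiable_expSlope.continuous
  let θ : C(E × ℂ, ℂ) := ⟨fun p => theta a r q p.1 p.2, by
    unfold theta
    have h1 := haE.comp (continuous_fst (X := E) (Y := ℂ))
    have h2 := hrE.comp (continuous_fst (X := E) (Y := ℂ))
    have h3 := hqE.comp (continuous_fst (X := E) (Y := ℂ))
    exact h1.add (h2.mul (continuous_snd.mul (hes.comp ((h3.pow 2).mul continuous_snd))))⟩
  let θ' : C(E × ℂ, ℂ) := ⟨fun p => r p.1 * exp (q p.1 ^ 2 * p.2), by
    have h2 := hrE.comp (continuous_fst (X := E) (Y := ℂ))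
    have h3 := hqE.comp (continuous_fst (X := E) (Y := ℂ))
    exact h2.mul (continuous_exp.comp ((h3.pow 2).mul continuous_snd))⟩
  let θi : C(E × ℂ, ℂ) := ⟨fun p => (r p.1)⁻¹ * exp (-(q p.1 ^ 2 * p.2)), by
    have h2 := hrE.comp (continuous_fst (X := E) (Y := ℂ))
    have h3 := hqE.comp (continuous_fst (X := E) (Y := ℂ))
    exact (h2.inv₀ fun p => hr0N _ (hEN p.1.2)).mul
      (continuous_exp.comp ((h3.pow 2).mul continuous_snd).neg)⟩
  set Θ := superposition θ with hΘ
  have hΘc : Continuous Θ := continuous_superposition θ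
  have hΘd : HasStrictFDerivAt Θ (ContinuousLinearMap.mul ℂ C(E, ℂ) (superposition θ' u)) u :=
    hasStrictFDerivAt_superposition θ θ' (fun z x => hasDerivAt_theta a r q z x) u
  have hΘA : ∀ w ∈ A, Θ w ∈ A := by
    rintro w ⟨g, hg, hwg⟩
    refine ⟨fun z => theta a r q z (g z), DifferentiableOn.theta haN hrN hqN hg, fun z => ?_⟩
    change theta a r q z (w z) = _
    rw [hwg]
  have hm' : superposition θi u ∈ A.topologicalClosure := by
    refine map_mem_closure (continuous_superposition θi) hu ?_
    rintro w ⟨g, hg, hwg⟩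
    refine ⟨fun z => (r z)⁻¹ * exp (-(q z ^ 2 * g z)),
      (hrN.inv hr0N).mul (((hqN.pow 2).mul hg).neg.cexp), fun z => ?_⟩
    change (r z)⁻¹ * exp (-(q z ^ 2 * w z)) = _
    rw [hwg]
  have hmm : superposition θ' u * superposition θi u = 1 := by
    ext z
    change r z * exp (q z ^ 2 * u z) * ((r z)⁻¹ * exp (-(q z ^ 2 * u z))) = 1
    have := hr0N _ (hEN z.2)
    rw [exp_neg]
    field_simp [exp_ne_zero]
  -- the finitely many conditions
  set J : Finset ((ℤ × ℤ) × Fin 4) :=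
    Q' ×ˢ Finset.univ ∪ {S} ×ˢ (Finset.univ.erase k₀) with hJ
  have hJside : ∀ i ∈ J, side i.1 i.2 ⊆ E := by
    rintro ⟨T, k⟩ hi z hz
    simp only [hJ, Finset.mem_union, Finset.mem_product, Finset.mem_univ, and_true,
      Finset.mem_singleton, Finset.mem_erase] at hi
    rcases hi with hT | ⟨rfl, hk⟩
    · exact hLE (mem_region.mpr ⟨T, hT, side_subset_sq T k hz⟩)
    · exact mem_keyhole.mpr (Or.inr ⟨k, hk, hz⟩)
  let Λ : C(E, ℂ) →L[ℂ] (J → ℂ) := ContinuousLinearMap.pi fun i => edgeCLM (hJside i.1 i.2)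
  have hΛu : Λ (Θ u) = sideDiff J F := by
    ext ⟨⟨T, k⟩, hi⟩
    change edgeCLM (hJside _ hi) (Θ u) = F (T + corner (k + 1)) - F (T + corner k)
    rw [edgeCLM_apply (hJside _ hi) (G := fun z => theta a r q z (u₀ z)) (fun z => rfl)]
    have hi' := hi
    simp only [hJ, Finset.mem_union, Finset.mem_product, Finset.mem_univ, and_true,
      Finset.mem_singleton, Finset.mem_erase] at hi'
    rcases hi' with hT | ⟨rfl, hk⟩
    · rw [← hFs T hT _ _ (vtx_corner_mem_sq T k) (vtx_corner_mem_sq T (k + 1))]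
      refine edgeIntegral_congr fun z hz => ?_
      simp only [hu₀s (mem_region.mpr ⟨T, hT, side_subset_sq T k hz⟩)]
    · exact hu₀i k (Finset.mem_erase.mpr ⟨hk, Finset.mem_univ k⟩)
  obtain ⟨σ, hσ⟩ := exists_linear_section (sideDiff J)
  -- closeness conditions
  have hev1 : ∀ᶠ w in 𝓝 u, ‖w - u‖ < ε :=
    (continuous_id.sub continuous_const).norm.continuousAt.eventually_lt continuousAt_const
      (by change ‖u - u‖ < ε; rwa [sub_self, norm_zero])
  have hev2 : ∀ᶠ w in 𝓝 u, ‖Θ w - Θ u‖ < ε / 8 :=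
    (hΘc.sub continuous_const).norm.continuousAt.eventually_lt continuousAt_const
      (by change ‖Θ u - Θ u‖ < ε / 8; rw [sub_self, norm_zero]; positivity)
  have hev3 : ∀ᶠ w in 𝓝 u, ∀ T ∈ Q', ∀ k : Fin 4,
      ‖σ (Λ (Θ w) - Λ (Θ u)) (T + corner k)‖ < ε / 4 := by
    rw [Filter.eventually_all_finset]
    intro T _
    rw [Filter.eventually_all]
    intro k
    have hc : Continuous ((LinearMap.proj (T + corner k) : (ℤ × ℤ → ℂ) →ₗ[ℂ] ℂ) ∘ₗ σ) :=
      LinearMap.continuous_of_finiteDimensional _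
    have hc2 : Continuous fun w => ‖σ (Λ (Θ w) - Λ (Θ u)) (T + corner k)‖ :=
      (hc.comp ((Λ.continuous.comp hΘc).sub continuous_const)).norm
    refine hc2.continuousAt.eventually_lt continuousAt_const ?_
    simpa using hε
  obtain ⟨η, hη, hηev⟩ := Metric.eventually_nhds_iff.mp (hev1.and (hev2.and hev3))
  -- It suffices that the side integrals of the corrected function are increments of some vertex
  -- function; the old integrals need not be reproduced.
  obtain ⟨w, ⟨g, hg, hwg⟩, hwu, hwN⟩ := exists_mem_near_apply_mem A hΘd hΘA hu hm' hmm Λ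
    (LinearMap.range (sideDiff J)) (hΛu ▸ LinearMap.mem_range_self _ F) hη
  obtain ⟨hw1, hw2, hw3⟩ := hηev (by rwa [dist_eq_norm])
  set G : ℤ × ℤ → ℂ := F + σ (Λ (Θ w) - Λ (Θ u)) with hG
  have hGd : sideDiff J G = Λ (Θ w) := by
    rw [hG, map_add, hσ _ (Submodule.sub_mem _ hwN (hΛu ▸ LinearMap.mem_range_self _ F)), ← hΛu]
    abel
  have hwE : ∀ z ∈ E, ‖g z - u₀ z‖ < ε := fun z hz => by
    have := ((w - u).norm_coe_le_norm ⟨z, hz⟩).trans_lt hw1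
    rw [ContinuousMap.sub_apply, hwg] at this
    exact this
  have hΘE : ∀ z ∈ E, ‖theta a r q z (g z) - theta a r q z (u₀ z)‖ ≤ ε / 8 := fun z hz => by
    have := ((Θ w - Θ u).norm_coe_le_norm ⟨z, hz⟩).trans hw2.le
    rw [ContinuousMap.sub_apply] at this
    change ‖theta a r q z (w ⟨z, hz⟩) - theta a r q z (u₀ z)‖ ≤ _ at this
    rwa [hwg] at this
  have hint : ∀ i (hi : i ∈ J), edgeIntegral (fun z => theta a r q z (g z))
      (vtx (i.1 + corner i.2)) (vtx (i.1 + corner (i.2 + 1))) =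
      G (i.1 + corner (i.2 + 1)) - G (i.1 + corner i.2) := by
    intro i hi
    have h1 := congrFun hGd ⟨i, hi⟩
    change G (i.1 + corner (i.2 + 1)) - G (i.1 + corner i.2) = edgeCLM (hJside i hi) (Θ w) at h1
    rw [h1, edgeCLM_apply (hJside i hi) (G := fun z => theta a r q z (g z))]
    intro z
    change theta a r q z (w z) = _
    rw [hwg]
  -- The side `k₀` is omitted in every square; for `S` it is the only side not contained in `E`.
  obtain ⟨f', hf', hf'G⟩ := exists_primitive_of_vertex (Q := insert S Q') (G := G)
    (h := fun z => theta a r q z (g z)) (DifferentiableOn.theta haN hrN hqN hg) (fun _ => k₀)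
    (fun T hT k hk => hint (T, k) (by
      rcases Finset.mem_insert.mp hT with rfl | hT
      · simp [hJ, hk]
      · simp [hJ, hT]))
  refine ⟨g, f', ?_, fun z hz => ⟨?_, ?_⟩⟩
  · have hsub : region (insert S Q') ⊆ N := iUnion₂_subset hsqN
    filter_upwards [hNo.mem_nhdsSet.mpr hsub] with z hz
    exact ⟨hg.differentiableAt (hNo.mem_nhds hz), hf' z hz⟩
  · rw [← hu₀s hz]
    exact hwE z (hLE hz)
  · obtain ⟨T, hT, hzT⟩ := mem_region.mp hz
    have hv := vtx_corner_mem_sq T 0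
    have hTE : sq T ⊆ region Q' := fun x hx => mem_region.mpr ⟨T, hT, hx⟩
    -- Any point of a square is within distance `2` of its corner, so the derivative error
    -- contributes at most `ε / 4`; the corner contributes less than another `ε / 4`.
    have hmv := (convex_sq T).norm_image_sub_le_of_norm_hasDerivWithin_le
      (f := fun z => f' z - f z)
      (f' := fun z => theta a r q z (g z) - theta a r q z (s z)) (C := ε / 8)
      (fun x hx => ((hf' x (hLN (hTE hx))).sub (hUs x (hLU (hTE hx))).2).hasDerivWithinAt)
      (fun x hx => by
        rw [← hu₀s (hTE hx)]
        exact hΘE x (hLE (hTE hx))) hv hzT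
    have hd := dist_le_two_of_mem_sq hzT hv
    have hvert : ‖f' (vtx (T + corner 0)) - f (vtx (T + corner 0))‖ < ε / 4 := by
      rw [hf'G T (Finset.mem_insert_of_mem hT) 0]
      have : G (T + corner 0) - f (vtx (T + corner 0)) =
          σ (Λ (Θ w) - Λ (Θ u)) (T + corner 0) := by
        simp [hG, hF]
      rw [this]
      exact hw3 T hT 0
    have htri := norm_sub_norm_le (f' z - f z) (f' (vtx (T + corner 0)) - f (vtx (T + corner 0)))
    nlinarith

end LocUniv

end

/-! ### Order of adding squares, and passage to compact sets. -/

noncomputable section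
namespace LocUniv
open Complex

/-- The square can be joined to a square outside `Q` by a chain of adjacent squares avoiding
`B`. -/
inductive Free (B : Set (ℤ × ℤ)) (Q : Finset (ℤ × ℤ)) : ℤ × ℤ → Prop
  | out {S : ℤ × ℤ} : S ∉ Q → Free B Q S
  | step {S : ℤ × ℤ} {k : Fin 4} : S ∉ B → Free B Q (S + nbr k) → Free B Q S

theorem Free.anti {B : Set (ℤ × ℤ)} {Q Q' : Finset (ℤ × ℤ)} (hQ : Q' ⊆ Q) {S : ℤ × ℤ}
    (h : Free B Q S) : Free B Q' S := by
  induction h with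
  | out h => exact .out fun h' => h (hQ h')
  | step h _ ih => exact .step h ih

/-- Every square at which the chain takes a step is itself free, so it cannot belong to `B'`; the
same chain works. -/
theorem Free.of_blocked {B B' : Set (ℤ × ℤ)} {Q : Finset (ℤ × ℤ)}
    (hB : ∀ S ∈ B', ¬ Free B Q S) {S : ℤ × ℤ} (h : Free B Q S) : Free B' Q S := by
  induction h with
  | out h => exact .out h
  | step h h' ih => exact .step (fun hS => hB _ hS (.step h h')) ih

/-- Follow the chain to the square from which it first leaves `Q`. -/
theorem Free.exists_exposed {B : Set (ℤ × ℤ)} {Q : Finset (ℤ × ℤ)} {S : ℤ × ℤ} (h : Free B Q S)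
    (hS : S ∈ Q) : ∃ S₀ ∈ Q, S₀ ∉ B ∧ ∃ k, S₀ + nbr k ∉ Q := by
  induction h with
  | out h => exact absurd hS h
  | @step S k h h' ih =>
    by_cases hn : S + nbr k ∈ Q
    · exact ih hn
    · exact ⟨S, hS, h, k, hn⟩

/-- Approximation of solutions near the squares of `P` by solutions near the squares of `Q`. -/
theorem exists_solNear_region {O : Set ℂ} {a r q : ℂ → ℂ} (ha : DifferentiableOn ℂ a O)
    (hr : DifferentiableOn ℂ r O) (hq : DifferentiableOn ℂ q O) (hr0 : ∀ z ∈ O, r z ≠ 0)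
    {P : Finset (ℤ × ℤ)} {s f : ℂ → ℂ} (h : SolNear a r q (region P) s f)
    (n : ℕ) : ∀ (Q : Finset (ℤ × ℤ)), (Q \ P).card = n → P ⊆ Q →
    (∀ S ∈ Q, S ∉ P → Free (P : Set (ℤ × ℤ)) Q S) →
    (∀ T ∈ Q, Metric.ball (ctr T) (3 / 4) ⊆ O) → (∀ S ∈ Q, S ∉ P → ∀ z ∈ sq S, q z ≠ 0) →
    ∀ ε > 0, ∃ s' f' : ℂ → ℂ, SolNear a r q (region Q) s' f' ∧
      ∀ z ∈ region P, ‖s' z - s z‖ < ε ∧ ‖f' z - f z‖ < ε := by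
  induction n with
  | zero =>
    intro Q hn hPQ _ _ _ ε hε
    have : Q = P := Finset.Subset.antisymm
      (Finset.sdiff_eq_empty_iff_subset.mp (Finset.card_eq_zero.mp hn)) hPQ
    subst this
    exact ⟨s, f, h, fun z _ => by simpa using hε⟩
  | succ n ih =>
    intro Q hn hPQ hfree hball hq0 ε hε
    obtain ⟨S, hS⟩ := Finset.card_pos.mp (by rw [hn]; exact Nat.succ_pos n : 0 < (Q \ P).card)
    rw [Finset.mem_sdiff] at hS
    -- The exposed square is removed before the induction hypothesis is used and added back last,
    -- when its neighbour across side `k` is still absent.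
    obtain ⟨S₀, hS₀, hS₀P, k, hk⟩ := (hfree S hS.1 hS.2).exists_exposed hS.1
    have hS₀P' : S₀ ∉ P := hS₀P
    have hsub : Q.erase S₀ ⊆ Q := Finset.erase_subset _ _
    have hPe : P ⊆ Q.erase S₀ := fun T hT =>
      Finset.mem_erase.mpr ⟨fun h => hS₀P' (h ▸ hT), hPQ hT⟩
    obtain ⟨s₁, f₁, h₁, hc₁⟩ := ih (Q.erase S₀) (by
        rw [Finset.erase_sdiff_comm, Finset.card_erase_of_mem (Finset.mem_sdiff.mpr ⟨hS₀, hS₀P'⟩),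
          hn, Nat.add_sub_cancel]) hPe
      (fun T hT hTP => (hfree T (hsub hT) hTP).anti hsub) (fun T hT => hball T (hsub hT))
      (fun T hT => hq0 T (hsub hT)) (ε / 2) (by positivity)
    have hins : insert S₀ (Q.erase S₀) = Q := Finset.insert_erase hS₀
    obtain ⟨s₂, f₂, h₂, hc₂⟩ := exists_solNear_insert ha hr hq hr0 (Finset.notMem_erase S₀ Q)
      (fun h => hk (hsub h)) (by rwa [hins]) (hq0 S₀ hS₀ hS₀P') h₁ (half_pos hε)
    rw [hins] at h₂
    refine ⟨s₂, f₂, h₂, fun z hz => ?_⟩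
    have hz' : z ∈ region (Q.erase S₀) := by
      obtain ⟨T, hT, hzT⟩ := mem_region.mp hz
      exact mem_region.mpr ⟨T, hPe hT, hzT⟩
    have c1 := hc₁ z hz
    have c2 := hc₂ z hz'
    have t1 := norm_add_le (s₂ z - s₁ z) (s₁ z - s z)
    have t2 := norm_add_le (f₂ z - f₁ z) (f₁ z - f z)
    rw [sub_add_sub_cancel] at t1 t2
    exact ⟨by linarith, by linarith⟩

theorem finite_sq_inter {C : Set ℂ} (hC : Bornology.IsBounded C) :
    {T : ℤ × ℤ | (sq T ∩ C).Nonempty}.Finite := by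
  obtain ⟨R, hR⟩ := hC.subset_closedBall (0 : ℂ)
  refine ((Set.finite_Icc (-⌈R⌉ - 1) (⌈R⌉ + 1)).prod
    (Set.finite_Icc (-⌈R⌉ - 1) (⌈R⌉ + 1))).subset ?_
  rintro T ⟨z, hz, hzC⟩
  obtain ⟨⟨h1, h2⟩, h3, h4⟩ := mem_sq.mp hz
  have hn := hR hzC
  rw [mem_closedBall_zero_iff] at hn
  have hre := abs_le.mp ((abs_re_le_norm z).trans (hn.trans (Int.le_ceil R)))
  have him := abs_le.mp ((abs_im_le_norm z).trans (hn.trans (Int.le_ceil R)))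
  have e1 : (-⌈R⌉ - 1 : ℝ) ≤ T.1 := by linarith
  have e2 : (T.1 : ℝ) ≤ ⌈R⌉ + 1 := by linarith
  have e3 : (-⌈R⌉ - 1 : ℝ) ≤ T.2 := by linarith
  have e4 : (T.2 : ℝ) ≤ ⌈R⌉ + 1 := by linarith
  exact ⟨⟨mod_cast e1, mod_cast e2⟩, ⟨mod_cast e3, mod_cast e4⟩⟩

theorem isClosed_biUnion_sq (X : Set (ℤ × ℤ)) : IsClosed (⋃ S ∈ X, sq S) := by
  rw [biUnion_eq_iUnion]
  refine LocallyFinite.isClosed_iUnion ?_ fun S => (isCompact_sq _).isClosed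
  have : LocallyFinite sq := fun z =>
    ⟨Metric.ball z 1, Metric.ball_mem_nhds z one_pos, finite_sq_inter Metric.isBounded_ball⟩
  exact this.comp_injective Subtype.val_injective

theorem Free.of_mem_sq_row {B : Set (ℤ × ℤ)} {Q : Finset (ℤ × ℤ)} {S T : ℤ × ℤ} {z : ℂ}
    (h : Free B Q S) (hS : z ∈ sq S) (hT : z ∈ sq T) (hTB : T ∉ B) (hST : S.2 = T.2) :
    Free B Q T := by
  obtain ⟨⟨h1, h2⟩, -, -⟩ := mem_sq.mp hS
  obtain ⟨⟨h5, h6⟩, -, -⟩ := mem_sq.mp hT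
  have a1 : (S.1 : ℝ) ≤ T.1 + 1 := by linarith
  have a2 : (T.1 : ℝ) ≤ S.1 + 1 := by linarith
  norm_cast at a1 a2
  have : S.1 = T.1 ∨ S.1 = T.1 + 1 ∨ S.1 = T.1 + -1 := by omega
  rcases this with e | e | e
  · rwa [show T = S from Prod.ext e.symm hST.symm]
  · refine .step (k := 1) hTB ?_
    rwa [show T + nbr 1 = S from Prod.ext (by simp [nbr, e]) (by simp [nbr, hST])]
  · refine .step (k := 3) hTB ?_
    rwa [show T + nbr 3 = S from Prod.ext (by simp [nbr, e]) (by simp [nbr, hST])]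

theorem Free.of_mem_sq_column {B : Set (ℤ × ℤ)} {Q : Finset (ℤ × ℤ)} {S T : ℤ × ℤ} {z : ℂ}
    (h : Free B Q S) (hS : z ∈ sq S) (hT : z ∈ sq T) (hTB : T ∉ B) (hST : S.1 = T.1) :
    Free B Q T := by
  obtain ⟨-, h1, h2⟩ := mem_sq.mp hS
  obtain ⟨-, h5, h6⟩ := mem_sq.mp hT
  have a1 : (S.2 : ℝ) ≤ T.2 + 1 := by linarith
  have a2 : (T.2 : ℝ) ≤ S.2 + 1 := by linarith
  norm_cast at a1 a2
  have : S.2 = T.2 ∨ S.2 = T.2 + 1 ∨ S.2 = T.2 + -1 := by omega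
  rcases this with e | e | e
  · rwa [show T = S from Prod.ext hST.symm e.symm]
  · refine .step (k := 2) hTB ?_
    rwa [show T + nbr 2 = S from Prod.ext (by simp [nbr, hST]) (by simp [nbr, e])]
  · refine .step (k := 0) hTB ?_
    rwa [show T + nbr 0 = S from Prod.ext (by simp [nbr, hST]) (by simp [nbr, e])]

/-- Squares with a common point may touch only diagonally; the square `(S.1, T.2)` contains the same
point and is joined to each of them through a side, if not equal to it. -/
theorem Free.of_mem_sq {B : Set (ℤ × ℤ)} {Q : Finset (ℤ × ℤ)} {S T : ℤ × ℤ} {z : ℂ}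
    (h : Free B Q S) (hS : z ∈ sq S) (hT : z ∈ sq T) (hB : ∀ T, z ∈ sq T → T ∉ B) :
    Free B Q T := by
  have hm : z ∈ sq (S.1, T.2) := ⟨hS.1, hT.2⟩
  exact (h.of_mem_sq_column hS hm (hB _ hm) rfl).of_mem_sq_row hm hT (hB _ hT) rfl

/-- Along a connected set whose squares are all unblocked, freeness propagates. -/
theorem Free.of_isPreconnected {B : Set (ℤ × ℤ)} {Q : Finset (ℤ × ℤ)} {P : Set ℂ}
    (hP : IsPreconnected P) (hPB : ∀ z ∈ P, ∀ T, z ∈ sq T → T ∉ B) {x y : ℂ} (hx : x ∈ P)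
    (hy : y ∈ P) {S T : ℤ × ℤ} (h : Free B Q S) (hxS : x ∈ sq S) (hyT : y ∈ sq T) :
    Free B Q T := by
  by_contra hT
  have := isPreconnected_closed_iff.mp hP (⋃ S ∈ {S | Free B Q S}, sq S)
    (⋃ S ∈ {S | ¬ Free B Q S}, sq S) (isClosed_biUnion_sq _) (isClosed_biUnion_sq _) ?_
    ⟨x, hx, mem_biUnion (x := S) h hxS⟩ ⟨y, hy, mem_biUnion (x := T) hT hyT⟩
  · obtain ⟨w, hwP, hw1, hw2⟩ := this
    obtain ⟨S₁, hS₁, hwS₁⟩ := mem_iUnion₂.mp hw1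
    obtain ⟨S₂, hS₂, hwS₂⟩ := mem_iUnion₂.mp hw2
    exact hS₂ (Free.of_mem_sq hS₁ hwS₁ hwS₂ (hPB w hwP))
  · intro w _
    by_cases hw : Free B Q (⌊w.re⌋, ⌊w.im⌋)
    · exact Or.inl (mem_biUnion hw (mem_sq_floor w))
    · exact Or.inr (mem_biUnion hw (mem_sq_floor w))

/-- If `K` is Runge in `Ω`, the points of a compact set off `K` can be joined to points off `C`,
staying at a uniform distance from `K`. -/
theorem exists_uniform_escape {K Ω C Z : Set ℂ} (hK : IsCompact K) (hKΩ : RungeIn K Ω)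
    (hC : IsCompact C) (hCΩ : C ⊆ Ω) (hZ : IsCompact Z) (hZK : Disjoint Z K) :
    ∃ d > 0, ∀ z ∈ Z, ∃ P : Set ℂ, IsPreconnected P ∧ z ∈ P ∧ (∃ p ∈ P, p ∉ C) ∧
      ∀ x ∈ P, ∀ y ∈ K, d < dist x y := by
  refine hZ.induction_on (p := fun Z => ∃ d > 0, ∀ z ∈ Z, ∃ P : Set ℂ, IsPreconnected P ∧ z ∈ P ∧
    (∃ p ∈ P, p ∉ C) ∧ ∀ x ∈ P, ∀ y ∈ K, d < dist x y) ⟨1, one_pos, by simp⟩ ?_ ?_ ?_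
  · rintro s t hst ⟨d, hd, h⟩
    exact ⟨d, hd, fun z hz => h z (hst hz)⟩
  · rintro s t ⟨d, hd, h⟩ ⟨d', hd', h'⟩
    refine ⟨min d d', lt_min hd hd', ?_⟩
    rintro z (hz | hz)
    · obtain ⟨P, h1, h2, h3, h4⟩ := h z hz
      exact ⟨P, h1, h2, h3, fun x hx y hy => (min_le_left _ _).trans_lt (h4 x hx y hy)⟩
    · obtain ⟨P, h1, h2, h3, h4⟩ := h' z hz
      exact ⟨P, h1, h2, h3, fun x hx y hy => (min_le_right _ _).trans_lt (h4 x hx y hy)⟩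
  · intro z hz
    have hzK : z ∉ K := fun h => hZK.le_bot ⟨hz, h⟩
    obtain ⟨S, hS, hzS, hSK, hS'⟩ := hKΩ z hzK
    obtain ⟨p, hpS, hpC⟩ : ∃ p ∈ S, p ∉ C := by
      rcases hS' with ⟨p, hpS, hp⟩ | hub
      · exact ⟨p, hpS, fun h => hp (hCΩ h)⟩
      · by_contra! h
        exact hub (hC.isBounded.subset h)
    have hKo : IsOpen Kᶜ := hK.isClosed.isOpen_compl
    have hV : IsConnected (connectedComponentIn Kᶜ z) :=
      isConnected_connectedComponentIn_iff.mpr hzK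
    have hVo : IsOpen (connectedComponentIn Kᶜ z) := hKo.connectedComponentIn
    have hSV : S ⊆ connectedComponentIn Kᶜ z := hS.subset_connectedComponentIn hzS hSK
    -- Replacing the connected set by a path makes it compact, hence at positive distance from `K`.
    have hpath := (hVo.isConnected_iff_isPathConnected.mp hV).joinedIn z (hSV hzS) p (hSV hpS)
    obtain ⟨γ, hγ⟩ := hpath
    have hPc : IsCompact (range γ) := isCompact_range γ.continuous
    have hPK : range γ ⊆ Kᶜ := by
      rintro _ ⟨t, rfl⟩
      exact connectedComponentIn_subset _ _ (hγ t)
    obtain ⟨δ, hδ, hδK⟩ := hPc.exists_cthickening_subset_open hKo hPK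
    have hdist : ∀ x ∈ range γ, ∀ y ∈ K, δ < dist x y := by
      intro x hx y hy
      by_contra hle
      refine hδK (Metric.mem_cthickening_of_dist_le y x δ _ hx ?_) hy
      rw [dist_comm]; exact not_lt.mp hle
    have hzγ : z ∈ range γ := ⟨0, γ.source⟩
    refine ⟨Metric.ball z (δ / 2),
      mem_nhdsWithin_of_mem_nhds (Metric.ball_mem_nhds z (half_pos hδ)), δ / 2, half_pos hδ, fun w hw => ?_⟩
    refine ⟨Metric.ball z (δ / 2) ∪ range γ, ?_, Or.inl hw, ⟨p, Or.inr ⟨1, γ.target⟩, hpC⟩, ?_⟩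
    · exact (convex_ball z (δ / 2)).isPreconnected.union z (Metric.mem_ball_self (half_pos hδ)) hzγ
        (isPreconnected_range γ.continuous)
    · rintro x (hx | hx) y hy
      · have h1 := hdist z hzγ y hy
        have h2 := dist_triangle_left z y x
        rw [Metric.mem_ball] at hx
        linarith
      · have := hdist x hx y hy
        linarith

open Classical in
/-- Approximation of solutions near a compact set `K`, Runge in `Ω`, by solutions near a larger
compact subset of `Ω`. -/
theorem exists_solNear_compact {Ω K C : Set ℂ} (hΩ : IsOpen Ω) {a r q : ℂ → ℂ}
    (ha : DifferentiableOn ℂ a Ω) (hr : DifferentiableOn ℂ r Ω) (hq : DifferentiableOn ℂ q Ω)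
    (hr0 : ∀ z ∈ Ω, r z ≠ 0) (hq0 : ∀ z ∈ Ω, q z = 0 → z ∈ K) (hK : IsCompact K)
    (hKΩ : RungeIn K Ω) (hC : IsCompact C) (hKC : K ⊆ C) (hCΩ : C ⊆ Ω) {s f : ℂ → ℂ}
    (h : SolNear a r q K s f) {ε : ℝ} (hε : 0 < ε) :
    ∃ s' f' : ℂ → ℂ, SolNear a r q C s' f' ∧ ∀ z ∈ K, ‖s' z - s z‖ < ε ∧ ‖f' z - f z‖ < ε := by
  obtain ⟨U, hU, hKU, hUs⟩ := eventually_nhdsSet_iff_exists.mp h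
  obtain ⟨ρ, hρ, hρΩ⟩ := hC.exists_cthickening_subset_open hΩ hCΩ
  set C' := Metric.cthickening ρ C with hC'
  have hC'c : IsCompact C' := hC.cthickening
  have hZ : IsCompact (C' \ U) := hC'c.diff hU
  obtain ⟨d, hd, hesc⟩ := exists_uniform_escape hK hKΩ hC'c hρΩ hZ
    (disjoint_left.mpr fun z hz hzK => hz.2 (hKU hzK))
  -- The mesh: `2δ ≤ ρ` keeps the discs around squares meeting `C` inside `C'`, and `2δ ≤ d`
  -- prevents a square met by an escape set from touching `K`. The grid stays the unit one, and the
  -- variable is scaled by `δ`.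
  obtain ⟨δ, hδ, hδρ, hδd⟩ : ∃ δ : ℝ, 0 < δ ∧ 2 * δ ≤ ρ ∧ 2 * δ ≤ d :=
    ⟨min ρ d / 2, by positivity, by linarith [min_le_left ρ d], by linarith [min_le_right ρ d]⟩
  have hδ0 : (δ : ℂ) ≠ 0 := by exact_mod_cast hδ.ne'
  have hdist : ∀ x y : ℂ, dist ((δ : ℂ) * x) (δ * y) = δ * ‖x - y‖ := fun x y => by
    rw [dist_eq_norm, ← mul_sub, norm_mul, norm_real, Real.norm_of_nonneg hδ.le]
  have hC₁ : Bornology.IsBounded {z : ℂ | (δ : ℂ) * z ∈ C} := by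
    obtain ⟨R, hR⟩ := hC.isBounded.subset_closedBall (0 : ℂ)
    refine (Metric.isBounded_closedBall (x := (0 : ℂ)) (r := R / δ)).subset fun z hz => ?_
    have := hR hz
    rw [mem_closedBall_zero_iff, norm_mul, norm_real, Real.norm_of_nonneg hδ.le] at this
    rw [mem_closedBall_zero_iff, le_div_iff₀ hδ]
    linarith
  set Q : Finset (ℤ × ℤ) := (finite_sq_inter hC₁).toFinset with hQ
  have hmQ : ∀ T, T ∈ Q ↔ ∃ z ∈ sq T, (δ : ℂ) * z ∈ C := fun T => by
    simp only [hQ, Set.Finite.mem_toFinset, mem_ofPred_eq]; rfl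
  set B : Set (ℤ × ℤ) := {T | ∃ z ∈ sq T, (δ : ℂ) * z ∈ K} with hB
  have hBQ : ∀ T ∈ B, T ∈ Q := by
    rintro T ⟨z, hz, hzK⟩
    exact (hmQ T).mpr ⟨z, hz, hKC hzK⟩
  have hnear : ∀ T ∈ Q, ∀ z ∈ Metric.ball (ctr T) (3 / 4), (δ : ℂ) * z ∈ C' := by
    intro T hT z hz
    obtain ⟨y, hy, hyC⟩ := (hmQ T).mp hT
    refine Metric.mem_cthickening_of_dist_le _ ((δ : ℂ) * y) _ _ hyC ?_
    rw [hdist]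
    have h1 := sq_subset_ball T hy
    rw [Metric.mem_ball] at h1 hz
    have h2 := dist_triangle_right z y (ctr T)
    rw [dist_eq_norm] at h2
    nlinarith
  -- `P` consists of the squares meeting `K` and those enclosed by them. The latter still lie where
  -- `s` and `f` are defined: a point outside `U` could escape without coming near `K`.
  set P : Finset (ℤ × ℤ) := Q.filter fun T => ¬ Free B Q T with hP
  have hBP : ∀ T ∈ B, T ∈ P := by
    intro T hT
    refine Finset.mem_filter.mpr ⟨hBQ T hT, fun hf => ?_⟩
    cases hf with
    | out h => exact h (hBQ T hT)
    | step h _ => exact h hT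
  have hPU : ∀ z ∈ region P, (δ : ℂ) * z ∈ U := by
    intro z hz
    obtain ⟨T, hT, hzT⟩ := mem_region.mp hz
    obtain ⟨hTQ, hTf⟩ := Finset.mem_filter.mp hT
    by_contra hzU
    obtain ⟨X, hX, hzX, ⟨p, hpX, hpC⟩, hXK⟩ :=
      hesc _ ⟨hnear T hTQ z (sq_subset_ball T hzT), hzU⟩
    refine hTf (Free.of_isPreconnected (P := (fun x => (δ : ℂ)⁻¹ * x) '' X)
      (hX.image _ (by fun_prop)) ?_ (x := (δ : ℂ)⁻¹ * p) (y := z) ⟨p, hpX, rfl⟩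
      ⟨_, hzX, by field_simp⟩ (.out (S := (⌊((δ : ℂ)⁻¹ * p).re⌋, ⌊((δ : ℂ)⁻¹ * p).im⌋)) ?_)
      (mem_sq_floor _) hzT)
    · rintro _ ⟨x, hx, rfl⟩ T' hxT' ⟨y, hy, hyK⟩
      have h1 := hXK x hx _ hyK
      have h2 := dist_le_two_of_mem_sq hxT' hy
      rw [show x = (δ : ℂ) * ((δ : ℂ)⁻¹ * x) by field_simp, hdist] at h1
      nlinarith
    · intro hmem
      refine hpC ?_
      have := hnear _ hmem _ (sq_subset_ball _ (mem_sq_floor ((δ : ℂ)⁻¹ * p)))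
      rwa [mul_inv_cancel_left₀ hδ0] at this
  -- rescaling
  have hθ : ∀ z x, theta (fun z => δ * a (δ * z)) (fun z => δ * r (δ * z)) (fun z => q (δ * z)) z x
      = δ * theta a r q (δ * z) x := fun z x => by simp only [theta]; ring
  have hlin : ∀ z : ℂ, HasDerivAt (fun z : ℂ => (δ : ℂ) * z) δ z := fun z => by
    simpa using (hasDerivAt_id' z).const_mul (δ : ℂ)
  have hlin' : ∀ z : ℂ, HasDerivAt (fun z : ℂ => (δ : ℂ)⁻¹ * z) (δ : ℂ)⁻¹ z := fun z => by
    simpa using (hasDerivAt_id' z).const_mul (δ : ℂ)⁻¹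
  set O : Set ℂ := {z | (δ : ℂ) * z ∈ Ω} with hO
  have hmaps : MapsTo (fun z : ℂ => (δ : ℂ) * z) O Ω := fun z hz => hz
  have hld : DifferentiableOn ℂ (fun z : ℂ => (δ : ℂ) * z) O := by fun_prop
  have hsol : SolNear (fun z => δ * a (δ * z)) (fun z => δ * r (δ * z)) (fun z => q (δ * z))
      (region P) (fun z => s (δ * z)) (fun z => f (δ * z)) := by
    have hopen : IsOpen {z : ℂ | (δ : ℂ) * z ∈ U} := hU.preimage (by fun_prop)
    filter_upwards [hopen.mem_nhdsSet.mpr hPU] with z hz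
    refine ⟨(hUs _ hz).1.comp z (hlin z).differentiableAt, ?_⟩
    rw [hθ, mul_comm]
    exact (hUs _ hz).2.comp z (hlin z)
  obtain ⟨s₁, f₁, h₁, hc₁⟩ := exists_solNear_region (O := O)
    ((ha.comp hld hmaps).const_mul (δ : ℂ)) ((hr.comp hld hmaps).const_mul (δ : ℂ))
    (hq.comp hld hmaps) (fun z hz => mul_ne_zero hδ0 (hr0 _ hz)) hsol _ Q rfl
    (Finset.filter_subset _ _)
    (fun S hS hSP => by
      have hf : Free B Q S := by
        by_contra hf
        exact hSP (Finset.mem_filter.mpr ⟨hS, hf⟩)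
      exact hf.of_blocked fun T hT => (Finset.mem_filter.mp hT).2)
    (fun T hT z hz => hρΩ (hnear T hT z hz))
    (fun S hS hSP z hz h0 => hSP (hBP S
      ⟨z, hz, hq0 _ (hρΩ (hnear S hS z (sq_subset_ball S hz))) h0⟩)) ε hε
  replace h₁ : SolNear (fun z => δ * a (δ * z)) (fun z => δ * r (δ * z)) (fun z => q (δ * z))
    (region Q) s₁ f₁ := h₁
  refine ⟨fun z => s₁ ((δ : ℂ)⁻¹ * z), fun z => f₁ ((δ : ℂ)⁻¹ * z), ?_, fun z hz => ?_⟩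
  · obtain ⟨V, hV, hQV, hVs⟩ := eventually_nhdsSet_iff_exists.mp h₁
    have hopen : IsOpen {z : ℂ | (δ : ℂ)⁻¹ * z ∈ V} := hV.preimage (by fun_prop)
    have hCV : C ⊆ {z : ℂ | (δ : ℂ)⁻¹ * z ∈ V} := fun z hz =>
      hQV (mem_region.mpr ⟨_, (hmQ _).mpr ⟨_, mem_sq_floor ((δ : ℂ)⁻¹ * z), by
        rwa [mul_inv_cancel_left₀ hδ0]⟩, mem_sq_floor _⟩)
    filter_upwards [hopen.mem_nhdsSet.mpr hCV] with z hz
    refine ⟨(hVs _ hz).1.comp z (hlin' z).differentiableAt, ?_⟩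
    have := (hVs _ hz).2.comp z (hlin' z)
    rw [hθ, mul_inv_cancel_left₀ hδ0, mul_comm, inv_mul_cancel_left₀ hδ0] at this
    exact this
  · have hzP : (δ : ℂ)⁻¹ * z ∈ region P := mem_region.mpr ⟨_, hBP _
      ⟨_, mem_sq_floor ((δ : ℂ)⁻¹ * z), by rwa [mul_inv_cancel_left₀ hδ0]⟩, mem_sq_floor _⟩
    have := hc₁ _ hzP
    simp only [mul_inv_cancel_left₀ hδ0] at this
    exact this

end LocUniv

end

/-! ### Exhaustion and passage to the limit. -/

noncomputable section

namespace LocUniv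

open Complex

/-- The compact exhaustion of a plane open set by distance to the boundary and to infinity. -/
def exhaustion (Ω : Set ℂ) (t : ℝ) : Set ℂ :=
  {z | ‖z‖ ≤ t ∧ ∀ p ∉ Ω, t⁻¹ ≤ dist z p}

theorem isCompact_exhaustion (Ω : Set ℂ) (t : ℝ) : IsCompact (exhaustion Ω t) := by
  refine (isCompact_closedBall (0 : ℂ) t).of_isClosed_subset ?_ fun z hz =>
    mem_closedBall_zero_iff.mpr hz.1
  have : exhaustion Ω t = {z | ‖z‖ ≤ t} ∩ ⋂ p ∈ Ωᶜ, {z | t⁻¹ ≤ dist z p} := by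
    ext z; simp [exhaustion]
  rw [this]
  exact (isClosed_le continuous_norm continuous_const).inter
    (isClosed_biInter fun p _ => isClosed_le continuous_const (by fun_prop))

theorem exhaustion_subset {Ω : Set ℂ} {t : ℝ} (ht : 0 < t) : exhaustion Ω t ⊆ Ω := by
  intro z hz
  by_contra h
  have := hz.2 z h
  rw [dist_self] at this
  exact absurd this (not_le.mpr (inv_pos.mpr ht))

theorem exhaustion_mono {Ω : Set ℂ} {t t' : ℝ} (ht : 0 < t) (h : t ≤ t') :
    exhaustion Ω t ⊆ exhaustion Ω t' := fun _ hz =>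
  ⟨hz.1.trans h, fun p hp => (inv_anti₀ ht h).trans (hz.2 p hp)⟩

theorem exists_subset_exhaustion {Ω K : Set ℂ} (hΩ : IsOpen Ω) (hK : IsCompact K)
    (hKΩ : K ⊆ Ω) : ∃ t > 0, K ⊆ exhaustion Ω t := by
  obtain ⟨δ, hδ, hδΩ⟩ := hK.exists_thickening_subset_open hΩ hKΩ
  obtain ⟨R, hR⟩ := hK.isBounded.subset_closedBall (0 : ℂ)
  have hpos : 0 < max R δ⁻¹ := lt_max_of_lt_right (inv_pos.mpr hδ)
  refine ⟨max R δ⁻¹, hpos, fun z hz =>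
    ⟨(mem_closedBall_zero_iff.mp (hR hz)).trans (le_max_left _ _), fun p hp => ?_⟩⟩
  by_contra! h
  refine hp (hδΩ (Metric.mem_thickening_iff.mpr ⟨z, hz, ?_⟩))
  rw [dist_comm]
  exact h.trans_le (inv_le_of_inv_le₀ hδ (le_max_right _ _))

/-- A point violating the distance condition lies in a disc about some `p ∉ Ω` that misses the set;
a point violating the norm bound escapes radially to infinity. -/
theorem rungeIn_exhaustion {Ω : Set ℂ} {t : ℝ} (ht : 0 < t) : RungeIn (exhaustion Ω t) Ω := by
  intro b hb
  by_cases hbt : ‖b‖ ≤ t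
  · have : ∃ p ∉ Ω, dist b p < t⁻¹ := by
      by_contra! h
      exact hb ⟨hbt, h⟩
    obtain ⟨p, hp, hbp⟩ := this
    refine ⟨Metric.ball p t⁻¹, (convex_ball p _).isPreconnected, hbp, fun z hz hzC => ?_,
      Or.inl ⟨p, Metric.mem_ball_self (inv_pos.mpr ht), hp⟩⟩
    exact absurd (hzC.2 p hp) (not_le.mpr hz)
  · rw [not_le] at hbt
    have hb0 : 0 < ‖b‖ := ht.trans hbt
    refine ⟨(fun x : ℝ => (x : ℂ) * b) '' Ici 1, isPreconnected_Ici.image _ (by fun_prop),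
      ⟨1, self_mem_Ici, by simp⟩, ?_, Or.inr fun hbd => ?_⟩
    · rintro _ ⟨x, hx, rfl⟩ hxC
      have h1 := hxC.1
      simp only [norm_mul, norm_real, Real.norm_eq_abs] at h1
      have hx1 : (1 : ℝ) ≤ |x| := (mem_Ici.mp hx).trans (le_abs_self x)
      nlinarith
    · obtain ⟨R, hR⟩ := hbd.subset_closedBall (0 : ℂ)
      have hx1 : (1 : ℝ) ≤ 1 + |R| / ‖b‖ := le_add_of_nonneg_right (by positivity)
      have := hR ⟨1 + |R| / ‖b‖, hx1, rfl⟩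
      rw [mem_closedBall_zero_iff, norm_mul, norm_real, Real.norm_of_nonneg (by positivity),
        add_mul, one_mul, div_mul_cancel₀ _ hb0.ne'] at this
      linarith [le_abs_self R]

theorem exists_limit_of_geometric {C : ℕ → Set ℂ} (hC : Monotone C) {F : ℕ → ℂ → ℂ} {D : ℝ}
    (h : ∀ n, ∀ z ∈ C n, ‖F (n + 1) z - F n z‖ < D / 2 / 2 ^ n) :
    ∃ g : ℂ → ℂ, ∀ n, ∀ z ∈ C n, ‖F n z - g z‖ ≤ D / 2 ^ n := by
  refine ⟨fun z => limUnder atTop fun n => F n z, fun n z hz => ?_⟩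
  have hstep : ∀ k, dist (F (n + k) z) (F (n + k + 1) z) ≤ D / 2 ^ n / 2 / 2 ^ k := fun k => by
    rw [dist_comm, dist_eq_norm]
    refine (h (n + k) z (hC (Nat.le_add_right n k) hz)).le.trans (le_of_eq ?_)
    rw [pow_add]
    field_simp
  have hcau : CauchySeq fun k => F (n + k) z := cauchySeq_of_le_geometric_two hstep
  obtain ⟨y, hy⟩ := cauchySeq_tendsto_of_complete hcau
  have hy' : Tendsto (fun k => F k z) atTop (𝓝 y) := by
    refine (tendsto_add_atTop_iff_nat n).mp (hy.congr fun k => ?_)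
    rw [add_comm]
  have := dist_le_of_le_geometric_two_of_tendsto₀ hstep hy
  change ‖F n z - limUnder atTop fun n => F n z‖ ≤ _
  rw [hy'.limUnder_eq, ← dist_eq_norm]
  exact this

theorem hasDerivAt_of_geometric_limit {C : ℕ → Set ℂ} (hC : Monotone C) {F : ℕ → ℂ → ℂ} {D : ℝ}
    (hF : ∀ n, ∀ z ∈ C n, DifferentiableAt ℂ (F n) z) {g : ℂ → ℂ}
    (hg : ∀ n, ∀ z ∈ C n, ‖F n z - g z‖ ≤ D / 2 ^ n) {z : ℂ} {N : ℕ} (hz : C N ∈ 𝓝 z) :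
    DifferentiableAt ℂ g z ∧ Tendsto (fun n => deriv (F n) z) atTop (𝓝 (deriv g z)) := by
  obtain ⟨ρ, hρ, hρC⟩ := Metric.mem_nhds_iff.mp hz
  have hunif : TendstoUniformlyOn F g atTop (Metric.ball z ρ) := by
    have hlim : Tendsto (fun n : ℕ => D / 2 ^ n) atTop (𝓝 0) := by
      have := (tendsto_pow_atTop_nhds_zero_of_lt_one (r := (2 : ℝ)⁻¹) (by norm_num)
        (by norm_num)).const_mul D
      simpa [div_eq_mul_inv] using this
    rw [Metric.tendstoUniformlyOn_iff]
    intro ε hε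
    filter_upwards [hlim.eventually_lt_const hε, eventually_ge_atTop N] with n hn hNn w hw
    rw [dist_comm, dist_eq_norm]
    exact (hg n w (hC hNn (hρC hw))).trans_lt hn
  have hdiff : ∀ᶠ n in atTop, DifferentiableOn ℂ (F n) (Metric.ball z ρ) := by
    filter_upwards [eventually_ge_atTop N] with n hNn w hw
    exact (hF n w (hC hNn (hρC hw))).differentiableWithinAt
  have hloc := hunif.tendstoLocallyUniformlyOn
  have hmem : z ∈ Metric.ball z ρ := Metric.mem_ball_self hρ
  exact ⟨(hloc.differentiableOn hdiff Metric.isOpen_ball).differentiableAt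
    (Metric.isOpen_ball.mem_nhds hmem),
    (hloc.deriv hdiff Metric.isOpen_ball).tendsto_at hmem⟩

/-- Global Runge-type approximation for the equation `f' = theta a r q z (s z)`. -/
theorem exists_sol_approx {Ω K : Set ℂ} {a r q s f : ℂ → ℂ} {ε : ℝ} (hΩ : IsOpen Ω)
    (ha : DifferentiableOn ℂ a Ω) (hr : DifferentiableOn ℂ r Ω) (hq : DifferentiableOn ℂ q Ω)
    (hr0 : ∀ z ∈ Ω, r z ≠ 0) (hq0 : ∀ z ∈ Ω, q z = 0 → z ∈ K) (hK : IsCompact K)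
    (hKsub : K ⊆ Ω) (hKΩ : RungeIn K Ω) (h : SolNear a r q K s f) (hε : 0 < ε) :
    ∃ s' g : ℂ → ℂ, DifferentiableOn ℂ s' Ω ∧
      (∀ z ∈ Ω, HasDerivAt g (theta a r q z (s' z)) z) ∧ ∀ z ∈ K, ‖g z - f z‖ < ε := by
  obtain ⟨t, ht, hKt⟩ := exists_subset_exhaustion hΩ hK hKsub
  set C : ℕ → Set ℂ := fun n => exhaustion Ω (t + n) with hCdef
  have htn : ∀ n : ℕ, 0 < t + n := fun n => by positivity
  have hCm : Monotone C := fun m n hmn =>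
    exhaustion_mono (htn m) (by gcongr)
  have hKC : ∀ n, K ⊆ C n := fun n => hKt.trans (exhaustion_mono ht (by simp))
  have hCΩ : ∀ n, C n ⊆ Ω := fun n => exhaustion_subset (htn n)
  have hCn : ∀ z ∈ Ω, ∃ N, C N ∈ 𝓝 z := fun z hz => by
    obtain ⟨ρ, hρ, hρΩ⟩ := Metric.nhds_basis_closedBall.mem_iff.mp (hΩ.mem_nhds hz)
    obtain ⟨t', ht', hsub⟩ := exists_subset_exhaustion hΩ (isCompact_closedBall z ρ) hρΩ
    obtain ⟨N, hN⟩ := exists_nat_ge t'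
    exact ⟨N, mem_of_superset (Metric.closedBall_mem_nhds z hρ)
      (hsub.trans (exhaustion_mono ht' (by linarith)))⟩
  obtain ⟨s₀, f₀, h₀, hc₀⟩ := exists_solNear_compact hΩ ha hr hq hr0 hq0 hK hKΩ
    (isCompact_exhaustion Ω _) (hKC 0) (hCΩ 0) h (half_pos hε)
  -- Half of `ε` was spent going from `K` to the first exhaustion set; the geometric series of later
  -- errors sums to at most the other half. The exhaustion sets are Runge themselves and contain the
  -- zeros of `q`, so the step can be repeated.
  have step : ∀ n, ∀ p : {p : (ℂ → ℂ) × (ℂ → ℂ) // SolNear a r q (C n) p.1 p.2},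
      ∃ p' : {p : (ℂ → ℂ) × (ℂ → ℂ) // SolNear a r q (C (n + 1)) p.1 p.2}, ∀ z ∈ C n,
        ‖p'.1.1 z - p.1.1 z‖ < ε / 2 / 2 / 2 ^ n ∧ ‖p'.1.2 z - p.1.2 z‖ < ε / 2 / 2 / 2 ^ n := by
    rintro n ⟨⟨s, f⟩, hp⟩
    obtain ⟨s', f', h', hc'⟩ := exists_solNear_compact hΩ ha hr hq hr0
      (fun z hz h0 => hKC n (hq0 z hz h0)) (isCompact_exhaustion Ω _)
      (rungeIn_exhaustion (htn n)) (isCompact_exhaustion Ω _) (hCm n.le_succ) (hCΩ (n + 1)) hp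
      (ε := ε / 2 / 2 / 2 ^ n) (by positivity)
    exact ⟨⟨⟨s', f'⟩, h'⟩, hc'⟩
  choose next hnext using step
  let X : ∀ n, {p : (ℂ → ℂ) × (ℂ → ℂ) // SolNear a r q (C n) p.1 p.2} :=
    fun n => Nat.rec ⟨⟨s₀, f₀⟩, h₀⟩ next n
  have hX : ∀ n, ∀ z ∈ C n, ‖(X (n + 1)).1.1 z - (X n).1.1 z‖ < ε / 2 / 2 / 2 ^ n ∧
      ‖(X (n + 1)).1.2 z - (X n).1.2 z‖ < ε / 2 / 2 / 2 ^ n := fun n => hnext n (X n)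
  obtain ⟨s', hs'⟩ := exists_limit_of_geometric hCm (F := fun n => (X n).1.1)
    fun n z hz => (hX n z hz).1
  obtain ⟨g, hg⟩ := exists_limit_of_geometric hCm (F := fun n => (X n).1.2)
    fun n z hz => (hX n z hz).2
  have hsol : ∀ n, ∀ z ∈ C n, DifferentiableAt ℂ (X n).1.1 z ∧
      HasDerivAt (X n).1.2 (theta a r q z ((X n).1.1 z)) z := fun n z hz =>
    (X n).2.self_of_nhdsSet z hz
  have hsd : ∀ z ∈ Ω, DifferentiableAt ℂ s' z := fun z hz => by
    obtain ⟨N, hN⟩ := hCn z hz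
    exact (hasDerivAt_of_geometric_limit hCm (fun n z hz => (hsol n z hz).1) hs' hN).1
  refine ⟨s', g, fun z hz => (hsd z hz).differentiableWithinAt, fun z hz => ?_, fun z hz => ?_⟩
  · obtain ⟨N, hN⟩ := hCn z hz
    obtain ⟨hgd, hgt⟩ :=
      hasDerivAt_of_geometric_limit hCm (fun n z hz => (hsol n z hz).2.differentiableAt) hg hN
    have hst : Tendsto (fun n => (X n).1.1 z) atTop (𝓝 (s' z)) := by
      have hlim : Tendsto (fun n : ℕ => ε / 2 / 2 ^ n) atTop (𝓝 0) := by
        have := (tendsto_pow_atTop_nhds_zero_of_lt_one (r := (2 : ℝ)⁻¹) (by norm_num)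
          (by norm_num)).const_mul (ε / 2)
        simpa [div_eq_mul_inv] using this
      rw [tendsto_iff_norm_sub_tendsto_zero]
      refine squeeze_zero' (Eventually.of_forall fun n => norm_nonneg _) ?_ hlim
      filter_upwards [eventually_ge_atTop N] with n hn
      exact hs' n z (hCm hn (mem_of_mem_nhds hN))
    have hcont : Continuous fun x => theta a r q z x := by
      have := differentiable_expSlope.continuous
      unfold theta
      fun_prop
    have hlim := (hcont.tendsto (s' z)).comp hst
    have heq : deriv g z = theta a r q z (s' z) := by
      refine tendsto_nhds_unique (hgt.congr' ?_) hlim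
      filter_upwards [eventually_ge_atTop N] with n hn
      exact (hsol n z (hCm hn (mem_of_mem_nhds hN))).2.deriv
    rw [← heq]
    exact hgd.hasDerivAt
  · have c1 := (hc₀ z hz).2
    have c2 := hg 0 z (hKC 0 hz)
    rw [pow_zero, div_one, norm_sub_rev] at c2
    have t1 := norm_add_le (g z - f₀ z) (f₀ z - f z)
    rw [sub_add_sub_cancel] at t1
    have c3 : ‖g z - f₀ z‖ ≤ ε / 2 := c2
    linarith

end LocUniv

end

/-! ### Part (a): holomorphic approximation. -/

noncomputable section

namespace LocUniv

open Complex

/-- A bounded component of the complement of `K` lying inside `Ω` would be a component of `Ω \ K`.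
Being relatively closed off `K`, its closure adds only points of `K`, so it would be relatively
compact in `Ω`. -/
theorem rungeIn_of_not_relCompactIn {Ω K : Set ℂ}
    (hKΩ : K ⊆ Ω) (hcomp : ∀ z ∈ Ω \ K, ¬ RelCompactIn (connectedComponentIn (Ω \ K) z) Ω) :
    RungeIn K Ω := by
  intro b hb
  by_cases hbΩ : b ∈ Ω
  · have hbS : b ∈ connectedComponentIn Kᶜ b := mem_connectedComponentIn hb
    refine ⟨connectedComponentIn Kᶜ b, isPreconnected_connectedComponentIn, hbS,
      connectedComponentIn_subset _ _, ?_⟩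
    by_contra! h
    obtain ⟨hΩ', hbd⟩ := h
    have hsub : connectedComponentIn Kᶜ b ⊆ Ω := fun z hz => by
      by_contra hzΩ
      exact eq_empty_iff_forall_notMem.mp hΩ' z ⟨hz, hzΩ⟩
    have heq : connectedComponentIn (Ω \ K) b = connectedComponentIn Kᶜ b := by
      refine (connectedComponentIn_mono b (sdiff_subset_compl _ _)).antisymm ?_
      exact isPreconnected_connectedComponentIn.subset_connectedComponentIn hbS
        fun z hz => ⟨hsub hz, connectedComponentIn_subset _ _ hz⟩
    refine hcomp b ⟨hbΩ, hb⟩ ?_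
    rw [heq]
    refine ⟨hbd.isCompact_closure, fun z hz => ?_⟩
    by_cases hzK : z ∈ K
    · exact hKΩ hzK
    · refine hsub (IsPreconnected.subset_connectedComponentIn
        (s := insert z (connectedComponentIn Kᶜ b)) ?_ (mem_insert_of_mem _ hbS) ?_
        (mem_insert _ _))
      · exact isPreconnected_connectedComponentIn.subset_closure (subset_insert _ _)
          (insert_subset hz subset_closure)
      · exact insert_subset hzK (connectedComponentIn_subset _ _)
  · exact ⟨{b}, isPreconnected_singleton, rfl, by simpa using hb, Or.inl ⟨b, rfl, hbΩ⟩⟩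

theorem rungeIn_univ_of_isConnected_compl {K : Set ℂ} (hK : IsCompact K) (h : IsConnected Kᶜ) :
    RungeIn K univ := by
  refine fun b hb => ⟨Kᶜ, h.isPreconnected, hb, subset_rfl, Or.inr fun hbd => ?_⟩
  have := hK.isBounded.union hbd
  rw [union_compl_self] at this
  exact NormedSpace.unbounded_univ ℂ ℂ this

/-- For this choice of coefficients the equation says that the derivative is `R exp s`, which is the
equation behind part (a). -/
theorem theta_self_one (R : ℂ → ℂ) (z s : ℂ) : theta R R (fun _ => 1) z s = R z * exp s := by
  have := mul_expSlope s
  simp only [theta, one_pow, one_mul, this]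
  ring

/-- Runge approximation by locally univalent holomorphic functions. -/
theorem exists_hlu_approx {Ω K : Set ℂ} (hΩ : IsOpen Ω) (hK : IsCompact K) (hKsub : K ⊆ Ω)
    (hKΩ : RungeIn K Ω) {f : ℂ → ℂ} (hf : f ∈ HLU K) {ε : ℝ} (hε : 0 < ε) :
    ∃ g ∈ HLU Ω, ∀ z ∈ K, ‖g z - f z‖ < ε := by
  obtain ⟨U, hU, hKU, hfU, hf0⟩ := hf
  have hfd : ∀ z ∈ U, DifferentiableAt ℂ f z := fun z hz => hfU.differentiableAt (hU.mem_nhds hz)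
  have hW : ∀ᶠ z in 𝓝ˢ K, DifferentiableAt ℂ (deriv f) z := by
    filter_upwards [hU.mem_nhdsSet.mpr hKU] with z hz
    exact (hfU.deriv hU).differentiableAt (hU.mem_nhds hz)
  obtain ⟨R, u, hR, hR0, hu⟩ := expFactor_of_ne_zero hK hKΩ hW fun z hz => hf0 z (hKU hz)
  have hsol : SolNear R R (fun _ => 1) K u f := by
    filter_upwards [hU.mem_nhdsSet.mpr hKU, hu] with z hz hzu
    rw [theta_self_one, ← hzu.2]
    exact ⟨hzu.1, (hfd z hz).hasDerivAt⟩
  obtain ⟨s, g, -, hg, hgK⟩ := exists_sol_approx hΩ hR hR (differentiableOn_const _) hR0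
    (fun z _ h => absurd h one_ne_zero) hK hKsub hKΩ hsol hε
  refine ⟨g, ⟨Ω, hΩ, subset_rfl, fun z hz => (hg z hz).differentiableAt.differentiableWithinAt,
    fun z hz => ?_⟩, hgK⟩
  rw [(hg z hz).deriv, theta_self_one]
  exact mul_ne_zero (hR0 z hz) (exp_ne_zero _)

end LocUniv

end

/-! ### Numerators of meromorphic functions with prescribed denominator. -/

noncomputable section

namespace LocUniv

open Complex

/-- Newton interpolation: each difference quotient `dslope` splits off one factor `z - p`, and
repetitions in the multiset are harmless. -/
theorem exists_eq_add_multiset_prod_mul {U : Set ℂ} (hU : IsOpen U) (m : Multiset ℂ)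
    (hm : ∀ p ∈ m, p ∈ U) {u : ℂ → ℂ} (hu : DifferentiableOn ℂ u U) :
    ∃ v s : ℂ → ℂ, Differentiable ℂ v ∧ DifferentiableOn ℂ s U ∧
      ∀ z, u z = v z + (m.map fun p => z - p).prod * s z := by
  induction m using Multiset.induction generalizing u with
  | empty => exact ⟨0, u, differentiable_const _, hu, fun z => by simp⟩
  | cons p m ih =>
    obtain ⟨v, s, hv, hs, h⟩ := ih (fun p hp => hm p (Multiset.mem_cons_of_mem hp))
      ((differentiableOn_dslope (hU.mem_nhds (hm p (Multiset.mem_cons_self p m)))).mpr hu)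
    refine ⟨fun z => u p + (z - p) * v z, s, by fun_prop, hs, fun z => ?_⟩
    have h1 := sub_smul_dslope u p z
    rw [smul_eq_mul, h z] at h1
    rw [Multiset.map_cons, Multiset.prod_cons]
    linear_combination -h1

/-- Division of a holomorphic function by `∏ (z - p) ^ 2` with an entire remainder. -/
theorem exists_eq_add_sq_mul {U : Set ℂ} (hU : IsOpen U) {P : Finset ℂ} (hP : ∀ p ∈ P, p ∈ U)
    {u : ℂ → ℂ} (hu : DifferentiableOn ℂ u U) :
    ∃ v s : ℂ → ℂ, Differentiable ℂ v ∧ DifferentiableOn ℂ s U ∧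
      ∀ z, u z = v z + (∏ p ∈ P, (z - p)) ^ 2 * s z := by
  obtain ⟨v, s, hv, hs, h⟩ := exists_eq_add_multiset_prod_mul hU (P.val + P.val)
    (fun p hp => hP p (by simpa using hp)) hu
  refine ⟨v, s, hv, hs, fun z => ?_⟩
  rw [h z, Multiset.map_add, Multiset.prod_add, pow_two]
  rfl

/-- The quotient `F / Q` is holomorphic off the zeros of `Q`, and `τ` continues it across them. -/
theorem differentiable_of_eqOn_div {V : Set ℂ} (hV : IsOpen V) {F Q τ : ℂ → ℂ}
    (hF : Differentiable ℂ F) (hQ : Differentiable ℂ Q) (hQV : ∀ z, Q z = 0 → z ∈ V)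
    (hτ : DifferentiableOn ℂ τ V) (h : ∀ z ∈ V, F z = Q z * τ z) :
    ∃ t : ℂ → ℂ, Differentiable ℂ t ∧ (∀ z, F z = Q z * t z) ∧ ∀ z ∈ V, t z = τ z := by
  classical
  set t : ℂ → ℂ := fun z => if Q z = 0 then τ z else F z / Q z with ht
  have htV : ∀ z ∈ V, t z = τ z := fun z hz => by
    simp only [ht]
    split_ifs with h0
    · rfl
    · rw [h z hz, mul_div_cancel_left₀ _ h0]
  refine ⟨t, fun z => ?_, fun z => ?_, htV⟩
  · by_cases hz : z ∈ V
    · refine (hτ.differentiableAt (hV.mem_nhds hz)).congr_of_eventuallyEq ?_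
      filter_upwards [hV.mem_nhds hz] with w hw using htV w hw
    · have h0 : Q z ≠ 0 := fun h0 => hz (hQV z h0)
      refine ((hF z).fun_div (hQ z) h0).congr_of_eventuallyEq ?_
      filter_upwards [(hQ z).continuousAt.eventually_ne h0] with w hw
      exact if_neg hw
  · by_cases h0 : Q z = 0
    · rw [htV z (hQV z h0), h z (hQV z h0)]
    · simp only [ht, if_neg h0, mul_div_cancel₀ _ h0]

/-- Approximation of numerators `φ` of meromorphic functions `φ / q`, where `q = ∏ (z - p)`, keeping
`φ' q - φ q'` free of zeros. -/
theorem exists_numerator_approx {K U : Set ℂ} (hK : IsCompact K) (hKΩ : RungeIn K univ)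
    (hU : IsOpen U) (hKU : K ⊆ U) {P : Finset ℂ} (hPK : ∀ p ∈ P, p ∈ K) {φ q : ℂ → ℂ}
    (hqP : ∀ z, q z = ∏ p ∈ P, (z - p)) (hφ : DifferentiableOn ℂ φ U)
    (hW0 : ∀ z ∈ K, deriv φ z * q z - φ z * deriv q z ≠ 0) {ε : ℝ} (hε : 0 < ε) :
    ∃ ψ : ℂ → ℂ, Differentiable ℂ ψ ∧ (∀ z, deriv ψ z * q z - ψ z * deriv q z ≠ 0) ∧
      ∀ z ∈ K, ∃ d, ψ z - φ z = q z * d ∧ ‖d‖ < ε := by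
  have hq : Differentiable ℂ q := by
    have : q = fun z => ∏ p ∈ P, (z - p) := funext hqP
    rw [this]
    fun_prop
  have hq' : Differentiable ℂ (deriv q) := fun z =>
    (hq.differentiableOn.deriv isOpen_univ).differentiableAt univ_mem
  have hqK : ∀ z, q z = 0 → z ∈ K := fun z h0 => by
    rw [hqP, Finset.prod_eq_zero_iff] at h0
    obtain ⟨p, hp, hzp⟩ := h0
    rw [sub_eq_zero.mp hzp]
    exact hPK p hp
  have hWd : ∀ᶠ z in 𝓝ˢ K, DifferentiableAt ℂ (fun z => deriv φ z * q z - φ z * deriv q z) z := by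
    filter_upwards [hU.mem_nhdsSet.mpr hKU] with z hz
    exact (((hφ.deriv hU).differentiableAt (hU.mem_nhds hz)).fun_mul (hq z)).fun_sub
      ((hφ.differentiableAt (hU.mem_nhds hz)).fun_mul (hq' z))
  obtain ⟨R, u, hR, hR0, hu⟩ := expFactor_of_ne_zero hK hKΩ hWd hW0
  obtain ⟨V, hV, hKV, hVu⟩ := eventually_nhdsSet_iff_exists.mp
    (hu.and (hU.mem_nhdsSet.mpr hKU))
  have hPV : ∀ p ∈ P, p ∈ V := fun p hp => hKV (hPK p hp)
  have hud : DifferentiableOn ℂ u V := fun z hz => (hVu z hz).1.1.differentiableWithinAt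
  have hVU : V ⊆ U := fun z hz => (hVu z hz).2
  obtain ⟨v, s₀, hv, hs₀, hvs⟩ := exists_eq_add_sq_mul hV hPV hud
  obtain ⟨Φ₀, s₁, hΦ₀, hs₁, hφs⟩ := exists_eq_add_sq_mul hV hPV (hφ.mono hVU)
  simp only [← hqP] at hvs hφs
  have hRd : Differentiable ℂ R := differentiableOn_univ.mp hR
  -- The entire remainder `v` of `u` modulo `q²` is moved into the prefactor, so the Wronskian of
  -- `φ` and `q` becomes `r exp (q² s₀)` near `K`.
  set r : ℂ → ℂ := fun z => R z * exp (v z) with hr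
  have hrd : Differentiable ℂ r := by fun_prop
  have hr0 : ∀ z, r z ≠ 0 := fun z => mul_ne_zero (hR0 z (mem_univ z)) (exp_ne_zero _)
  have hΦ₀' : Differentiable ℂ (deriv Φ₀) := fun z =>
    (hΦ₀.differentiableOn.deriv isOpen_univ).differentiableAt univ_mem
  have hs₁a : ∀ z ∈ V, DifferentiableAt ℂ s₁ z := fun z hz => hs₁.differentiableAt (hV.mem_nhds hz)
  have hW : ∀ z ∈ V, deriv φ z * q z - φ z * deriv q z = r z * exp (q z ^ 2 * s₀ z) :=
    fun z hz => (hVu z hz).1.2.trans (by rw [hvs z, exp_add, hr, mul_assoc])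
  have hφ' : ∀ z ∈ V, deriv φ z
      = deriv Φ₀ z + (2 * q z * deriv q z * s₁ z + q z ^ 2 * deriv s₁ z) := fun z hz => by
    have h1 := (((hq z).hasDerivAt.pow 2).mul (hs₁a z hz).hasDerivAt)
    have h2 := ((hΦ₀ z).hasDerivAt.add h1).deriv
    have h3 : φ = Φ₀ + q ^ 2 * s₁ := funext hφs
    rw [h3, h2]
    simp
  have hθd : DifferentiableOn ℂ (fun z => theta 0 r q z (s₀ z)) V :=
    LocUniv.DifferentiableOn.theta (differentiableOn_const _) hrd.differentiableOn
      hq.differentiableOn hs₀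
  have hθ : ∀ z x, q z ^ 2 * theta 0 r q z x = r z * exp (q z ^ 2 * x) - r z := fun z x => by
    have := mul_expSlope (q z ^ 2 * x)
    simp only [theta, Pi.zero_apply]
    linear_combination r z * this
  -- The Wronskian of the remainder `Φ₀` with `q` agrees with `r` modulo `q²`; `t` is the entire
  -- quotient of the difference. In the ansatz `ψ = g q + Φ₀ + q T` with `T' = t`, the Wronskian is
  -- `r exp (q² s)` exactly when `g' = theta 0 r q z s`, off the zeros of `q`.
  obtain ⟨t, ht, htF, htV⟩ := differentiable_of_eqOn_div hV
    (F := fun z => r z - (deriv Φ₀ z * q z - Φ₀ z * deriv q z)) (Q := fun z => q z ^ 2)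
    (τ := fun z => deriv q z * s₁ z + q z * deriv s₁ z - theta 0 r q z (s₀ z))
    (by fun_prop) (by fun_prop) (fun z h0 => hKV (hqK z (pow_eq_zero_iff two_ne_zero |>.mp h0)))
    (((hq'.differentiableOn.fun_mul hs₁).fun_add
      (hq.differentiableOn.fun_mul (hs₁.deriv hV))).fun_sub hθd)
    (fun z hz => by
      have h1 := hW z hz
      rw [hφ' z hz, hφs z] at h1
      linear_combination -h1 + hθ z (s₀ z))
  obtain ⟨T, hT⟩ := ht.isExactOn_univ
  have hT : ∀ z, HasDerivAt T (t z) z := fun z => hT z (mem_univ z)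
  have hsol : SolNear 0 r q K s₀ (fun z => q z * s₁ z - T z) := by
    filter_upwards [hV.mem_nhdsSet.mpr hKV] with z hz
    refine ⟨hs₀.differentiableAt (hV.mem_nhds hz), ?_⟩
    refine (((hq z).hasDerivAt.fun_mul (hs₁a z hz).hasDerivAt).fun_sub (hT z)).congr_deriv ?_
    rw [htV z hz]
    ring
  obtain ⟨s, g, -, hg, hgK⟩ := exists_sol_approx isOpen_univ (differentiableOn_const _)
    hrd.differentiableOn hq.differentiableOn (fun z _ => hr0 z) (fun z _ => hqK z) hK
    (subset_univ K) hKΩ hsol hε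
  have hψ : ∀ z, HasDerivAt (fun z => g z * q z + (Φ₀ z + q z * T z))
      (theta 0 r q z (s z) * q z + g z * deriv q z
        + (deriv Φ₀ z + (deriv q z * T z + q z * t z))) z := fun z =>
    ((hg z (mem_univ z)).fun_mul (hq z).hasDerivAt).fun_add
      ((hΦ₀ z).hasDerivAt.fun_add ((hq z).hasDerivAt.fun_mul (hT z)))
  refine ⟨fun z => g z * q z + (Φ₀ z + q z * T z), fun z => (hψ z).differentiableAt, fun z => ?_,
    fun z hz => ⟨g z - (q z * s₁ z - T z), ?_, hgK z hz⟩⟩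
  · have : deriv (fun z => g z * q z + (Φ₀ z + q z * T z)) z * q z
        - (g z * q z + (Φ₀ z + q z * T z)) * deriv q z = r z * exp (q z ^ 2 * s z) := by
      rw [(hψ z).deriv]
      linear_combination hθ z (s z) - htF z
    rw [this]
    exact mul_ne_zero (hr0 z) (exp_ne_zero _)
  · rw [hφs z]
    ring

end LocUniv

end

/-! ### Part (b): sphere-valued functions and meromorphic approximation. -/

noncomputable section

namespace LocUniv

open Complex

theorem chordal_coe_le (z w : ℂ) : chordal (z : Sphere) (w : Sphere) ≤ ‖z - w‖ := by
  have h : ∀ x : ℂ, 1 ≤ √(1 + ‖x‖ ^ 2) := fun x => Real.one_le_sqrt.mpr (by simp)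
  exact div_le_self (norm_nonneg _) (one_le_mul_of_one_le_of_one_le (h z) (h w))

theorem finitePart_coe {f : ℂ → Sphere} {z : ℂ} (h : f z ≠ OnePoint.infty) :
    (finitePart f z : Sphere) = f z := by
  obtain ⟨x, hx⟩ := OnePoint.ne_infty_iff_exists.mp h
  simp only [finitePart, ← hx]
  rfl

theorem continuousAt_finitePart {f : ℂ → Sphere} {z : ℂ} (hf : ContinuousAt f z)
    (h : f z ≠ OnePoint.infty) : ContinuousAt (finitePart f) z := by
  refine (OnePoint.isOpenEmbedding_coe (X := ℂ)).isInducing.continuousAt_iff.mpr ?_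
  refine hf.congr ?_
  filter_upwards [hf.eventually_ne h] with w hw using (finitePart_coe hw).symm

theorem tendsto_finitePart_cobounded {f : ℂ → Sphere} {z : ℂ} (hf : ContinuousAt f z)
    (h : f z = OnePoint.infty) (hne : ∀ᶠ w in 𝓝[≠] z, f w ≠ OnePoint.infty) :
    Tendsto (finitePart f) (𝓝[≠] z) (Bornology.cobounded ℂ) := by
  rw [Metric.cobounded_eq_cocompact, ← coclosedCompact_eq_cocompact,
    ← OnePoint.comap_coe_nhds_infty, tendsto_comap_iff, ← h]
  refine (hf.tendsto.mono_left nhdsWithin_le_nhds).congr' ?_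
  filter_upwards [hne] with w hw using (finitePart_coe hw).symm

/-- The sphere-valued quotient `ψ / q`, with poles at the zeros of `q`. -/
def sphereDiv (ψ q : ℂ → ℂ) (z : ℂ) : Sphere :=
  open Classical in if q z = 0 then OnePoint.infty else ((ψ z / q z : ℂ) : Sphere)

theorem sphereDiv_of_eq_zero {ψ q : ℂ → ℂ} {z : ℂ} (h : q z = 0) :
    sphereDiv ψ q z = OnePoint.infty := if_pos h

theorem sphereDiv_of_ne_zero {ψ q : ℂ → ℂ} {z : ℂ} (h : q z ≠ 0) :
    sphereDiv ψ q z = ((ψ z / q z : ℂ) : Sphere) := if_neg h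

theorem finitePart_sphereDiv (ψ q : ℂ → ℂ) : finitePart (sphereDiv ψ q) = ψ / q := by
  funext z
  by_cases h : q z = 0
  · simp only [finitePart, sphereDiv_of_eq_zero h, Pi.div_apply, h, div_zero]
    rfl
  · simp only [finitePart, sphereDiv_of_ne_zero h, Pi.div_apply]
    rfl

theorem meromorphicOrderAt_eq_one {q : ℂ → ℂ} {z : ℂ} (hq : AnalyticAt ℂ q z) (h : q z = 0)
    (hd : deriv q z ≠ 0) : meromorphicOrderAt q z = ((1 : ℤ) : WithTop ℤ) := by
  rw [hq.meromorphicOrderAt_eq, hq.analyticOrderAt_eq_one_of_zero_deriv_ne_zero h hd]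
  rfl

/-- Quotients of entire functions with nowhere vanishing Wronskian are locally univalent. -/
theorem sphereDiv_mem_mlu {ψ q : ℂ → ℂ} (hψ : Differentiable ℂ ψ) (hq : Differentiable ℂ q)
    (hW : ∀ z, deriv ψ z * q z - ψ z * deriv q z ≠ 0) : sphereDiv ψ q ∈ MLU univ := by
  have hq0 : ∀ z, ∀ᶠ w in 𝓝[≠] z, q w ≠ 0 := fun z => by
    rcases (hq.analyticAt z).eventually_eq_zero_or_eventually_ne_zero with h | h
    · refine absurd ?_ (hW z)
      have h' : q =ᶠ[𝓝 z] fun _ => 0 := h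
      rw [h'.deriv_eq, h.self_of_nhds]
      simp
    · exact h
  have hmer : ∀ z, MeromorphicAt (finitePart (sphereDiv ψ q)) z := fun z => by
    rw [finitePart_sphereDiv]
    exact (hψ.analyticAt z).meromorphicAt.div (hq.analyticAt z).meromorphicAt
  refine ⟨univ, isOpen_univ, subset_rfl, fun z _ => ⟨?_, hmer z, ?_⟩, fun z _ hz => ?_,
    fun z _ hz => ?_⟩
  · filter_upwards [hq0 z] with w hw
    rw [sphereDiv_of_ne_zero hw]
    exact OnePoint.coe_ne_infty _
  · by_cases h : q z = 0
    · have hψ0 : ψ z ≠ 0 := fun h0 => hW z (by rw [h, h0]; simp)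
      have hlim : Tendsto (fun w => ψ w / q w) (𝓝[≠] z) (Bornology.cobounded ℂ) := by
        have h1 : Tendsto (fun w => q w / ψ w) (𝓝[≠] z) (𝓝[≠] 0) := by
          refine tendsto_nhdsWithin_iff.mpr ⟨?_, ?_⟩
          · have := ((hq z).continuousAt.div (hψ z).continuousAt hψ0).tendsto
            rw [Pi.div_apply, h, zero_div] at this
            exact this.mono_left nhdsWithin_le_nhds
          · filter_upwards [hq0 z, ((hψ z).continuousAt.eventually_ne hψ0).filter_mono
              nhdsWithin_le_nhds] with w h1 h2 using div_ne_zero h1 h2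
        refine (tendsto_inv₀_nhdsNE_zero.comp h1).congr fun w => ?_
        simp
      rw [Metric.cobounded_eq_cocompact, ← coclosedCompact_eq_cocompact] at hlim
      rw [continuousAt_iff_punctured_nhds, sphereDiv_of_eq_zero h]
      refine (OnePoint.tendsto_coe_infty.comp hlim).congr' ?_
      filter_upwards [hq0 z] with w hw using (sphereDiv_of_ne_zero hw).symm
    · have hc : ContinuousAt (fun w => ((ψ w / q w : ℂ) : Sphere)) z :=
        (OnePoint.continuous_coe.continuousAt).comp
          ((hψ z).continuousAt.div (hq z).continuousAt h)
      refine hc.congr ?_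
      filter_upwards [(hq z).continuousAt.eventually_ne h] with w hw
      exact (sphereDiv_of_ne_zero hw).symm
  · have h : q z = 0 := by
      by_contra h
      rw [sphereDiv_of_ne_zero h] at hz
      exact OnePoint.coe_ne_infty _ hz
    have hψ0 : ψ z ≠ 0 := fun h0 => hW z (by rw [h, h0]; simp)
    have hq' : deriv q z ≠ 0 := fun h0 => hW z (by rw [h, h0]; simp)
    rw [finitePart_sphereDiv, meromorphicOrderAt_div (hψ.analyticAt z).meromorphicAt
      (hq.analyticAt z).meromorphicAt, meromorphicOrderAt_eq_one (hq.analyticAt z) h hq',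
      (hψ.analyticAt z).meromorphicOrderAt_eq,
      (hψ.analyticAt z).analyticOrderAt_eq_zero.mpr hψ0]
    rfl
  · have h : q z ≠ 0 := fun h => hz (sphereDiv_of_eq_zero h)
    rw [finitePart_sphereDiv, deriv_div (hψ z) (hq z) h]
    exact div_ne_zero (hW z) (pow_ne_zero 2 h)

theorem finite_poles {f : ℂ → Sphere} {K : Set ℂ} (hK : IsCompact K)
    (hf : ∀ z ∈ K, ∀ᶠ w in 𝓝[≠] z, f w ≠ OnePoint.infty) :
    {z ∈ K | f z = OnePoint.infty}.Finite := by
  by_contra h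
  obtain ⟨z, hz, hacc⟩ := Set.Infinite.exists_accPt_of_subset_isCompact h hK (sep_subset _ _)
  rw [accPt_iff_frequently_nhdsNE] at hacc
  exact hacc ((hf z hz).mono fun w hw hw' => hw hw'.2)

/-- Near a compact set, a locally univalent meromorphic function is a quotient `φ / ∏ (z - p)` over
its poles `p`, with nonvanishing Wronskian. -/
theorem exists_numerator {K : Set ℂ} (hK : IsCompact K) {f : ℂ → Sphere} (hf : f ∈ MLU K) :
    ∃ (U : Set ℂ) (P : Finset ℂ) (φ q : ℂ → ℂ), IsOpen U ∧ K ⊆ U ∧ (∀ p ∈ P, p ∈ K) ∧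
      (∀ z, q z = ∏ p ∈ P, (z - p)) ∧ DifferentiableOn ℂ φ U ∧
      (∀ z ∈ K, deriv φ z * q z - φ z * deriv q z ≠ 0) ∧ ∀ z ∈ K, f z = sphereDiv φ q z := by
  classical
  obtain ⟨U₀, hU₀, hKU₀, hmero, hord, hder⟩ := hf
  have hfin := finite_poles hK fun z hz => (hmero z (hKU₀ hz)).1
  set P : Finset ℂ := hfin.toFinset with hPdef
  have hP : ∀ p, p ∈ P ↔ p ∈ K ∧ f p = OnePoint.infty := fun p => by simp [hPdef]
  set q : ℂ → ℂ := fun z => ∏ p ∈ P, (z - p) with hq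
  have hqd : Differentiable ℂ q := by fun_prop
  have hq0 : ∀ z, q z = 0 ↔ z ∈ P := fun z => by
    simp only [hq, Finset.prod_eq_zero_iff, sub_eq_zero]
    exact ⟨fun ⟨p, hp, h⟩ => h ▸ hp, fun h => ⟨z, h, rfl⟩⟩
  have hq' : ∀ p ∈ P, deriv q p ≠ 0 := fun p hp => by
    have h1 : q = fun z => (z - p) * ∏ x ∈ P.erase p, (z - x) :=
      funext fun z => (Finset.mul_prod_erase P (fun x => z - x) hp).symm
    have h2 : DifferentiableAt ℂ (fun z => ∏ x ∈ P.erase p, (z - x)) p := by fun_prop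
    have h3 := ((hasDerivAt_id' p).sub_const p).fun_mul h2.hasDerivAt
    rw [h1, h3.deriv]
    simp only [one_mul, sub_self, zero_mul, add_zero]
    exact Finset.prod_ne_zero_iff.mpr fun x hx => sub_ne_zero.mpr (Finset.ne_of_mem_erase hx).symm
  -- Poles outside `K` are discarded. The set stays open because poles are isolated.
  set U : Set ℂ := {z ∈ U₀ | f z = OnePoint.infty → z ∈ P} with hUdef
  have hU : IsOpen U := isOpen_iff_mem_nhds.mpr fun z hz => by
    by_cases h : f z = OnePoint.infty
    · have h1 := eventually_nhdsWithin_iff.mp (hmero z hz.1).1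
      filter_upwards [hU₀.mem_nhds hz.1, h1] with w hw hw1
      refine ⟨hw, fun hwf => ?_⟩
      by_cases hwz : w = z
      · exact hwz ▸ hz.2 h
      · exact absurd hwf (hw1 hwz)
    · filter_upwards [hU₀.mem_nhds hz.1, (hmero z hz.1).2.2.eventually_ne h] with w hw hw1
      exact ⟨hw, fun hwf => absurd hwf hw1⟩
  have hKU : K ⊆ U := fun z hz => ⟨hKU₀ hz, fun h => (hP z).mpr ⟨hz, h⟩⟩
  set h : ℂ → ℂ := q * finitePart f with hh
  have hqm : ∀ z, MeromorphicAt q z := fun z => (hqd.analyticAt z).meromorphicAt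
  have hmer : MeromorphicOn h U := fun z hz => (hqm z).mul (hmero z hz.1).2.1
  have hfc : ∀ z ∈ U, z ∉ P → ContinuousAt (finitePart f) z := fun z hz hzP =>
    continuousAt_finitePart (hmero z hz.1).2.2 fun hf => hzP (hz.2 hf)
  have han : ∀ z ∈ U, z ∉ P → AnalyticAt ℂ h z := fun z hz hzP =>
    (hmer z hz).analyticAt ((hqd z).continuousAt.mul (hfc z hz hzP))
  set φ : ℂ → ℂ := toMeromorphicNFOn h U with hφdef
  have hNF : MeromorphicNFOn φ U := meromorphicNFOn_toMeromorphicNFOn h U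
  have hordφ : ∀ z ∈ U, meromorphicOrderAt φ z = meromorphicOrderAt h z := fun z hz =>
    meromorphicOrderAt_toMeromorphicNFOn hmer hz
  -- The order of `f` at a pole is negative and at least `-1`, hence exactly `-1`, and the simple
  -- zero of `q` cancels it.
  have hordP : ∀ z ∈ U, z ∈ P → meromorphicOrderAt φ z = 0 := fun z hz hzP => by
    have hinf := ((hP z).mp hzP).2
    have h1 := hord z hz.1 hinf
    have h2 := (tendsto_cobounded_iff_meromorphicOrderAt_neg (hmero z hz.1).2.1).mp
      (tendsto_finitePart_cobounded (hmero z hz.1).2.2 hinf (hmero z hz.1).1)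
    rw [hordφ z hz, hh, meromorphicOrderAt_mul (hqm z) (hmero z hz.1).2.1,
      meromorphicOrderAt_eq_one (hqd.analyticAt z) ((hq0 z).mpr hzP) (hq' z hzP)]
    obtain ⟨n, hn⟩ := WithTop.ne_top_iff_exists.mp (h2.trans_le le_top).ne
    rw [← hn] at h1 h2 ⊢
    have h1' : -1 ≤ n := WithTop.coe_le_coe.mp h1
    have h2' : n < 0 := WithTop.coe_lt_coe.mp h2
    have : n = -1 := by omega
    rw [this]
    rfl
  have hφa : ∀ z ∈ U, AnalyticAt ℂ φ z := fun z hz => by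
    refine (hNF hz).meromorphicOrderAt_nonneg_iff_analyticAt.mp ?_
    by_cases hzP : z ∈ P
    · exact (hordP z hz hzP).ge
    · rw [hordφ z hz]
      exact (han z hz hzP).meromorphicOrderAt_nonneg
  have hφh : ∀ z ∈ U, z ∉ P → φ =ᶠ[𝓝 z] h := fun z hz hzP => by
    have h1 : φ =ᶠ[𝓝[≠] z] h := hmer.toMeromorphicNFOn_eq_self_on_nhdsNE hz
    exact ((hφa z hz).continuousAt.eventuallyEq_nhds_iff_eventuallyEq_nhdsNE
      (han z hz hzP).continuousAt).mp h1
  refine ⟨U, P, φ, q, hU, hKU, fun p hp => ((hP p).mp hp).1, fun _ => rfl,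
    fun z hz => (hφa z hz).differentiableAt.differentiableWithinAt, fun z hz => ?_, fun z hz => ?_⟩
  · by_cases hzP : z ∈ P
    · have h1 : φ z ≠ 0 := (hNF (hKU hz)).meromorphicOrderAt_eq_zero_iff.mp (hordP z (hKU hz) hzP)
      rw [(hq0 z).mpr hzP, mul_zero, zero_sub]
      exact neg_ne_zero.mpr (mul_ne_zero h1 (hq' z hzP))
    · have hne : f z ≠ OnePoint.infty := fun h => hzP ((hP z).mpr ⟨hz, h⟩)
      have hfd : DifferentiableAt ℂ (finitePart f) z :=
        ((hmero z (hKU₀ hz)).2.1.analyticAt (hfc z (hKU hz) hzP)).differentiableAt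
      have hqz : q z ≠ 0 := fun h0 => hzP ((hq0 z).mp h0)
      have e := hφh z (hKU hz) hzP
      -- Away from the poles `φ = q f`, so the Wronskian is `q² f'`.
      have : deriv φ z * q z - φ z * deriv q z = q z ^ 2 * deriv (finitePart f) z := by
        rw [e.deriv_eq, e.self_of_nhds, hh, deriv_mul (hqd z) hfd, Pi.mul_apply]
        ring
      rw [this]
      exact mul_ne_zero (pow_ne_zero 2 hqz) (hder z (hKU₀ hz) hne)
  · by_cases hzP : z ∈ P
    · rw [sphereDiv_of_eq_zero ((hq0 z).mpr hzP), ((hP z).mp hzP).2]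
    · have hne : f z ≠ OnePoint.infty := fun h => hzP ((hP z).mpr ⟨hz, h⟩)
      have hqz : q z ≠ 0 := fun h0 => hzP ((hq0 z).mp h0)
      rw [sphereDiv_of_ne_zero hqz, (hφh z (hKU hz) hzP).self_of_nhds, hh, Pi.mul_apply,
        mul_div_cancel_left₀ _ hqz, finitePart_coe hne]

/-- Runge approximation by locally univalent meromorphic functions in the chordal metric. -/
theorem exists_mlu_approx {K : Set ℂ} (hK : IsCompact K) (hKΩ : RungeIn K univ)
    {f : ℂ → Sphere} (hf : f ∈ MLU K) {ε : ℝ} (hε : 0 < ε) :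
    ∃ g ∈ MLU univ, ∀ z ∈ K, chordal (g z) (f z) < ε := by
  obtain ⟨U, P, φ, q, hU, hKU, hPK, hqP, hφ, hW, hfφ⟩ := exists_numerator hK hf
  obtain ⟨ψ, hψ, hWψ, hψK⟩ := exists_numerator_approx hK hKΩ hU hKU hPK hqP hφ hW hε
  have hq : Differentiable ℂ q := by
    have : q = fun z => ∏ p ∈ P, (z - p) := funext hqP
    rw [this]
    fun_prop
  refine ⟨sphereDiv ψ q, sphereDiv_mem_mlu hψ hq hWψ, fun z hz => ?_⟩
  rw [hfφ z hz]
  -- On the zeros of `q` both functions are infinite and the distance is zero by definition;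
  -- elsewhere the Euclidean distance dominates.
  by_cases h : q z = 0
  · rw [sphereDiv_of_eq_zero h, sphereDiv_of_eq_zero h]
    exact hε
  · rw [sphereDiv_of_ne_zero h, sphereDiv_of_ne_zero h]
    refine (chordal_coe_le _ _).trans_lt ?_
    obtain ⟨d, hd, hdε⟩ := hψK z hz
    rwa [← sub_div, hd, mul_div_cancel_left₀ _ h]

end LocUniv

end

theorem mainTheorem1 (Ω K : Set ℂ) (hΩ : IsOpen Ω) (hΩc : IsConnected Ω)
    (hK : IsCompact K) (hKΩ : K ⊆ Ω)
    (hcomp : ∀ z ∈ Ω \ K, ¬ LocUniv.RelCompactIn (connectedComponentIn (Ω \ K) z) Ω) :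
    (∀ f ∈ LocUniv.HLU K, ∀ ε > (0 : ℝ), ∃ g ∈ LocUniv.HLU Ω,
      ∀ z ∈ K, ‖g z - f z‖ < ε) ∧
    (IsConnected Kᶜ → ∀ f ∈ LocUniv.MLU K, ∀ ε > (0 : ℝ), ∃ g ∈ LocUniv.MLU Set.univ,
      ∀ z ∈ K, LocUniv.chordal (g z) (f z) < ε) := by
  have hR := LocUniv.rungeIn_of_not_relCompactIn hKΩ hcomp
  exact ⟨fun f hf ε hε => LocUniv.exists_hlu_approx hΩ hK hKΩ hR hf hε, fun hc f hf ε hε =>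
    LocUniv.exists_mlu_approx hK (LocUniv.rungeIn_univ_of_isConnected_compl hK hc) hf hε⟩
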